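/- There are absolute constants $C_1,C_2>0$ such that the following holds. Let $k,n\ge 0$ and $d_1,\dots,d_k\ge 0$ be integers, and for $1\le j\le k$ let $A^j=(A^j_s)_{s\in S_j}$ be a tensor-valued polynomial on $\mathbb R^n$ of degree at most $d_j$, i.e. a tensor, with finite (multi-)index set $S_j$, whose coordinates $A^j_s$ are real polynomials on $\mathbb R^n$ of total degree at most $d_j$. For a tensor $B$ let $|B|_2$ be the square root of the sum of the squares of its coordinates, and let $\bigwedge_{i_1,\dots,i_k}\prod_{j=1}^k D_{i_j}A^j_{S_j}(x)$ denote the tensor with indices $i_1,\dots,i_k\in\{1,\dots,n\}$, $s_1\in S_1,\dots,s_k\in S_k$ and coordinates $$\sum_{\sigma\in\mathfrak S_k}\operatorname{sgn}(\sigma)\prod_{j=1}^k\frac{\partial A^j_{s_j}}{\partial x_{i_{\sigma(j)}}}(x).$$ Let $X$ be a standard Gaussian vector in $\mathbb R^n$. Then for every real $\epsilon$ with $0<\epsilon<1/2$, $$\Pr\left(\prod_{j=1}^k|A^j(X)|_2<\epsilon\left|\bigwedge_{i_1,\dots,i_k}\prod_{j=1}^kD_{i_j}A^j_{S_j}(X)\right|_2\right)\le\epsilon\,2^{C_1(d_1+\cdots+d_k)}\,\bigl(C_2\sqrt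 k\bigr)^{k+1}\,\log(\epsilon^{-1})^k .$$ -/

import Mathlib

open MeasureTheory ProbabilityTheory

namespace StrongAnticoncentration

/-- A real tensor, given by its coordinates. `I` is the finite set of (multi-)indices; for an
`r`-tensor of dimensions `m₁, …, m_r` it is `(l : Fin r) → Fin (m l)`. -/
abbrev Tensor (I : Type*) := I → ℝ

/-- The `L²` norm of a tensor: the square root of the sum of the squares of its coordinates. -/
noncomputable def norm2 {I : Type*} [Fintype I] (A : Tensor I) : ℝ :=
  Real.sqrt (∑ i, A i ^ 2)

/-- The wedge product of a tensor over its first `k` indices (all ranging over `I`), the remaining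
indices being collected in `T`:
`(⋀_{i₁,…,i_k} B)_{i₁,…,i_k,t} = ∑_{σ ∈ S_k} sgn(σ) B_{i_{σ(1)},…,i_{σ(k)},t}`. -/
noncomputable def wedge {k : ℕ} {I T : Type*} (B : Tensor ((Fin k → I) × T)) :
    Tensor ((Fin k → I) × T) :=
  fun q => ∑ σ : Equiv.Perm (Fin k),
    ((Equiv.Perm.sign σ : ℤ) : ℝ) * B (fun j => q.1 (σ j), q.2)

/-- The tensor product `∏_j (B^j)_{i_j, s_j}`, with the indices `i_1, …, i_k` listed first. -/
noncomputable def tensorProd {k : ℕ} {I : Type*} {S : Fin k → Type*}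
    (B : (j : Fin k) → Tensor (I × S j)) : Tensor ((Fin k → I) × ((j : Fin k) → S j)) :=
  fun q => ∏ j, B j (q.1 j, q.2 j)

/-- A tensor-valued polynomial on `ℝⁿ`: a tensor whose coordinates are real polynomials. -/
abbrev TensorPoly (n : ℕ) (S : Type*) := S → MvPolynomial (Fin n) ℝ

/-- The value `A(x)` of a tensor-valued polynomial at `x ∈ ℝⁿ`. -/
noncomputable def evalAt {n : ℕ} {S : Type*} (A : TensorPoly n S) (x : Fin n → ℝ) : Tensor S :=
  fun s => MvPolynomial.eval x (A s)

/-- The derivative `D_i A_s = ∂A_s / ∂x_i`, with indices `(i, s)`. -/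
noncomputable def derivative {n : ℕ} {S : Type*} (A : TensorPoly n S) :
    TensorPoly n (Fin n × S) :=
  fun p => MvPolynomial.pderiv p.1 (A p.2)

/-- The law of a standard Gaussian vector in `ℝⁿ`: independent `N(0,1)` coordinates. -/
noncomputable def gaussian (n : ℕ) : Measure (Fin n → ℝ) :=
  Measure.pi fun _ => gaussianReal 0 1

end StrongAnticoncentration

/-! Restrict to the region where every `δ j ≤ |A^j| ≤ M j`. There Markov's inequality reduces the
claim to an upper bound for the Gaussian mean of `|⋀ DA| / ∏ max(δ j, |A^j|)`, and
`lintegral_norm2_wedgeDeriv_le` bounds it by a constant times `∏ log (2 M j / δ j)`.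

To make this mean scalar, contract each `A^j` with an independent Gaussian vector `g_j`, and the
derivative slots with independent Gaussian directions `Y_1, …, Y_k`. The wedge becomes the Jacobian
determinant `det (D_{Y_a} p_b)` of the scalar polynomials `p_b = ⟨g_b, A^b⟩`, and `1 / max(δ, |A|)`
is replaced by a weight `w(p_b)`, with `w(t)` like `1/|t|` but regularised near zero and at
infinity. Nothing is lost beyond a factor `100 ^ k`, because the first moment of a Gaussian
combination of tensors is comparable to its second, even in the presence of such weights
(`le_lintegral_norm2_multiContract`).

For fixed `g`, `lintegral_jacobian_le` bounds the weighted Jacobian. The joint law of `X, Y_1, …,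
Y_k` is invariant under orthogonal mixing, so `X` may be replaced by `∑ u_a G_a`, with the `G_a`
independent standard Gaussians and `u` averaged over directions in `ℝ^(k+1)`. On the unit sphere of
`u`, the polynomials `p_b` take prescribed values at no more than `2 ∏ max(d_b, 1)` nondegenerate
points, by Bézout (`card_nondegenerate_zeros_le`). The area formula then leaves the one-dimensional
integrals `∫ w`, each of which is logarithmic in `M / δ`.

The region outside the truncation is handled by Chebyshev's inequality above and by
`measure_small_ball_le` below. The latter is an induction on the degree: either the derivative has
small energy and the Poincaré inequality makes `A` nearly constant, or the derivative is itself
rarely small by induction, and the case `k = 1` of the main estimate shows that `A` is rarely small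
where its derivative is large. Since `δ j` is a power of `ε` with exponent `2 d_j`, each logarithm
is at most `4 * 2 ^ d_j * log ε⁻¹`. -/

namespace StrongAnticoncentration
open MvPolynomial

/-! ### Bézout's bound for nondegenerate real zeros, by dimension counting. -/

section Bezout
variable {m : ℕ}

/-- Interpolation polynomials at a finite set of points. -/
theorem exists_interpolation (Z : Finset (Fin m → ℝ)) :
    ∃ h : (Fin m → ℝ) → MvPolynomial (Fin m) ℝ,
      ∀ z ∈ Z, ∀ z' ∈ Z, eval z' (h z) = if z' = z then 1 else 0 := by
  classical
  -- The factor for `y` is `⟨x - y, z - y⟩ / |z - y|²`, an affine function of `x` that is `0` at `y`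
  -- and `1` at `z`.
  refine ⟨fun z => ∏ y ∈ Z.erase z, (C ((∑ i, (z i - y i) ^ 2)⁻¹) *
    ∑ i, (X i - C (y i)) * C (z i - y i)), fun z hz z' hz' => ?_⟩
  rw [map_prod]
  split_ifs with h
  · subst h
    refine Finset.prod_eq_one fun y hy => ?_
    have hne : (∑ i, (z' i - y i) ^ 2) ≠ 0 := by
      intro h0
      rw [Finset.sum_eq_zero_iff_of_nonneg (fun i _ => sq_nonneg _)] at h0
      apply (Finset.mem_erase.1 hy).1
      funext i
      have := h0 i (Finset.mem_univ i)
      nlinarith [pow_eq_zero_iff (two_ne_zero) |>.1 this]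
    simp only [map_mul, eval_C, map_sum, map_sub, eval_X]
    simp_rw [← sq]
    exact inv_mul_cancel₀ hne
  · apply Finset.prod_eq_zero (i := z') (Finset.mem_erase.2 ⟨h, hz'⟩)
    simp

/-- Substituting `X * u` into a polynomial whose homogeneous components of degree `< e` vanish. -/
theorem X_pow_dvd_aeval_mul_sub (g : MvPolynomial (Fin m) ℝ) (u : Fin m → Polynomial ℝ) (e : ℕ)
    (hg : ∀ i < e, homogeneousComponent i g = 0) :
    (Polynomial.X : Polynomial ℝ) ^ (e + 1) ∣ aeval (fun j => Polynomial.X * u j) g -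
      Polynomial.X ^ e * aeval u (homogeneousComponent e g) := by
  have key : ∀ i, aeval (fun j => Polynomial.X * u j) (homogeneousComponent i g) =
      Polynomial.X ^ i * aeval u (homogeneousComponent i g) := by
    intro i
    have hh := homogeneousComponent_isHomogeneous i g
    rw [aeval_def, aeval_def, eval₂_eq, eval₂_eq, Finset.mul_sum]
    refine Finset.sum_congr rfl fun s hs => ?_
    have hs' := hh (mem_support_iff.1 hs)
    have : ∏ j ∈ s.support, (Polynomial.X * u j) ^ s j =
        Polynomial.X ^ i * ∏ j ∈ s.support, u j ^ s j := by
      simp_rw [mul_pow]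
      rw [Finset.prod_mul_distrib, Finset.prod_pow_eq_pow_sum]
      congr 2
      rw [← hs', Finsupp.weight_apply, Finsupp.sum]
      simp
    rw [this]; ring
  have hsum : aeval (fun j => Polynomial.X * u j) g = ∑ i ∈ Finset.range (g.totalDegree + 1),
      Polynomial.X ^ i * aeval u (homogeneousComponent i g) := by
    conv_lhs => rw [← sum_homogeneousComponent g]
    rw [map_sum]
    exact Finset.sum_congr rfl fun i _ => key i
  have hterm : ∀ i, i ≠ e → (Polynomial.X : Polynomial ℝ) ^ (e + 1) ∣
      Polynomial.X ^ i * aeval u (homogeneousComponent i g) := by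
    intro i hi
    rcases lt_or_gt_of_ne hi with h | h
    · rw [hg i h]; simp
    · exact Dvd.dvd.mul_right (pow_dvd_pow _ h) _
  rw [hsum]
  by_cases he : e ∈ Finset.range (g.totalDegree + 1)
  · rw [← Finset.add_sum_erase _ _ he, add_sub_cancel_left]
    exact Finset.dvd_sum fun i hi => hterm i (Finset.mem_erase.1 hi).1
  · have : homogeneousComponent e g = 0 := by
      apply homogeneousComponent_eq_zero
      simpa using he
    rw [this, map_zero, mul_zero, sub_zero]
    exact Finset.dvd_sum fun i hi => hterm i (by rintro rfl; exact he hi)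

/-- Derivative along a line of a polynomial, algebraically. -/
theorem eval_zero_derivative_aeval_line (p : MvPolynomial (Fin m) ℝ) (z v : Fin m → ℝ) :
    (Polynomial.derivative
      (aeval (fun i => Polynomial.C (z i) + Polynomial.X * Polynomial.C (v i)) p)).eval 0 =
      ∑ i, eval z (pderiv i p) * v i := by
  have hev : ∀ q : MvPolynomial (Fin m) ℝ,
      (aeval (fun i => Polynomial.C (z i) + Polynomial.X * Polynomial.C (v i)) q).eval 0 =
        eval z q := by
    intro q
    have : (Polynomial.evalRingHom (0:ℝ)).comp (aeval (R := ℝ) (fun i =>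
        Polynomial.C (z i) + Polynomial.X * Polynomial.C (v i))).toRingHom = eval z := by
      apply ringHom_ext <;> simp
    exact congrArg (fun r : MvPolynomial (Fin m) ℝ →+* ℝ => r q) this
  induction p using MvPolynomial.induction_on with
  | C a => simp
  | add p q hp hq =>
    simp only [map_add, Polynomial.eval_add, hp, hq, add_mul,
      Finset.sum_add_distrib]
  | mul_X p i hp =>
    simp only [map_mul, aeval_X, Polynomial.derivative_mul, Polynomial.eval_add,
      Polynomial.eval_mul, hp, hev, Derivation.leibniz, smul_eq_mul, map_add, pderiv_X, eval_X]
    simp only [Polynomial.derivative_C, Polynomial.derivative_X, Polynomial.eval_C,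
      Polynomial.eval_X, Polynomial.eval_zero, Polynomial.eval_one]
    simp only [add_mul, Finset.sum_add_distrib, Pi.single_apply, apply_ite (eval z), map_one,
      map_zero, mul_ite, ite_mul, mul_one, mul_zero, zero_mul, one_mul, Finset.sum_ite_eq, Finset.mem_univ, if_true]
    rw [Finset.sum_mul]
    simp only [add_zero, zero_add]
    rw [add_comm]
    congr 1
    exact Finset.sum_congr rfl fun j _ => by ring

/-- Near a nondegenerate zero the `f j` behave as local coordinates, so they satisfy no polynomial
relation there, and the interpolating `h z` decouple the different zeros. Formally, one kills the
homogeneous components of all `g z` degree by degree. Along the line `z₀ + X v` one has `f j = X * u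
j` with `u(0) = J v`. Once the components below degree `e` are gone, dividing the relation by `X ^
e` and setting `X = 0` leaves only the degree `e` component of `g z₀` evaluated at `J v`, and `J` is
onto. -/
theorem independence_at_nondegenerate_zeros (f : Fin m → MvPolynomial (Fin m) ℝ)
    (Z : Finset (Fin m → ℝ)) (hz : ∀ z ∈ Z, ∀ j, eval z (f j) = 0)
    (hJ : ∀ z ∈ Z, (Matrix.of fun j i => eval z (pderiv i (f j))).det ≠ 0)
    (h : (Fin m → ℝ) → MvPolynomial (Fin m) ℝ)
    (hh : ∀ z ∈ Z, ∀ z' ∈ Z, eval z' (h z) = if z' = z then 1 else 0)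
    (g : (Fin m → ℝ) → MvPolynomial (Fin m) ℝ)
    (hg : ∑ z ∈ Z, h z * aeval f (g z) = 0) : ∀ z ∈ Z, g z = 0 := by
  have main : ∀ e : ℕ, ∀ z ∈ Z, homogeneousComponent e (g z) = 0 := by
    intro e
    induction e using Nat.strong_induction_on with
    | _ e ih =>
    intro z₀ hz₀
    have hvan : ∀ v : Fin m → ℝ, eval (fun j => ∑ i, eval z₀ (pderiv i (f j)) * v i)
        (homogeneousComponent e (g z₀)) = 0 := by
      intro v
      let φ : MvPolynomial (Fin m) ℝ →ₐ[ℝ] Polynomial ℝ :=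
        aeval (fun i => Polynomial.C (z₀ i) + Polynomial.X * Polynomial.C (v i))
      have hφ0 : ∀ q, (φ q).eval 0 = eval z₀ q := by
        intro q
        have : (Polynomial.evalRingHom (0:ℝ)).comp φ.toRingHom = eval z₀ := by
          apply ringHom_ext <;> simp [φ]
        exact congrArg (fun r : MvPolynomial (Fin m) ℝ →+* ℝ => r q) this
      let u : Fin m → Polynomial ℝ := fun j => (φ (f j)).divX
      have hu : ∀ j, φ (f j) = Polynomial.X * u j := by
        intro j
        have h1 := Polynomial.X_mul_divX_add (φ (f j))
        rw [Polynomial.coeff_zero_eq_eval_zero, hφ0, hz z₀ hz₀ j, map_zero, add_zero] at h1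
        exact h1.symm
      have hu0 : ∀ j, (u j).eval 0 = ∑ i, eval z₀ (pderiv i (f j)) * v i := by
        intro j
        rw [← eval_zero_derivative_aeval_line]
        change _ = (Polynomial.derivative (φ (f j))).eval 0
        rw [hu j]; simp
      have hcomp : ∀ q : MvPolynomial (Fin m) ℝ, φ (aeval f q) = aeval (fun j => Polynomial.X * u j) q := by
        intro q
        have : φ.comp (aeval (R := ℝ) f) = aeval (fun j => Polynomial.X * u j) := by
          apply algHom_ext; intro j; simp [hu]
        exact congrArg (fun r : MvPolynomial (Fin m) ℝ →ₐ[ℝ] _ => r q) this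
      have h0 : ∑ z ∈ Z, φ (h z) * aeval (fun j => Polynomial.X * u j) (g z) = 0 := by
        have := congrArg φ hg
        rw [map_sum, map_zero] at this
        rw [← this]
        exact Finset.sum_congr rfl fun z _ => by rw [map_mul, hcomp]
      have hdvd : (Polynomial.X : Polynomial ℝ) ^ (e + 1) ∣
          Polynomial.X ^ e * ∑ z ∈ Z, φ (h z) * aeval u (homogeneousComponent e (g z)) := by
        have h1 : (Polynomial.X : Polynomial ℝ) ^ (e + 1) ∣ ∑ z ∈ Z, φ (h z) *
            (aeval (fun j => Polynomial.X * u j) (g z) -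
              Polynomial.X ^ e * aeval u (homogeneousComponent e (g z))) :=
          Finset.dvd_sum fun z hz' => Dvd.dvd.mul_left
            (X_pow_dvd_aeval_mul_sub _ _ _ fun i hi => ih i hi z hz') _
        simp_rw [mul_sub] at h1
        rw [Finset.sum_sub_distrib, h0, zero_sub, dvd_neg] at h1
        rw [Finset.mul_sum]
        convert h1 using 2
        ring
      rw [pow_succ, mul_dvd_mul_iff_left (pow_ne_zero _ Polynomial.X_ne_zero),
        Polynomial.X_dvd_iff, Polynomial.coeff_zero_eq_eval_zero, Polynomial.eval_finsetSum] at hdvd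
      simp only [Polynomial.eval_mul, hφ0] at hdvd
      rw [Finset.sum_eq_single z₀] at hdvd
      · rw [hh z₀ hz₀ z₀ hz₀, if_pos rfl, one_mul] at hdvd
        rw [← hdvd]
        have : (Polynomial.evalRingHom (0:ℝ)).comp (aeval (R := ℝ) u).toRingHom =
            eval (fun j => ∑ i, eval z₀ (pderiv i (f j)) * v i) := by
          apply ringHom_ext <;> simp [hu0]
        exact (congrArg (fun r : MvPolynomial (Fin m) ℝ →+* ℝ => r _) this).symm
      · intro z hz' hne
        rw [hh z hz' z₀ hz₀, if_neg (Ne.symm hne), zero_mul]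
      · exact fun h => absurd hz₀ h
    apply MvPolynomial.funext
    intro w
    rw [map_zero]
    set J := Matrix.of fun j i => eval z₀ (pderiv i (f j)) with hJdef
    have hunit : IsUnit J.det := isUnit_iff_ne_zero.2 (hJ z₀ hz₀)
    have := hvan (J⁻¹.mulVec w)
    convert this using 2
    have h2 : J.mulVec (J⁻¹.mulVec w) = w := by
      rw [Matrix.mulVec_mulVec, Matrix.mul_nonsing_inv _ hunit, Matrix.one_mulVec]
    exact congrArg _ h2.symm
  intro z hz'
  rw [← sum_homogeneousComponent (g z)]
  exact Finset.sum_eq_zero fun i _ => main i z hz'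

/-- The exponents of total degree at most `D`. -/
def exponentsLE (m D : ℕ) : Finset (Fin m → ℕ) :=
  (Fintype.piFinset fun _ => Finset.range (D + 1)).filter fun β => ∑ i, β i ≤ D

theorem mem_exponentsLE {D : ℕ} {β : Fin m → ℕ} : β ∈ exponentsLE m D ↔ ∑ i, β i ≤ D := by
  simp only [exponentsLE, Finset.mem_filter, Fintype.mem_piFinset, Finset.mem_range,
    and_iff_right_iff_imp]
  intro h i
  have := Finset.single_le_sum (fun j _ => Nat.zero_le (β j)) (Finset.mem_univ i)
  omega

theorem card_exponentsLE_le (D : ℕ) : (exponentsLE m D).card ≤ (D + 1) ^ m := by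
  refine (Finset.card_filter_le _ _).trans ?_
  simp

/-- The products `h z * f ^ α` with `∑ α j * d j ≤ D` are linearly independent and have degree at
most `D + H`, where `H` bounds the degrees of the `h z`. This bounds `Z.card` times the number of
such `α` by a dimension. The number of such `α` is at least the number of exponents of degree `≤ D`
divided by `∏ d j`. -/
theorem card_zeros_mul_le (f : Fin m → MvPolynomial (Fin m) ℝ) (d : Fin m → ℕ)
    (hd : ∀ j, 1 ≤ d j) (hdeg : ∀ j, (f j).totalDegree ≤ d j)
    (Z : Finset (Fin m → ℝ)) (hz : ∀ z ∈ Z, ∀ j, eval z (f j) = 0)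
    (hJ : ∀ z ∈ Z, (Matrix.of fun j i => eval z (pderiv i (f j))).det ≠ 0) :
    ∃ H : ℕ, ∀ D : ℕ, Z.card * (exponentsLE m D).card ≤
      (∏ j, d j) * (exponentsLE m (D + H)).card := by
  classical
  obtain ⟨h, hh⟩ := exists_interpolation Z
  refine ⟨Z.sup fun z => (h z).totalDegree, fun D => ?_⟩
  set H := Z.sup fun z => (h z).totalDegree
  let S : Finset (Fin m → ℕ) := (exponentsLE m D).filter fun α => ∑ j, α j * d j ≤ D
  have hS : (exponentsLE m D).card ≤ S.card * ∏ j, d j := by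
    have : (S ×ˢ Fintype.piFinset fun j => Finset.range (d j)).card = S.card * ∏ j, d j := by
      simp
    rw [← this]
    -- Division with remainder in each coordinate: the quotient is an admissible `α`, and there are
    -- `∏ d j` possible remainders.
    refine Finset.card_le_card_of_injOn (fun β => (fun j => β j / d j, fun j => β j % d j))
      (fun β hβ => ?_) ?_
    · have hβ' := mem_exponentsLE.1 hβ
      simp only [Finset.coe_product, Set.mem_prod, Finset.mem_coe, S, Finset.mem_filter,
        Fintype.mem_piFinset, Finset.mem_range]
      refine ⟨⟨mem_exponentsLE.2 ?_, ?_⟩, fun j => Nat.mod_lt _ (hd j)⟩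
      · exact (Finset.sum_le_sum fun j _ => Nat.div_le_self _ _).trans hβ'
      · exact (Finset.sum_le_sum fun j _ => Nat.div_mul_le_self _ _).trans hβ'
    · intro β _ γ _ hβγ
      funext j
      have h1 := congrFun (congrArg Prod.fst hβγ) j
      have h2 := congrFun (congrArg Prod.snd hβγ) j
      simp only at h1 h2
      rw [← Nat.div_add_mod (β j) (d j), h1, h2, Nat.div_add_mod]
  let V : Finset (MvPolynomial (Fin m) ℝ) :=
    (exponentsLE m (D + H)).image fun β => monomial (Finsupp.equivFunOnFinite.symm β) 1
  have hV : ∀ p : MvPolynomial (Fin m) ℝ, p.totalDegree ≤ D + H →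
      p ∈ Submodule.span ℝ (V : Set (MvPolynomial (Fin m) ℝ)) := by
    intro p hp
    rw [p.as_sum]
    refine Submodule.sum_mem _ fun s hs => ?_
    rw [show monomial s (coeff s p) = (coeff s p) • (monomial s (1:ℝ)) by
      rw [smul_monomial, smul_eq_mul, mul_one]]
    refine Submodule.smul_mem _ _ (Submodule.subset_span ?_)
    simp only [V, Finset.coe_image, Set.mem_image, Finset.mem_coe]
    refine ⟨s, mem_exponentsLE.2 ?_, by congr 1; ext; simp⟩
    refine le_trans ?_ hp
    have := le_totalDegree hs
    rwa [Finsupp.sum_fintype _ _ (fun _ => rfl)] at this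
  let v : (Z × S) → MvPolynomial (Fin m) ℝ := fun q => h q.1 * ∏ j, f j ^ (q.2 : Fin m → ℕ) j
  have hvdeg : ∀ q, v q ∈ Submodule.span ℝ (V : Set (MvPolynomial (Fin m) ℝ)) := by
    intro q
    apply hV
    refine (totalDegree_mul _ _).trans ?_
    rw [add_comm D H]
    refine add_le_add (Finset.le_sup (f := fun z => (h z).totalDegree) q.1.2) ?_
    refine (totalDegree_finsetProd _ _).trans ?_
    refine le_trans (Finset.sum_le_sum fun j _ => (totalDegree_pow _ _).trans
      (Nat.mul_le_mul_left _ (hdeg j))) ?_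
    exact (Finset.mem_filter.1 q.2.2).2
  have hli : LinearIndependent ℝ v := by
    rw [Fintype.linearIndependent_iff]
    intro c hc
    let g : (Fin m → ℝ) → MvPolynomial (Fin m) ℝ := fun z =>
      if hz : z ∈ Z then ∑ α : S, monomial (Finsupp.equivFunOnFinite.symm α.1) (c (⟨z, hz⟩, α))
      else 0
    have hg : ∑ z ∈ Z, h z * aeval f (g z) = 0 := by
      rw [← hc, Fintype.sum_prod_type, ← Finset.sum_coe_sort Z]
      refine Finset.sum_congr rfl fun z _ => ?_
      simp only [g, z.2, dif_pos, map_sum, Finset.mul_sum]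
      refine Finset.sum_congr rfl fun α _ => ?_
      rw [aeval_monomial, Finsupp.prod_fintype _ _ (fun _ => pow_zero _)]
      simp only [v, Algebra.smul_def]
      simp only [Finsupp.equivFunOnFinite_symm_apply_apply]
      ring
    have := independence_at_nondegenerate_zeros f Z hz hJ h hh g hg
    rintro ⟨z, α⟩
    have h1 := congrArg (coeff (Finsupp.equivFunOnFinite.symm α.1)) (this z z.2)
    simp only [g, z.2, dif_pos, coeff_sum, coeff_monomial, coeff_zero] at h1
    rw [Finset.sum_eq_single α] at h1
    · simpa using h1
    · intro b _ hb
      rw [if_neg]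
      intro h
      exact hb (Subtype.ext (Finsupp.equivFunOnFinite.symm.injective h))
    · simp
  have hcard : Z.card * S.card ≤ (exponentsLE m (D + H)).card := by
    have h1 : Fintype.card (Z × S) = Z.card * S.card := by simp
    rw [← h1]
    have hspan : Submodule.span ℝ (Set.range v) ≤
        Submodule.span ℝ (V : Set (MvPolynomial (Fin m) ℝ)) := by
      rw [Submodule.span_le]; rintro _ ⟨q, rfl⟩; exact hvdeg q
    rw [← finrank_span_eq_card hli]
    have : FiniteDimensional ℝ (Submodule.span ℝ (V : Set (MvPolynomial (Fin m) ℝ))) :=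
      FiniteDimensional.span_of_finite ℝ V.finite_toSet
    exact (Submodule.finrank_mono hspan).trans
      ((finrank_span_finset_le_card V).trans Finset.card_image_le)
  calc Z.card * (exponentsLE m D).card ≤ Z.card * (S.card * ∏ j, d j) := by gcongr
    _ = (∏ j, d j) * (Z.card * S.card) := by ring
    _ ≤ _ := by gcongr

/-- Bézout's bound for the number of nondegenerate real zeros of a square polynomial system. -/
theorem card_nondegenerate_zeros_le (f : Fin m → MvPolynomial (Fin m) ℝ) (d : Fin m → ℕ)
    (hd : ∀ j, 1 ≤ d j) (hdeg : ∀ j, (f j).totalDegree ≤ d j)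
    (Z : Finset (Fin m → ℝ)) (hz : ∀ z ∈ Z, ∀ j, eval z (f j) = 0)
    (hJ : ∀ z ∈ Z, (Matrix.of fun j i => eval z (pderiv i (f j))).det ≠ 0) :
    Z.card ≤ ∏ j, d j := by
  obtain ⟨H, hH⟩ := card_zeros_mul_le f d hd hdeg Z hz hJ
  set P := ∏ j, d j with hP
  have hP1 : 1 ≤ P := Finset.one_le_prod' fun j _ => hd j
  by_contra! hlt
  -- Iterating the inequality along `D = 0, H, 2H, …` avoids computing the asymptotics of the number
  -- of exponents. If `Z.card ≥ P + 1`, that number would grow at least like `((P + 1) / P) ^ j`,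
  -- whereas it is polynomial in `j`.
  have hstep : ∀ j : ℕ, (P + 1) ^ j ≤ P ^ j * (exponentsLE m (j * H)).card := by
    intro j
    induction j with
    | zero =>
      simp only [pow_zero, zero_mul, one_mul]
      exact Finset.card_pos.2 ⟨0, mem_exponentsLE.2 (by simp)⟩
    | succ j ih =>
      calc (P + 1) ^ (j + 1) = (P + 1) * (P + 1) ^ j := by ring
        _ ≤ Z.card * (P ^ j * (exponentsLE m (j * H)).card) := Nat.mul_le_mul hlt ih
        _ = P ^ j * (Z.card * (exponentsLE m (j * H)).card) := by ring
        _ ≤ P ^ j * (P * (exponentsLE m (j * H + H)).card) := Nat.mul_le_mul_left _ (hH _)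
        _ = P ^ (j + 1) * (exponentsLE m ((j + 1) * H)).card := by
          rw [show (j + 1) * H = j * H + H by ring]; ring
  have hPpos : (0:ℝ) < P := by exact_mod_cast hP1
  have hr : 1 < ((P:ℝ) + 1) / P := by rw [lt_div_iff₀ hPpos]; linarith
  have ht := tendsto_pow_const_div_const_pow_of_one_lt m hr
  have hc : (0:ℝ) < (((H:ℝ) + 1) ^ m)⁻¹ := by positivity
  obtain ⟨j, hj, hj1⟩ := ((ht.eventually (gt_mem_nhds hc)).and
    (Filter.eventually_ge_atTop 1)).exists
  have h1 : ((P:ℝ) + 1) ^ j ≤ P ^ j * ((j:ℝ) * (H + 1)) ^ m := by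
    have h2 : (P + 1) ^ j ≤ P ^ j * (j * (H + 1)) ^ m := by
      refine (hstep j).trans ?_
      gcongr
      refine (card_exponentsLE_le _).trans ?_
      gcongr
      nlinarith
    exact_mod_cast h2
  rw [div_lt_iff₀ (by positivity), inv_mul_eq_div, lt_div_iff₀ (by positivity), div_pow,
    lt_div_iff₀ (by positivity), ← mul_pow] at hj
  linarith

end Bezout

end StrongAnticoncentration

namespace StrongAnticoncentration

/-! ### The area formula with bounded multiplicity. -/

section AreaFormula
open scoped ENNReal NNReal
variable {E : Type*} [NormedAddCommGroup E] [NormedSpace ℝ E] [FiniteDimensional ℝ E]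
  [MeasurableSpace E] [BorelSpace E]

/-- The area formula as an inequality, for a map all of whose fibres have at most `N` points. -/
theorem lintegral_abs_det_mul_le_of_card_fibre_le (μ : Measure E) [μ.IsAddHaarMeasure]
    {s : Set E} (hs : MeasurableSet s) (f : E → E) (f' : E → E →L[ℝ] E)
    (hf' : ∀ x ∈ s, HasFDerivWithinAt f (f' x) s x) (hdet : ∀ x ∈ s, (f' x).det ≠ 0) (N : ℕ)
    (hN : ∀ y, ∀ Z : Finset E, (∀ z ∈ Z, z ∈ s ∧ f z = y) → Z.card ≤ N)
    (g : E → ℝ≥0∞) (hg : Measurable g) :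
    ∫⁻ x in s, ENNReal.ofReal |(f' x).det| * g (f x) ∂μ ≤ N * ∫⁻ y, g y ∂μ := by
  classical
  rcases s.eq_empty_or_nonempty with rfl | hne
  · simp
  -- A map that approximates an invertible linear map to within half of `1 / ‖A⁻¹‖` is injective.
  -- Thus `s` can be cut into countably many pieces on which `f` is injective and the change of
  -- variables formula holds. The inverse has norm zero only when `E` is trivial.
  have hr : ∀ A : E →L[ℝ] E, ∃ r : ℝ≥0, r ≠ 0 ∧ (A.det ≠ 0 → ∀ t : Set E,
      ApproximatesLinearOn f A t r → Set.InjOn f t) := by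
    intro A
    by_cases hA : A.det ≠ 0
    · let B := A.toContinuousLinearEquivOfDetNeZero hA
      rcases eq_or_ne ‖(B.symm : E →L[ℝ] E)‖₊ 0 with h0 | h0
      · have hsub : Subsingleton E := by
          refine ⟨fun x y => ?_⟩
          have hz : (B.symm : E →L[ℝ] E) = 0 := by simpa using h0
          have : ∀ x : E, x = 0 := fun x => by
            have := congrArg (fun L : E →L[ℝ] E => L (B x)) hz
            simpa using this
          rw [this x, this y]
        exact ⟨1, one_ne_zero, fun _ t _ => Set.injOn_of_subsingleton _ _⟩
      · refine ⟨‖(B.symm : E →L[ℝ] E)‖₊⁻¹ / 2, by positivity, fun _ t ht => ?_⟩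
        have ht' : ApproximatesLinearOn f (B : E →L[ℝ] E) t (‖(B.symm : E →L[ℝ] E)‖₊⁻¹ / 2) := by
          convert ht
          ext x; simp [B]
        exact ht'.injOn (Or.inr (NNReal.half_lt_self (by simpa using h0)))
    · exact ⟨1, one_ne_zero, fun h => absurd h hA⟩
  choose r r0 hr using hr
  obtain ⟨t, A, htd, htm, hst, happ, hA⟩ :=
    exists_partition_approximatesLinearOn_of_hasFDerivWithinAt f s f' hf' r r0
  have hinj : ∀ n, Set.InjOn f (s ∩ t n) := by
    intro n
    obtain ⟨y, hy, hAy⟩ := hA hne n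
    exact hr (A n) (hAy ▸ hdet y hy) _ (happ n)
  have hmeas : ∀ n, MeasurableSet (s ∩ t n) := fun n => hs.inter (htm n)
  have hder : ∀ n, ∀ x ∈ s ∩ t n, HasFDerivWithinAt f (f' x) (s ∩ t n) x :=
    fun n x hx => (hf' x hx.1).mono Set.inter_subset_left
  have himeas : ∀ n, MeasurableSet (f '' (s ∩ t n)) := fun n =>
    measurable_image_of_fderivWithin (hmeas n) (hder n) (hinj n)
  have hunion : s = ⋃ n, s ∩ t n := by
    rw [← Set.inter_iUnion]; exact (Set.inter_eq_left.2 hst).symm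
  calc ∫⁻ x in s, ENNReal.ofReal |(f' x).det| * g (f x) ∂μ
      = ∑' n, ∫⁻ x in s ∩ t n, ENNReal.ofReal |(f' x).det| * g (f x) ∂μ := by
        conv_lhs => rw [hunion]
        exact lintegral_iUnion hmeas
          (fun i j hij => (htd hij).mono Set.inter_subset_right Set.inter_subset_right) _
    _ = ∑' n, ∫⁻ y in f '' (s ∩ t n), g y ∂μ := by
        congr 1; funext n
        exact (lintegral_image_eq_lintegral_abs_det_fderiv_mul μ (hmeas n) (hder n) (hinj n) g).symm
    _ = ∑' n, ∫⁻ y, (f '' (s ∩ t n)).indicator (fun _ => 1) y * g y ∂μ := by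
        congr 1; funext n
        rw [← lintegral_indicator (himeas n)]
        congr 1; funext y
        by_cases hy : y ∈ f '' (s ∩ t n)
        · rw [Set.indicator_of_mem hy, Set.indicator_of_mem hy, one_mul]
        · rw [Set.indicator_of_notMem hy, Set.indicator_of_notMem hy, zero_mul]
    _ = ∫⁻ y, ∑' n, (f '' (s ∩ t n)).indicator (fun _ => 1) y * g y ∂μ := by
        rw [lintegral_tsum]
        intro n
        exact ((measurable_const.indicator (himeas n)).mul hg).aemeasurable
    _ ≤ ∫⁻ y, N * g y ∂μ := by
        refine lintegral_mono fun y => ?_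
        rw [ENNReal.tsum_mul_right]
        refine mul_le_mul_left ?_ _
        rw [ENNReal.tsum_eq_iSup_sum]
        refine iSup_le fun F => ?_
        -- The pieces are disjoint, so preimages of `y` taken in different pieces are distinct
        -- points of a single fibre, and there are at most `N` of them.
        let F' := F.filter fun n => y ∈ f '' (s ∩ t n)
        have h1 : ∑ n ∈ F, (f '' (s ∩ t n)).indicator (fun _ => (1:ℝ≥0∞)) y = F'.card := by
          simp only [Set.indicator_apply, F', Finset.sum_boole]
        rw [h1]
        have h2 : ∀ n ∈ F', ∃ x, (x ∈ s ∩ t n) ∧ f x = y := fun n hn => (Finset.mem_filter.1 hn).2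
        choose! x hx using h2
        have h3 : Set.InjOn x F' := by
          intro a ha b hb hab
          by_contra hne
          exact Set.disjoint_left.1 (htd hne) (hx a ha).1.2 (hab ▸ (hx b hb).1.2)
        have h4 := hN y (F'.image x) (by
          intro z hz
          obtain ⟨n, hn, rfl⟩ := Finset.mem_image.1 hz
          exact ⟨(hx n hn).1.1, (hx n hn).2⟩)
        rw [Finset.card_image_of_injOn h3] at h4
        exact_mod_cast h4
    _ = N * ∫⁻ y, g y ∂μ := lintegral_const_mul _ hg

end AreaFormula
end StrongAnticoncentration

namespace StrongAnticoncentration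
open scoped ENNReal NNReal

/-! ### Gaussian moments and a weighted reverse Hölder inequality. -/

section GaussianMoments

/-- The standard Gaussian measure on `ℝ^K`. -/
noncomputable abbrev stdGauss (K : Type*) [Fintype K] : Measure (K → ℝ) :=
  Measure.pi fun _ : K => gaussianReal 0 1

variable {K T : Type*} [Fintype K] [Fintype T]

theorem map_stdGauss_linearForm (a : K → ℝ) :
    (stdGauss K).map (fun y => ∑ i, a i * y i) = gaussianReal 0 (∑ i, a i ^ 2).toNNReal := by
  let L : StrongDual ℝ (EuclideanSpace ℝ K) := innerSL ℝ (WithLp.toLp 2 a)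
  have h := IsGaussian.map_eq_gaussianReal (μ := stdGaussian (EuclideanSpace ℝ K)) L
  rw [integral_strongDual_stdGaussian, variance_dual_stdGaussian, ← map_pi_eq_stdGaussian,
    Measure.map_map (by fun_prop) (by fun_prop)] at h
  have hL : ‖L‖ ^ 2 = ∑ i, a i ^ 2 := by
    simp only [L, innerSL_apply_norm, EuclideanSpace.real_norm_sq_eq]
  rw [hL] at h
  rw [← h]
  congr 1
  funext y
  simp [L, PiLp.inner_apply, mul_comm]

theorem measurePreserving_stdGauss_of_isometry (R : (K → ℝ) →ₗ[ℝ] (K → ℝ))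
    (hR : ∀ x, ∑ i, R x i ^ 2 = ∑ i, x i ^ 2) :
    MeasurePreserving R (stdGauss K) (stdGauss K) := by
  let e : (K → ℝ) ≃ₗ[ℝ] EuclideanSpace ℝ K := (WithLp.linearEquiv 2 ℝ (K → ℝ)).symm
  let A : EuclideanSpace ℝ K →ₗᵢ[ℝ] EuclideanSpace ℝ K :=
    { toLinearMap := e.toLinearMap ∘ₗ R ∘ₗ e.symm.toLinearMap
      norm_map' := fun x => by
        have h1 : ‖(e.toLinearMap ∘ₗ R ∘ₗ e.symm.toLinearMap) x‖ ^ 2 = ‖x‖ ^ 2 := by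
          rw [EuclideanSpace.real_norm_sq_eq, EuclideanSpace.real_norm_sq_eq]
          exact hR _
        exact (sq_eq_sq₀ (norm_nonneg _) (norm_nonneg _)).1 h1 }
  have h := stdGaussian_map (A.toLinearIsometryEquiv rfl)
  rw [← map_pi_eq_stdGaussian, Measure.map_map (by fun_prop) (by fun_prop)] at h
  have hR' : Measurable R := (LinearMap.continuous_of_finiteDimensional R).measurable
  refine ⟨hR', ?_⟩
  have h2 := congrArg (fun μ => Measure.map (WithLp.ofLp (p := 2)) μ) h
  rw [Measure.map_map (by fun_prop) (by fun_prop), Measure.map_map (by fun_prop) (by fun_prop)]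
    at h2
  have e1 : (WithLp.ofLp (p := 2) ∘ (A.toLinearIsometryEquiv rfl) ∘ WithLp.toLp 2 :
      (K → ℝ) → (K → ℝ)) = R := by
    funext x; rfl
  have e2 : (WithLp.ofLp (p := 2) ∘ WithLp.toLp 2 : (K → ℝ) → (K → ℝ)) = id := rfl
  rw [e2, Measure.map_id] at h2
  exact e1 ▸ h2

theorem integrable_pow_gaussianReal (v : ℝ≥0) (p : ℕ) :
    Integrable (fun x : ℝ => x ^ p) (gaussianReal 0 v) := by
  rcases Nat.eq_zero_or_pos p with rfl | hp
  · simp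
  · have h := (memLp_id_gaussianReal (μ := 0) (v := v) p).integrable_norm_pow hp.ne'
    refine h.mono' (by fun_prop) (Filter.Eventually.of_forall fun x => ?_)
    simp

theorem integral_sq_gaussianReal (v : ℝ≥0) : ∫ x, x ^ 2 ∂gaussianReal 0 v = v := by
  have := variance_fun_id_gaussianReal (μ := 0) (v := v)
  rw [variance_eq_integral measurable_id'.aemeasurable] at this
  simpa using this

theorem integral_pow_four_gaussianReal (v : ℝ≥0) :
    ∫ x, x ^ 4 ∂gaussianReal 0 v = 3 * (v : ℝ) ^ 2 := by
  calc ∫ x, x ^ 4 ∂gaussianReal 0 v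
      = iteratedDeriv 4 (mgf (fun x ↦ x) (gaussianReal 0 v)) 0 := by
        rw [iteratedDeriv_mgf_zero] <;> simp
    _ = 3 * (v : ℝ) ^ 2 := by
      have he : ∀ t : ℝ, HasDerivAt (fun t : ℝ => Real.exp (v * t ^ 2 / 2))
          (v * t * Real.exp (v * t ^ 2 / 2)) t := by
        intro t
        have h1 : HasDerivAt (fun t : ℝ => (v:ℝ) * t ^ 2 / 2) (v * t) t :=
          (((hasDerivAt_pow 2 t).const_mul (v:ℝ)).div_const 2).congr_deriv (by norm_num; ring)
        exact h1.exp.congr_deriv (by ring)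
      -- Every derivative of the moment generating function is a polynomial times the same
      -- exponential, and differentiation acts on the polynomial factor by `q ↦ q' + v t q`.
      have hq : ∀ q q' r : ℝ → ℝ, (∀ t, HasDerivAt q (q' t) t) →
          (∀ t, q' t + v * t * q t = r t) →
          deriv (fun t => q t * Real.exp (v * t ^ 2 / 2)) =
            fun t => r t * Real.exp (v * t ^ 2 / 2) := by
        intro q q' r hq hr
        funext t
        rw [((hq t).fun_mul (he t)).deriv, ← hr]; ring
      have d0 : mgf (fun x ↦ x) (gaussianReal 0 v) =
          fun t => (fun _ => (1:ℝ)) t * Real.exp (v * t ^ 2 / 2) := by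
        rw [mgf_fun_id_gaussianReal]; funext t; simp
      rw [iteratedDeriv_succ', iteratedDeriv_succ', iteratedDeriv_succ', iteratedDeriv_one, d0,
        hq _ (fun _ => 0) (fun t => v * t) (fun t => hasDerivAt_const t 1) (fun t => by ring),
        hq (fun t => v * t) (fun _ => v) (fun t => v + v ^ 2 * t ^ 2)
          (fun t => by simpa using (hasDerivAt_id t).const_mul (v:ℝ)) (fun t => by ring),
        hq (fun t => v + v ^ 2 * t ^ 2) (fun t => 2 * v ^ 2 * t)
          (fun t => 3 * v ^ 2 * t + v ^ 3 * t ^ 3)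
          (fun t => (((hasDerivAt_pow 2 t).const_mul ((v:ℝ) ^ 2)).const_add (v:ℝ)).congr_deriv
            (by norm_num; ring)) (fun t => by ring),
        hq (fun t => 3 * v ^ 2 * t + v ^ 3 * t ^ 3) (fun t => 3 * v ^ 2 + 3 * v ^ 3 * t ^ 2)
          (fun t => 3 * v ^ 2 + 6 * v ^ 3 * t ^ 2 + v ^ 4 * t ^ 4)
          (fun t => (((hasDerivAt_id' t).const_mul (3 * (v:ℝ) ^ 2)).fun_add
            ((hasDerivAt_pow 3 t).const_mul ((v:ℝ) ^ 3))).congr_deriv (by norm_num; ring))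
          (fun t => by ring)]
      simp

theorem integrable_linearForm_pow (a : K → ℝ) (p : ℕ) :
    Integrable (fun y => (∑ i, a i * y i) ^ p) (stdGauss K) := by
  have h := integrable_pow_gaussianReal (∑ i, a i ^ 2).toNNReal p
  rw [← map_stdGauss_linearForm a] at h
  exact h.comp_measurable (by fun_prop)

theorem integral_linearForm_sq (a : K → ℝ) :
    ∫ y, (∑ i, a i * y i) ^ 2 ∂stdGauss K = ∑ i, a i ^ 2 := by
  have h := integral_sq_gaussianReal (∑ i, a i ^ 2).toNNReal
  have hm : AEMeasurable (fun y => ∑ i, a i * y i) (stdGauss K) :=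
    Measurable.aemeasurable (by fun_prop)
  rw [← map_stdGauss_linearForm a, integral_map hm (by fun_prop),
    Real.coe_toNNReal _ (Finset.sum_nonneg fun i _ => sq_nonneg _)] at h
  exact h

theorem integral_linearForm_pow_four (a : K → ℝ) :
    ∫ y, (∑ i, a i * y i) ^ 4 ∂stdGauss K = 3 * (∑ i, a i ^ 2) ^ 2 := by
  have h := integral_pow_four_gaussianReal (∑ i, a i ^ 2).toNNReal
  have hm : AEMeasurable (fun y => ∑ i, a i * y i) (stdGauss K) :=
    Measurable.aemeasurable (by fun_prop)
  rw [← map_stdGauss_linearForm a, integral_map hm (by fun_prop),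
    Real.coe_toNNReal _ (Finset.sum_nonneg fun i _ => sq_nonneg _)] at h
  exact h

theorem norm2_nonneg (A : Tensor T) : 0 ≤ norm2 A := Real.sqrt_nonneg _

theorem norm2_sq (A : Tensor T) : norm2 A ^ 2 = ∑ t, A t ^ 2 :=
  Real.sq_sqrt (Finset.sum_nonneg fun _ _ => sq_nonneg _)

/-- The contraction of a tensor with index set `K × T` by a vector indexed by `K`. -/
def contract (L : K → T → ℝ) (y : K → ℝ) : Tensor T := fun t => ∑ i, L i t * y i

theorem integrable_norm2_contract_sq (L : K → T → ℝ) :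
    Integrable (fun y => norm2 (contract L y) ^ 2) (stdGauss K) := by
  simp_rw [norm2_sq]
  exact integrable_finsetSum _ fun t _ => integrable_linearForm_pow (fun i => L i t) 2

theorem integral_norm2_contract_sq (L : K → T → ℝ) :
    ∫ y, norm2 (contract L y) ^ 2 ∂stdGauss K = ∑ t, ∑ i, L i t ^ 2 := by
  simp_rw [norm2_sq, contract]
  rw [integral_finsetSum _ fun t _ => integrable_linearForm_pow (fun i => L i t) 2]
  exact Finset.sum_congr rfl fun t _ => integral_linearForm_sq fun i => L i t

/-- Cauchy–Schwarz with weights `a_t = ∑ i, L i t ^ 2`. These suit the Gaussian identity `E X_t⁴ = 3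
a_t²`, which turns the right side into `3 (∑ a_t)²` after integration. A coordinate with `a_t = 0`
vanishes identically, so division by zero does no harm. -/
theorem norm2_contract_pow_four_le (L : K → T → ℝ) (y : K → ℝ) :
    norm2 (contract L y) ^ 4 ≤ (∑ t, ∑ i, L i t ^ 2) *
      ∑ t, (∑ i, L i t * y i) ^ 4 / ∑ i, L i t ^ 2 := by
  rw [show norm2 (contract L y) ^ 4 = (norm2 (contract L y) ^ 2) ^ 2 by ring, norm2_sq]
  refine Finset.sum_sq_le_sum_mul_sum_of_sq_le_mul _ (fun t _ => by positivity)
    (fun t _ => by positivity) fun t _ => le_of_eq ?_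
  by_cases h0 : ∑ i, L i t ^ 2 = 0
  · have : ∀ i, L i t = 0 := fun i => by
      rw [Finset.sum_eq_zero_iff_of_nonneg (fun i _ => sq_nonneg _)] at h0
      exact pow_eq_zero_iff two_ne_zero |>.1 (h0 i (Finset.mem_univ i))
    simp [contract, this]
  · rw [mul_div_cancel₀ _ h0]
    simp only [contract]; ring

theorem measurable_norm2_contract (L : K → T → ℝ) :
    Measurable fun y => norm2 (contract L y) := by
  unfold norm2 contract; fun_prop

theorem integrable_norm2_contract_pow_four (L : K → T → ℝ) :
    Integrable (fun y => norm2 (contract L y) ^ 4) (stdGauss K) := by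
  have h : Integrable (fun y : K → ℝ => (∑ t, ∑ i, L i t ^ 2) *
      ∑ t, (∑ i, L i t * y i) ^ 4 / ∑ i, L i t ^ 2) (stdGauss K) :=
    (integrable_finsetSum _ fun t _ =>
      (integrable_linearForm_pow (fun i => L i t) 4).div_const _).const_mul _
  refine h.mono' ((measurable_norm2_contract L).pow_const 4).aestronglyMeasurable
    (Filter.Eventually.of_forall fun y => ?_)
  rw [Real.norm_of_nonneg (pow_nonneg (norm2_nonneg _) 4)]
  exact norm2_contract_pow_four_le L y

theorem integral_norm2_contract_pow_four_le (L : K → T → ℝ) :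
    ∫ y, norm2 (contract L y) ^ 4 ∂stdGauss K ≤ 3 * (∑ t, ∑ i, L i t ^ 2) ^ 2 := by
  calc ∫ y, norm2 (contract L y) ^ 4 ∂stdGauss K
      ≤ ∫ y, (∑ t, ∑ i, L i t ^ 2) *
          ∑ t, (∑ i, L i t * y i) ^ 4 / ∑ i, L i t ^ 2 ∂stdGauss K :=
        integral_mono (integrable_norm2_contract_pow_four L)
          ((integrable_finsetSum _ fun t _ =>
            (integrable_linearForm_pow (fun i => L i t) 4).div_const _).const_mul _)
          (norm2_contract_pow_four_le L)
    _ = (∑ t, ∑ i, L i t ^ 2) * ∑ t, 3 * (∑ i, L i t ^ 2) ^ 2 / ∑ i, L i t ^ 2 := by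
        rw [integral_const_mul, integral_finsetSum _ fun t _ =>
          (integrable_linearForm_pow (fun i => L i t) 4).div_const _]
        congr 1
        refine Finset.sum_congr rfl fun t _ => ?_
        rw [integral_div, integral_linearForm_pow_four fun i => L i t]
    _ = 3 * (∑ t, ∑ i, L i t ^ 2) ^ 2 := by
        rw [sq, mul_left_comm]
        congr 1
        rw [Finset.mul_sum]
        refine Finset.sum_congr rfl fun t _ => ?_
        by_cases h0 : ∑ i, L i t ^ 2 = 0
        · simp [h0]
        · field_simp

theorem ofReal_integral_le_lintegral_ofReal {α : Type*} [MeasurableSpace α] {μ : Measure α}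
    {Z : α → ℝ} (hZ : Integrable Z μ) :
    ENNReal.ofReal (∫ x, Z x ∂μ) ≤ ∫⁻ x, ENNReal.ofReal (Z x) ∂μ := by
  rw [integral_eq_lintegral_pos_part_sub_lintegral_neg_part hZ]
  refine ENNReal.ofReal_le_of_le_toReal ?_ |>.trans le_rfl
  exact sub_le_self _ ENNReal.toReal_nonneg

/-- The weighted first moment of a Gaussian linear combination of tensors dominates its second
moment, for weights `F ^ (-1/2)` with `F` of bounded mean. -/
theorem le_lintegral_norm2_contract (L : K → T → ℝ) (F : (K → ℝ) → ℝ) (hF0 : ∀ y, 0 < F y)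
    (hF : Integrable F (stdGauss K)) (ρ : ℝ) (hρ : 0 < ρ)
    (hFρ : ∫ y, F y ∂stdGauss K ≤ 6 * ρ ^ 2) :
    ENNReal.ofReal (Real.sqrt (∑ t, ∑ i, L i t ^ 2) / (10 * ρ)) ≤
      ∫⁻ y, ENNReal.ofReal (norm2 (contract L y)) * ENNReal.ofReal (Real.sqrt (F y))⁻¹
        ∂stdGauss K := by
  set m := ∑ t, ∑ i, L i t ^ 2 with hm
  have hm0 : 0 ≤ m := by positivity
  rcases hm0.eq_or_lt with h0 | hmpos
  · rw [← h0]; simp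
  set μ := Real.sqrt m with hμ
  have hμpos : 0 < μ := Real.sqrt_pos.2 hmpos
  have hμm : μ ^ 2 = m := Real.sq_sqrt hm0
  let N : (K → ℝ) → ℝ := fun y => norm2 (contract L y)
  -- `Z` is a pointwise minorant of `N / √F` that involves only `N²`, `N⁴` and `F`, whose means are
  -- controlled. With `f = √F`, it combines three inequalities: the tangent bound `1/f ≥ 1/(2ρ) -
  -- f/(16ρ²)` at `f = 4ρ`, the bound `N ≥ 3N²/(4μ) - N⁴/(16μ³)`, which is sharp at `N = 2μ`, and
  -- the arithmetic–geometric mean inequality for `N f`. The resulting mean is at least `(41/320)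
  -- μ/ρ`.
  let Z : (K → ℝ) → ℝ := fun y => (1 / (2 * ρ)) * (3 / (4 * μ) * N y ^ 2 -
    1 / (16 * μ ^ 3) * N y ^ 4) - 1 / (32 * ρ ^ 2) * (5 * ρ / (2 * μ) * N y ^ 2 +
      2 * μ / (5 * ρ) * F y)
  have i2 := integrable_norm2_contract_sq L
  have i4 := integrable_norm2_contract_pow_four L
  have j1 : Integrable (fun y => 3 / (4 * μ) * N y ^ 2 - 1 / (16 * μ ^ 3) * N y ^ 4)
      (stdGauss K) := (i2.const_mul _).sub (i4.const_mul _)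
  have j2 : Integrable (fun y => 5 * ρ / (2 * μ) * N y ^ 2 + 2 * μ / (5 * ρ) * F y)
      (stdGauss K) := (i2.const_mul _).add (hF.const_mul _)
  have hZint : Integrable Z (stdGauss K) := (j1.const_mul _).sub (j2.const_mul _)
  have hZval : μ / (10 * ρ) ≤ ∫ y, Z y ∂stdGauss K := by
    have e1 : ∫ y, Z y ∂stdGauss K = (1 / (2 * ρ)) * (3 / (4 * μ) * ∫ y, N y ^ 2 ∂stdGauss K -
        1 / (16 * μ ^ 3) * ∫ y, N y ^ 4 ∂stdGauss K) -
        1 / (32 * ρ ^ 2) * (5 * ρ / (2 * μ) * ∫ y, N y ^ 2 ∂stdGauss K +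
        2 * μ / (5 * ρ) * ∫ y, F y ∂stdGauss K) := by
      simp only [Z]
      rw [integral_sub (j1.const_mul _) (j2.const_mul _), integral_const_mul,
        integral_sub (i2.const_mul _) (i4.const_mul _), integral_const_mul, integral_const_mul,
        integral_const_mul, integral_add (i2.const_mul _) (hF.const_mul _), integral_const_mul,
        integral_const_mul]
    rw [e1]
    have e2 : ∫ y, N y ^ 2 ∂stdGauss K = μ ^ 2 := by
      rw [hμm]; exact integral_norm2_contract_sq L
    have e4 : ∫ y, N y ^ 4 ∂stdGauss K ≤ 3 * (μ ^ 2) ^ 2 := by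
      rw [hμm]; exact integral_norm2_contract_pow_four_le L
    rw [e2]
    have b1 : 1 / (16 * μ ^ 3) * ∫ y, N y ^ 4 ∂stdGauss K ≤
        1 / (16 * μ ^ 3) * (3 * (μ ^ 2) ^ 2) := by gcongr
    have b2 : 2 * μ / (5 * ρ) * ∫ y, F y ∂stdGauss K ≤ 2 * μ / (5 * ρ) * (6 * ρ ^ 2) := by
      gcongr
    calc μ / (10 * ρ) ≤ (1 / (2 * ρ)) * (3 / (4 * μ) * μ ^ 2 -
        1 / (16 * μ ^ 3) * (3 * (μ ^ 2) ^ 2)) -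
        1 / (32 * ρ ^ 2) * (5 * ρ / (2 * μ) * μ ^ 2 + 2 * μ / (5 * ρ) * (6 * ρ ^ 2)) := by
          have : (1 / (2 * ρ)) * (3 / (4 * μ) * μ ^ 2 -
            1 / (16 * μ ^ 3) * (3 * (μ ^ 2) ^ 2)) -
            1 / (32 * ρ ^ 2) * (5 * ρ / (2 * μ) * μ ^ 2 + 2 * μ / (5 * ρ) * (6 * ρ ^ 2)) =
            (41 / 320) * (μ / ρ) := by field_simp; ring
          rw [this, show μ / (10 * ρ) = (1 / 10) * (μ / ρ) by field_simp]
          have : 0 < μ / ρ := by positivity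
          nlinarith
      _ ≤ _ := by gcongr
  have hpt : ∀ y, Z y ≤ N y * (Real.sqrt (F y))⁻¹ := by
    intro y
    have hN : 0 ≤ N y := norm2_nonneg _
    set f := Real.sqrt (F y) with hf
    have hfpos : 0 < f := Real.sqrt_pos.2 (hF0 y)
    have hfF : F y = f ^ 2 := (Real.sq_sqrt (hF0 y).le).symm
    have a1 : 3 / (4 * μ) * N y ^ 2 - 1 / (16 * μ ^ 3) * N y ^ 4 ≤ N y := by
      have : N y - (3 / (4 * μ) * N y ^ 2 - 1 / (16 * μ ^ 3) * N y ^ 4) =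
          N y * (N y - 2 * μ) ^ 2 * (N y + 4 * μ) / (16 * μ ^ 3) := by field_simp; ring
      have h2 : 0 ≤ N y * (N y - 2 * μ) ^ 2 * (N y + 4 * μ) / (16 * μ ^ 3) := by positivity
      linarith
    have a2 : N y * f ≤ (1 / 2) * (5 * ρ / (2 * μ) * N y ^ 2 + 2 * μ / (5 * ρ) * f ^ 2) := by
      have : (1 / 2) * (5 * ρ / (2 * μ) * N y ^ 2 + 2 * μ / (5 * ρ) * f ^ 2) - N y * f =
          (5 * ρ * N y - 2 * μ * f) ^ 2 / (20 * μ * ρ) := by field_simp; ring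
      have h2 : 0 ≤ (5 * ρ * N y - 2 * μ * f) ^ 2 / (20 * μ * ρ) := by positivity
      linarith
    have a3 : 1 / (2 * ρ) * N y - 1 / (16 * ρ ^ 2) * (N y * f) ≤ N y * f⁻¹ := by
      have : N y * f⁻¹ - (1 / (2 * ρ) * N y - 1 / (16 * ρ ^ 2) * (N y * f)) =
          N y * (f - 4 * ρ) ^ 2 / (16 * ρ ^ 2 * f) := by field_simp; ring
      have h2 : 0 ≤ N y * (f - 4 * ρ) ^ 2 / (16 * ρ ^ 2 * f) := by positivity
      linarith
    have a1' := mul_le_mul_of_nonneg_left a1 (show 0 ≤ 1 / (2 * ρ) by positivity)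
    have a2' := mul_le_mul_of_nonneg_left a2 (show 0 ≤ 1 / (16 * ρ ^ 2) by positivity)
    simp only [Z]
    rw [hfF]
    have : 1 / (16 * ρ ^ 2) * (1 / 2 * (5 * ρ / (2 * μ) * N y ^ 2 + 2 * μ / (5 * ρ) * f ^ 2)) =
      1 / (32 * ρ ^ 2) * (5 * ρ / (2 * μ) * N y ^ 2 + 2 * μ / (5 * ρ) * f ^ 2) := by ring
    linarith
  calc ENNReal.ofReal (μ / (10 * ρ)) ≤ ENNReal.ofReal (∫ y, Z y ∂stdGauss K) :=
        ENNReal.ofReal_le_ofReal hZval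
    _ ≤ ∫⁻ y, ENNReal.ofReal (Z y) ∂stdGauss K := ofReal_integral_le_lintegral_ofReal hZint
    _ ≤ _ := by
        refine lintegral_mono fun y => ?_
        rw [← ENNReal.ofReal_mul (norm2_nonneg _)]
        exact ENNReal.ofReal_le_ofReal (hpt y)

end GaussianMoments
end StrongAnticoncentration

namespace StrongAnticoncentration
open scoped ENNReal NNReal
open MvPolynomial

/-! ### Derivatives, measurability and degrees of polynomials. -/

section PolynomialCalculus

variable {n : ℕ}

/-- The derivative of `p` at `x` in direction `y`. -/
noncomputable def dirDeriv (p : MvPolynomial (Fin n) ℝ) (y x : Fin n → ℝ) : ℝ :=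
  ∑ i, eval x (pderiv i p) * y i

theorem hasFDerivAt_eval (p : MvPolynomial (Fin n) ℝ) (x : Fin n → ℝ) :
    HasFDerivAt (fun x => eval x p)
      (∑ i, eval x (pderiv i p) • ContinuousLinearMap.proj (R := ℝ) (φ := fun _ : Fin n => ℝ) i)
      x := by
  induction p using MvPolynomial.induction_on with
  | C a => simpa using hasFDerivAt_const a x
  | add p q hp hq =>
    simp only [map_add, add_smul, Finset.sum_add_distrib]
    exact hp.fun_add hq
  | mul_X p i hp =>
    have h := hp.fun_mul (hasFDerivAt_apply (𝕜 := ℝ) (F' := fun _ : Fin n => ℝ) i x)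
    simp only [map_mul, eval_X]
    refine h.congr_fderiv ?_
    ext v
    simp only [add_apply, smul_apply,
      sum_apply, ContinuousLinearMap.proj_apply, smul_eq_mul,
      Derivation.leibniz, pderiv_X, map_add, map_mul, eval_X, Pi.single_apply, add_mul,
      Finset.sum_add_distrib, apply_ite (eval x), map_zero, mul_ite, ite_mul, mul_one,
      mul_zero, zero_mul, Finset.sum_ite_eq, Finset.mem_univ, if_true]
    rw [Finset.mul_sum]
    congr 1
    exact Finset.sum_congr rfl fun j _ => by ring

theorem continuous_eval_comp {α : Type*} [TopologicalSpace α] (p : MvPolynomial (Fin n) ℝ)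
    {f : α → Fin n → ℝ} (hf : Continuous f) : Continuous fun x => eval (f x) p :=
  (continuous_eval p).comp hf

theorem measurable_eval_comp {α : Type*} [MeasurableSpace α] (p : MvPolynomial (Fin n) ℝ)
    {f : α → Fin n → ℝ} (hf : Measurable f) : Measurable fun x => eval (f x) p :=
  (continuous_eval p).measurable.comp hf

theorem measurable_dirDeriv_comp {α : Type*} [MeasurableSpace α] (p : MvPolynomial (Fin n) ℝ)
    {f g : α → Fin n → ℝ} (hf : Measurable f) (hg : Measurable g) :
    Measurable fun x => dirDeriv p (f x) (g x) := by
  unfold dirDeriv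
  exact Finset.measurable_sum _ fun i _ =>
    (measurable_eval_comp _ hg).mul ((measurable_pi_apply i).comp hf)

theorem measurable_matrix_det {α ι : Type*} [MeasurableSpace α] [Fintype ι] [DecidableEq ι]
    {A : α → Matrix ι ι ℝ} (hA : ∀ i j, Measurable fun x => A x i j) :
    Measurable fun x => (A x).det := by
  simp only [Matrix.det_apply]
  exact Finset.measurable_sum _ fun σ _ =>
    (Finset.measurable_prod _ fun i _ => hA _ _).const_smul _

theorem totalDegree_aeval_le {σ τ : Type*} (f : σ → MvPolynomial τ ℝ)
    (hf : ∀ i, (f i).totalDegree ≤ 1) (p : MvPolynomial σ ℝ) :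
    (aeval f p).totalDegree ≤ p.totalDegree := by
  rw [aeval_def, eval₂_eq]
  refine totalDegree_finsetSum_le fun s hs => ?_
  refine (totalDegree_mul _ _).trans ?_
  rw [show (algebraMap ℝ (MvPolynomial τ ℝ)) (coeff s p) = C (coeff s p) from rfl, totalDegree_C,
    zero_add]
  refine (totalDegree_finsetProd _ _).trans (le_trans ?_ (le_totalDegree hs))
  refine Finset.sum_le_sum fun i _ => (totalDegree_pow _ _).trans ?_
  exact (Nat.mul_le_mul_left _ (hf i)).trans_eq (mul_one _)

theorem totalDegree_pderiv_le (i : Fin n) (p : MvPolynomial (Fin n) ℝ) :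
    (pderiv i p).totalDegree ≤ p.totalDegree - 1 := by
  classical
  conv_lhs => rw [p.as_sum, map_sum]
  refine totalDegree_finsetSum_le fun s hs => ?_
  rw [pderiv_monomial]
  by_cases h0 : s i = 0
  · simp [h0]
  · refine (totalDegree_monomial_le _ _).trans ?_
    have h1 := le_totalDegree hs
    have h2 : Finsupp.single i 1 ≤ s := by
      rw [Finsupp.single_le_iff]; omega
    have h3 : s = (s - Finsupp.single i 1) + Finsupp.single i 1 :=
      (tsub_add_cancel_of_le h2).symm
    have h4 : (s.sum fun _ e => e) = ((s - Finsupp.single i 1).sum fun _ e => e) + 1 := by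
      conv_lhs => rw [h3]
      rw [Finsupp.sum_add_index' (fun _ => rfl) (fun _ _ _ => rfl)]
      simp
    change ((s - Finsupp.single i 1).sum fun _ e => e) ≤ _
    omega

end PolynomialCalculus

/-! ### Orthogonal mixing of independent Gaussian vectors. -/

section Rotation

theorem lintegral_pi_fin_succ {k : ℕ} {α : Fin (k + 1) → Type*}
    {m : ∀ i, MeasurableSpace (α i)} (μ : ∀ i, Measure (α i)) [∀ i, SigmaFinite (μ i)]
    (f : (∀ i, α i) → ℝ≥0∞) :
    ∫⁻ x, f x ∂Measure.pi μ =
      ∫⁻ p, f (Fin.cons p.1 p.2) ∂((μ 0).prod (Measure.pi fun j => μ j.succ)) := by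
  have h := (measurePreserving_piFinSuccAbove μ 0).symm
  rw [← h.lintegral_comp_emb (MeasurableEquiv.measurableEmbedding _)]
  refine lintegral_congr fun p => congrArg f ?_
  exact Fin.insertNth_zero (α := α) p.1 p.2

theorem lintegral_prod_pi {k : ℕ} (h : Fin k → ℝ → ℝ≥0∞) (hh : ∀ j, Measurable (h j)) :
    ∫⁻ w : Fin k → ℝ, ∏ j, h j (w j) = ∏ j, ∫⁻ t, h j t := by
  induction k with
  | zero => simp [volume_pi]
  | succ k ih =>
    rw [volume_pi, lintegral_pi_fin_succ]
    simp only [Fin.prod_univ_succ, Fin.cons_zero, Fin.cons_succ]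
    rw [lintegral_prod_mul (f := h 0) (g := fun w : Fin k → ℝ => ∏ j, h j.succ (w j))
      (hh 0).aemeasurable (Finset.measurable_prod _ fun j _ =>
        (hh j.succ).comp (measurable_pi_apply j)).aemeasurable]
    rw [← ih _ fun j => hh j.succ]
    rfl

variable {A I : Type*} [Fintype A] [Fintype I]

theorem measurePreserving_curry_stdGauss :
    MeasurePreserving (MeasurableEquiv.curry A I ℝ) (stdGauss (A × I))
      (Measure.pi fun _ : A => stdGauss I) := by
  refine MeasurePreserving.symm (MeasurableEquiv.curry A I ℝ).symm
    ⟨(MeasurableEquiv.curry A I ℝ).symm.measurable, ?_⟩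
  refine (Measure.pi_eq fun s _ => ?_).symm
  rw [MeasurableEquiv.map_apply]
  have : (MeasurableEquiv.curry A I ℝ).symm ⁻¹' (Set.univ.pi s) =
      Set.univ.pi fun a => Set.univ.pi fun i => s (a, i) := by
    ext x
    simp [Set.mem_pi, MeasurableEquiv.coe_curry_symm]
  rw [this, Measure.pi_pi, Fintype.prod_prod_type]
  simp_rw [Measure.pi_pi]

/-- After uncurrying, the map acts on `ℝ^(A × I)` by the matrix `R` separately for each `i`, so it
is an isometry, and the standard Gaussian measure is invariant under isometries. -/
theorem measurePreserving_rotate [DecidableEq A] (R : Matrix A A ℝ) (hR : R.transpose * R = 1) :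
    MeasurePreserving (fun (G : A → I → ℝ) a i => ∑ b, R a b * G b i)
      (Measure.pi fun _ : A => stdGauss I) (Measure.pi fun _ : A => stdGauss I) := by
  let T : (A × I → ℝ) →ₗ[ℝ] (A × I → ℝ) :=
    { toFun := fun x q => ∑ b, R q.1 b * x (b, q.2)
      map_add' := fun x y => by funext q; simp [mul_add, Finset.sum_add_distrib]
      map_smul' := fun c x => by
        funext q; simp only [Pi.smul_apply, smul_eq_mul, RingHom.id_apply, Finset.mul_sum]
        exact Finset.sum_congr rfl fun b _ => by ring }
  have hT : ∀ x, ∑ q, T x q ^ 2 = ∑ q, x q ^ 2 := by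
    intro x
    rw [Fintype.sum_prod_type_right, Fintype.sum_prod_type_right]
    refine Finset.sum_congr rfl fun i _ => ?_
    let v : A → ℝ := fun a => x (a, i)
    have h1 : R.mulVec v ⬝ᵥ R.mulVec v = v ⬝ᵥ v := by
      rw [Matrix.dotProduct_mulVec, ← Matrix.mulVec_transpose, Matrix.mulVec_mulVec, hR,
        Matrix.one_mulVec]
    simpa [dotProduct, Matrix.mulVec, sq, T, v] using h1
  have h := (measurePreserving_curry_stdGauss (A := A) (I := I)).comp
    ((measurePreserving_stdGauss_of_isometry T hT).comp
      (MeasurePreserving.symm _ (measurePreserving_curry_stdGauss (A := A) (I := I))))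
  exact h

end Rotation
end StrongAnticoncentration

namespace StrongAnticoncentration
open scoped ENNReal NNReal
open MvPolynomial

/-! ### Replacing the Gaussian point by a point on a sphere, and counting fibres there. -/

section SphericalAverage

variable {k n : ℕ}

/-- The linear combination of the rows of `G` with coefficients `u`. -/
def comb (u : Fin (k + 1) → ℝ) (G : Fin (k + 1) → Fin n → ℝ) : Fin n → ℝ :=
  fun i => ∑ a, u a * G a i

/-- The matrix with rows `u` and the gradients at `u` of the functions `v ↦ p_b(comb v G)`. -/
noncomputable def tangentMatrix (p : Fin k → MvPolynomial (Fin n) ℝ)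
    (G : Fin (k + 1) → Fin n → ℝ) (u : Fin (k + 1) → ℝ) :
    Matrix (Fin (k + 1)) (Fin (k + 1)) ℝ :=
  Matrix.of (Fin.cons u fun b a => dirDeriv (p b) (G a) (comb u G))

@[simp] theorem tangentMatrix_zero (p : Fin k → MvPolynomial (Fin n) ℝ)
    (G : Fin (k + 1) → Fin n → ℝ) (u : Fin (k + 1) → ℝ) (a : Fin (k + 1)) :
    tangentMatrix p G u 0 a = u a := rfl

@[simp] theorem tangentMatrix_succ (p : Fin k → MvPolynomial (Fin n) ℝ)
    (G : Fin (k + 1) → Fin n → ℝ) (u : Fin (k + 1) → ℝ) (b : Fin k) (a : Fin (k + 1)) :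
    tangentMatrix p G u b.succ a = dirDeriv (p b) (G a) (comb u G) := rfl

theorem exists_rotation (u : Fin (k + 1) → ℝ) (hu : ∑ a, u a ^ 2 = 1) :
    ∃ R : Matrix (Fin (k + 1)) (Fin (k + 1)) ℝ, R.transpose * R = 1 ∧ ∀ a, R 0 a = u a := by
  let v : Fin (k + 1) → EuclideanSpace ℝ (Fin (k + 1)) := fun _ => WithLp.toLp 2 u
  have hv : Orthonormal ℝ (({0} : Set (Fin (k + 1))).domRestrict v) := by
    constructor
    · intro i
      have h : ‖(WithLp.toLp 2 u : EuclideanSpace ℝ (Fin (k + 1)))‖ ^ 2 = 1 := by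
        rw [EuclideanSpace.real_norm_sq_eq]; exact hu
      exact (sq_eq_sq₀ (norm_nonneg _) zero_le_one).1 (h.trans (one_pow 2).symm)
    · intro i j hij
      exact absurd (Subsingleton.elim i j) hij
  obtain ⟨b, hb⟩ := hv.exists_orthonormalBasis_extension_of_card_eq (by simp)
  refine ⟨Matrix.of fun i a => b i a, ?_, fun a => ?_⟩
  · rw [mul_eq_one_comm]
    ext i j
    rw [Matrix.mul_apply, Matrix.one_apply]
    have h := b.inner_eq_ite j i
    rw [PiLp.inner_apply] at h
    simp only [RCLike.inner_apply, conj_trivial] at h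
    simp only [Matrix.of_apply, Matrix.transpose_apply]
    rw [h]
    simp [eq_comm]
  · simp [hb 0 (Set.mem_singleton _), v]

theorem dirDeriv_comb (p : MvPolynomial (Fin n) ℝ) (u : Fin (k + 1) → ℝ)
    (G : Fin (k + 1) → Fin n → ℝ) (x : Fin n → ℝ) :
    dirDeriv p (comb u G) x = ∑ a, dirDeriv p (G a) x * u a := by
  simp only [dirDeriv, comb, Finset.mul_sum, Finset.sum_mul]
  rw [Finset.sum_comm]
  exact Finset.sum_congr rfl fun i _ => Finset.sum_congr rfl fun a _ => by ring

/-- Multiplying the tangent matrix at `R 0` by `Rᵀ` keeps the absolute determinant. It turns the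
first row into `(1, 0, …, 0)` by orthonormality of the rows of `R`, and the remaining minor is the
Jacobian along the other rotated vectors. -/
theorem abs_det_rotated (p : Fin k → MvPolynomial (Fin n) ℝ) (G : Fin (k + 1) → Fin n → ℝ)
    (R : Matrix (Fin (k + 1)) (Fin (k + 1)) ℝ) (hR : R.transpose * R = 1) :
    |(Matrix.of fun b a : Fin k => dirDeriv (p b) (comb (R a.succ) G) (comb (R 0) G)).det| =
      |(tangentMatrix p G (R 0)).det| := by
  have hR' : R * R.transpose = 1 := mul_eq_one_comm.1 hR
  have hdetR : |R.transpose.det| = 1 := by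
    have h := congrArg Matrix.det hR
    rw [Matrix.det_mul, Matrix.det_transpose, Matrix.det_one] at h
    rw [Matrix.det_transpose]
    rcases mul_self_eq_one_iff.1 h with h | h <;> rw [h] <;> simp
  rw [← mul_one |(tangentMatrix p G (R 0)).det|, ← hdetR, ← abs_mul, ← Matrix.det_mul]
  congr 1
  have h0 : ∀ a, (tangentMatrix p G (R 0) * R.transpose) 0 a = if a = 0 then 1 else 0 := by
    intro a
    have h := congrFun (congrFun hR' 0) a
    rw [Matrix.one_apply] at h
    simp only [eq_comm] at h ⊢
    rw [h]; rfl
  rw [Matrix.det_succ_row_zero, Finset.sum_eq_single 0]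
  · rw [h0]
    simp only [Fin.val_zero, pow_zero, if_true, mul_one, one_mul]
    congr 1
    ext b a
    simp only [Matrix.of_apply, Matrix.submatrix_apply, Matrix.mul_apply, Matrix.transpose_apply,
      tangentMatrix_succ, Fin.zero_succAbove]
    exact dirDeriv_comb _ _ _ _
  · intro a _ ha
    rw [h0, if_neg ha]; simp
  · simp

theorem measurable_comb {α : Type*} [MeasurableSpace α] {u : α → Fin (k + 1) → ℝ}
    {G : α → Fin (k + 1) → Fin n → ℝ} (hu : Measurable u) (hG : Measurable G) :
    Measurable fun x => comb (u x) (G x) := by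
  unfold comb; fun_prop

theorem measurable_det_tangentMatrix {α : Type*} [MeasurableSpace α]
    (p : Fin k → MvPolynomial (Fin n) ℝ) {u : α → Fin (k + 1) → ℝ}
    {G : α → Fin (k + 1) → Fin n → ℝ} (hu : Measurable u) (hG : Measurable G) :
    Measurable fun x => (tangentMatrix p (G x) (u x)).det := by
  refine measurable_matrix_det fun i j => ?_
  refine Fin.cases ?_ (fun b => ?_) i
  · simp only [tangentMatrix_zero]; fun_prop
  · simp only [tangentMatrix_succ]
    exact measurable_dirDeriv_comp _ ((measurable_pi_apply j).comp hG) (measurable_comb hu hG)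

/-- Apply the invariance under mixing with an orthogonal matrix whose first row is `u`. The left
side does not depend on `u`, so the right side can be averaged over any family of unit vectors. -/
theorem lintegral_jacobian_eq (p : Fin k → MvPolynomial (Fin n) ℝ) (h : Fin k → ℝ → ℝ≥0∞)
    (hh : ∀ b, Measurable (h b)) (u : Fin (k + 1) → ℝ) (hu : ∑ a, u a ^ 2 = 1) :
    ∫⁻ G : Fin (k + 1) → Fin n → ℝ,
        ENNReal.ofReal |(Matrix.of fun b a : Fin k => dirDeriv (p b) (G a.succ) (G 0)).det| *
          ∏ b, h b (eval (G 0) (p b)) ∂(Measure.pi fun _ => stdGauss (Fin n)) =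
      ∫⁻ G : Fin (k + 1) → Fin n → ℝ, ENNReal.ofReal |(tangentMatrix p G u).det| *
          ∏ b, h b (eval (comb u G) (p b)) ∂Measure.pi fun _ => stdGauss (Fin n) := by
  obtain ⟨R, hR, hRu⟩ := exists_rotation u hu
  have hRu' : R 0 = u := funext hRu
  have hmp := measurePreserving_rotate (I := Fin n) R hR
  rw [← hmp.lintegral_comp]
  · refine lintegral_congr fun G => ?_
    rw [← hRu', ← abs_det_rotated p G R hR]
    rfl
  · refine Measurable.mul (ENNReal.measurable_ofReal.comp (Measurable.abs ?_)) ?_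
    · exact measurable_matrix_det fun b a =>
        measurable_dirDeriv_comp (p b) (measurable_pi_apply _) (measurable_pi_apply _)
    · exact Finset.measurable_prod _ fun b _ =>
        (hh b).comp (measurable_eval_comp _ (measurable_pi_apply _))

/-- The squared Euclidean length of a vector. -/
def lenSq (r : Fin (k + 1) → ℝ) : ℝ := ∑ a, r a ^ 2

/-- The vector `r` scaled to unit Euclidean length. -/
noncomputable def unitVec (r : Fin (k + 1) → ℝ) : Fin (k + 1) → ℝ :=
  fun a => (Real.sqrt (lenSq r))⁻¹ * r a

theorem sum_unitVec_sq {r : Fin (k + 1) → ℝ} (hr : 0 < lenSq r) : ∑ a, unitVec r a ^ 2 = 1 := by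
  simp only [unitVec, mul_pow, ← Finset.mul_sum]
  rw [inv_pow, Real.sq_sqrt hr.le]
  exact inv_mul_cancel₀ hr.ne'

theorem measurable_unitVec : Measurable (unitVec (k := k)) := by
  unfold unitVec lenSq; fun_prop

/-- The polar map: squared length, and the values of the `p_b` at the unit vector. -/
noncomputable def polarMap (p : Fin k → MvPolynomial (Fin n) ℝ) (G : Fin (k + 1) → Fin n → ℝ)
    (r : Fin (k + 1) → ℝ) : Fin (k + 1) → ℝ :=
  Fin.cons (lenSq r) fun b => eval (comb (unitVec r) G) (p b)

/-- The Jacobian matrix of `polarMap`. -/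
noncomputable def polarJacobian (p : Fin k → MvPolynomial (Fin n) ℝ)
    (G : Fin (k + 1) → Fin n → ℝ) (r : Fin (k + 1) → ℝ) :
    Matrix (Fin (k + 1)) (Fin (k + 1)) ℝ :=
  Matrix.of (Fin.cons (fun a => 2 * r a) fun b a => (Real.sqrt (lenSq r))⁻¹ *
    (dirDeriv (p b) (G a) (comb (unitVec r) G) -
      (∑ c, dirDeriv (p b) (G c) (comb (unitVec r) G) * unitVec r c) * unitVec r a))

theorem hasFDerivAt_lenSq (r : Fin (k + 1) → ℝ) :
    HasFDerivAt lenSq (∑ a, (2 * r a) • ContinuousLinearMap.proj (R := ℝ)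
      (φ := fun _ : Fin (k + 1) => ℝ) a) r := by
  unfold lenSq
  refine HasFDerivAt.fun_sum fun a _ => ?_
  have h := (hasFDerivAt_apply (𝕜 := ℝ) (F' := fun _ : Fin (k + 1) => ℝ) a r).pow 2
  refine h.congr_fderiv ?_
  ext v; simp

theorem hasFDerivAt_polarMap (p : Fin k → MvPolynomial (Fin n) ℝ) (G : Fin (k + 1) → Fin n → ℝ)
    {r : Fin (k + 1) → ℝ} (hr : 0 < lenSq r) :
    HasFDerivAt (polarMap p G)
      (LinearMap.toContinuousLinearMap (Matrix.toLin' (polarJacobian p G r))) r := by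
  rw [hasFDerivAt_pi']
  intro j
  set s := Real.sqrt (lenSq r) with hs
  have hspos : 0 < s := Real.sqrt_pos.2 hr
  refine Fin.cases ?_ (fun b => ?_) j
  · refine (hasFDerivAt_lenSq r).congr_fderiv ?_
    ext v
    simp [polarJacobian, Matrix.mulVec, dotProduct]
  · have hinv : HasFDerivAt (fun r : Fin (k + 1) → ℝ => (Real.sqrt (lenSq r))⁻¹)
        ((-(s ^ 2)⁻¹ * (1 / (2 * s))) • ∑ a, (2 * r a) • ContinuousLinearMap.proj (R := ℝ)
          (φ := fun _ : Fin (k + 1) => ℝ) a) r := by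
      have h1 := (hasDerivAt_inv hspos.ne').comp_hasFDerivAt r
        ((hasFDerivAt_lenSq r).sqrt hr.ne')
      refine h1.congr_fderiv ?_
      rw [smul_smul]
    have hunit : HasFDerivAt (fun r : Fin (k + 1) → ℝ => comb (unitVec r) G)
        (ContinuousLinearMap.pi fun i => ∑ a, G a i • (s⁻¹ • ContinuousLinearMap.proj (R := ℝ)
          (φ := fun _ : Fin (k + 1) => ℝ) a + r a • ((-(s ^ 2)⁻¹ * (1 / (2 * s))) •
            ∑ a, (2 * r a) • ContinuousLinearMap.proj (R := ℝ)
              (φ := fun _ : Fin (k + 1) => ℝ) a))) r := by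
      rw [hasFDerivAt_pi]
      intro i
      unfold comb unitVec
      refine HasFDerivAt.fun_sum fun a _ => ?_
      exact (hinv.fun_mul (hasFDerivAt_apply (𝕜 := ℝ) (F' := fun _ : Fin (k + 1) => ℝ) a r)).mul_const
        (G a i)
    have h := (hasFDerivAt_eval (p b) (comb (unitVec r) G)).comp r hunit
    refine h.congr_fderiv ?_
    ext v
    have hu : ∀ a, unitVec r a = s⁻¹ * r a := fun a => rfl
    simp only [ContinuousLinearMap.comp_apply, sum_apply, smul_apply, add_apply,
      ContinuousLinearMap.proj_apply, ContinuousLinearMap.pi_apply, smul_eq_mul,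
      LinearMap.coe_toContinuousLinearMap', Matrix.toLin'_apply, Matrix.mulVec, dotProduct,
      polarJacobian, Matrix.of_apply, Fin.cons_succ, dirDeriv, ← hs, hu]
    set x := comb (unitVec r) G
    set L := ∑ a, 2 * r a * v a with hL
    set D : Fin (k + 1) → ℝ := fun a => ∑ i, eval x (pderiv i (p b)) * G a i with hD
    have e1 : ∑ i, eval x (pderiv i (p b)) * ∑ a, G a i *
        (s⁻¹ * v a + r a * (-(s ^ 2)⁻¹ * (1 / (2 * s)) * L)) =
        ∑ a, D a * (s⁻¹ * v a + r a * (-(s ^ 2)⁻¹ * (1 / (2 * s)) * L)) := by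
      simp only [hD, Finset.mul_sum, Finset.sum_mul]
      rw [Finset.sum_comm]
      exact Finset.sum_congr rfl fun a _ => Finset.sum_congr rfl fun i _ => by ring
    rw [e1]
    have e2 : ∑ a, D a * (s⁻¹ * v a + r a * (-(s ^ 2)⁻¹ * (1 / (2 * s)) * L)) =
        s⁻¹ * ∑ a, D a * v a - s⁻¹ ^ 3 * ((∑ a, D a * r a) * ∑ a, r a * v a) := by
      have : L = 2 * ∑ a, r a * v a := by
        rw [hL, Finset.mul_sum]; exact Finset.sum_congr rfl fun a _ => by ring
      rw [this]
      generalize ∑ a, r a * v a = M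
      rw [Finset.mul_sum, Finset.sum_mul, Finset.mul_sum, ← Finset.sum_sub_distrib]
      refine Finset.sum_congr rfl fun a _ => ?_
      field_simp
      ring
    rw [e2]
    have e3 : ∀ a, s⁻¹ * (D a - (∑ c, D c * (s⁻¹ * r c)) * (s⁻¹ * r a)) * v a =
        s⁻¹ * (D a * v a) - s⁻¹ ^ 3 * ((∑ c, D c * r c) * (r a * v a)) := by
      intro a
      have : ∑ c, D c * (s⁻¹ * r c) = s⁻¹ * ∑ c, D c * r c := by
        rw [Finset.mul_sum]; exact Finset.sum_congr rfl fun c _ => by ring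
      rw [this]; ring
    refine Eq.trans ?_ (Finset.sum_congr rfl fun a _ => (e3 a).symm)
    rw [Finset.sum_sub_distrib, ← Finset.mul_sum, ← Finset.mul_sum, ← Finset.mul_sum]

/-- Projecting the gradients to the tangent space of the sphere subtracts multiples of the first
row, which leaves the determinant unchanged. Only the scalings of the rows remain: `2 |r|` for the
first and `1 / |r|` for the `k` others. -/
theorem det_polarJacobian (p : Fin k → MvPolynomial (Fin n) ℝ) (G : Fin (k + 1) → Fin n → ℝ)
    {r : Fin (k + 1) → ℝ} (hr : 0 < lenSq r) :
    (polarJacobian p G r).det = 2 * Real.sqrt (lenSq r) * (Real.sqrt (lenSq r))⁻¹ ^ k *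
      (tangentMatrix p G (unitVec r)).det := by
  set s := Real.sqrt (lenSq r) with hs
  have hspos : 0 < s := Real.sqrt_pos.2 hr
  let c : Fin k → ℝ := fun b =>
    ∑ c, dirDeriv (p b) (G c) (comb (unitVec r) G) * unitVec r c
  let B : Matrix (Fin (k + 1)) (Fin (k + 1)) ℝ := Matrix.of (Fin.cons (unitVec r) fun b a =>
    dirDeriv (p b) (G a) (comb (unitVec r) G) - c b * unitVec r a)
  let w : Fin (k + 1) → ℝ := Fin.cons (2 * s) fun _ => s⁻¹
  have h1 : polarJacobian p G r = Matrix.of fun i j => w i * B i j := by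
    ext i j
    refine Fin.cases ?_ (fun b => ?_) i
    · change 2 * r j = 2 * s * (s⁻¹ * r j)
      field_simp
    · rfl
  have h2 : B.det = (tangentMatrix p G (unitVec r)).det := by
    refine Matrix.det_eq_of_forall_row_eq_smul_add_const (Fin.cons 0 fun b => - c b) 0 rfl ?_
    intro i j
    refine Fin.cases ?_ (fun b => ?_) i
    · change unitVec r j = unitVec r j + 0 * unitVec r j
      ring
    · change _ - c b * unitVec r j = _ + - c b * unitVec r j
      rw [tangentMatrix_succ]; ring
  rw [h1, Matrix.det_mul_column, h2, Fin.prod_univ_succ]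
  simp [w]

/-- The polynomial `u ↦ p(comb u G)`. -/
noncomputable def pullback (p : MvPolynomial (Fin n) ℝ) (G : Fin (k + 1) → Fin n → ℝ) :
    MvPolynomial (Fin (k + 1)) ℝ :=
  aeval (fun i => ∑ a, C (G a i) * X a) p

theorem eval_pullback (p : MvPolynomial (Fin n) ℝ) (G : Fin (k + 1) → Fin n → ℝ)
    (u : Fin (k + 1) → ℝ) : eval u (pullback p G) = eval (comb u G) p := by
  have : (eval u).comp (aeval (R := ℝ) (fun i => ∑ a, C (G a i) * X a)).toRingHom =
      eval (comb u G) := by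
    apply ringHom_ext
    · intro x; simp
    · intro i; simp [comb, mul_comm]
  exact congrArg (fun f : MvPolynomial (Fin n) ℝ →+* ℝ => f p) this

theorem totalDegree_pullback_le (p : MvPolynomial (Fin n) ℝ) (G : Fin (k + 1) → Fin n → ℝ) :
    (pullback p G).totalDegree ≤ p.totalDegree := by
  refine totalDegree_aeval_le _ (fun i => ?_) p
  refine totalDegree_finsetSum_le fun a _ => ?_
  refine (totalDegree_mul _ _).trans ?_
  rw [totalDegree_C, totalDegree_X]

theorem eval_pderiv_pullback (p : MvPolynomial (Fin n) ℝ) (G : Fin (k + 1) → Fin n → ℝ)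
    (u : Fin (k + 1) → ℝ) (a : Fin (k + 1)) :
    eval u (pderiv a (pullback p G)) = dirDeriv p (G a) (comb u G) := by
  have hcomb : HasFDerivAt (fun u : Fin (k + 1) → ℝ => comb u G)
      (ContinuousLinearMap.pi fun i => ∑ a, G a i • ContinuousLinearMap.proj (R := ℝ)
          (φ := fun _ : Fin (k + 1) => ℝ) a) u := by
    rw [hasFDerivAt_pi]
    intro i
    unfold comb
    exact HasFDerivAt.fun_sum fun a _ =>
      (hasFDerivAt_apply (𝕜 := ℝ) (F' := fun _ : Fin (k + 1) => ℝ) a u).mul_const (G a i)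
  have h1 := (hasFDerivAt_eval p (comb u G)).comp u hcomb
  have h2 := hasFDerivAt_eval (pullback p G) u
  have hfun : (fun u => eval u (pullback p G)) = (fun x => eval x p) ∘ fun u => comb u G :=
    funext fun u => eval_pullback p G u
  rw [hfun] at h2
  have h3 := congrArg (fun L : (Fin (k + 1) → ℝ) →L[ℝ] ℝ => L (Pi.single a 1)) (h2.unique h1)
  simpa [dirDeriv, Pi.single_apply] using h3

/-- The first coordinate of `polarMap` fixes the length, so points of a fibre are determined by
their directions. These are nondegenerate solutions of `|u|² = 1` and `p_b(comb u G) = y_b`, to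
which Bézout's bound applies. The sphere contributes the factor `2`, and the maximum with `1` is
there because that bound requires positive degree bounds. -/
theorem card_fibre_polarMap_le (p : Fin k → MvPolynomial (Fin n) ℝ) (d : Fin k → ℕ)
    (hdeg : ∀ b, (p b).totalDegree ≤ d b) (G : Fin (k + 1) → Fin n → ℝ)
    (y : Fin (k + 1) → ℝ) (Z : Finset (Fin (k + 1) → ℝ))
    (hZ : ∀ z ∈ Z, 0 < lenSq z ∧ (tangentMatrix p G (unitVec z)).det ≠ 0 ∧ polarMap p G z = y) :
    Z.card ≤ 2 * ∏ b, max (d b) 1 := by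
  classical
  have hinj : Set.InjOn unitVec (Z : Set (Fin (k + 1) → ℝ)) := by
    intro z hz z' hz' h
    have h1 : lenSq z = lenSq z' := by
      have e1 := congrFun (hZ z hz).2.2 0
      have e2 := congrFun (hZ z' hz').2.2 0
      exact e1.trans e2.symm
    have hpos : 0 < Real.sqrt (lenSq z) := Real.sqrt_pos.2 (hZ z hz).1
    funext a
    have h2 := congrFun h a
    simp only [unitVec, ← h1] at h2
    exact mul_left_cancel₀ (inv_ne_zero hpos.ne') h2
  rw [← Finset.card_image_of_injOn hinj]
  let f : Fin (k + 1) → MvPolynomial (Fin (k + 1)) ℝ :=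
    Fin.cons (∑ a, X a ^ 2 - C 1) fun b => pullback (p b) G - C (y b.succ)
  have hb := card_nondegenerate_zeros_le f (Fin.cons 2 fun b => max (d b) 1) ?_ ?_
    (Z.image unitVec) ?_ ?_
  · rw [Fin.prod_univ_succ] at hb
    simpa using hb
  · intro j
    refine Fin.cases ?_ (fun b => ?_) j <;> simp
  · intro j
    refine Fin.cases ?_ (fun b => ?_) j
    · simp only [f, Fin.cons_zero]
      refine (totalDegree_sub _ _).trans (max_le (totalDegree_finsetSum_le fun a _ => ?_) ?_)
      · simp [totalDegree_X_pow]
      · simp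
    · simp only [f, Fin.cons_succ]
      refine (totalDegree_sub _ _).trans (max_le ?_ (by simp))
      exact (totalDegree_pullback_le _ _).trans ((hdeg b).trans (le_max_left _ _))
  · intro z hz j
    obtain ⟨r, hr, rfl⟩ := Finset.mem_image.1 hz
    obtain ⟨h1, _, h3⟩ := hZ r hr
    refine Fin.cases ?_ (fun b => ?_) j
    · simp [f, sum_unitVec_sq h1]
    · simp only [f, Fin.cons_succ, map_sub, eval_pullback, eval_C]
      rw [← h3]
      simp [polarMap]
  · intro z hz
    obtain ⟨r, hr, rfl⟩ := Finset.mem_image.1 hz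
    obtain ⟨h1, h2, _⟩ := hZ r hr
    -- The gradient of `|u|²` is `2u`, so the Jacobian of the system is the tangent matrix with its
    -- first row doubled.
    have : (Matrix.of fun j i => eval (unitVec r) (pderiv i (f j))) =
        Matrix.of fun i j => (Fin.cons 2 (fun _ => 1) : Fin (k + 1) → ℝ) i *
          tangentMatrix p G (unitVec r) i j := by
      ext j i
      refine Fin.cases ?_ (fun b => ?_) j
      · simp [f, pderiv_X, Pi.single_apply]
      · simp [f, eval_pderiv_pullback]
    rw [this, Matrix.det_mul_column, Fin.prod_univ_succ]
    simpa using h2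

end SphericalAverage
end StrongAnticoncentration

namespace StrongAnticoncentration
open scoped ENNReal NNReal
open MvPolynomial

/-! ### The bound for the averaged Jacobian. -/

section JacobianBound

variable {k n : ℕ}

/-- A box in the shell `1 ≤ |r| ≤ 2`. -/
noncomputable def shellBox (k : ℕ) : Set (Fin (k + 1) → ℝ) :=
  Set.Icc (fun _ => (Real.sqrt (k + 1))⁻¹) (fun _ => 2 * (Real.sqrt (k + 1))⁻¹)

theorem measurableSet_shellBox : MeasurableSet (shellBox k) := measurableSet_Icc

theorem lenSq_mem_of_mem_shellBox {r : Fin (k + 1) → ℝ} (hr : r ∈ shellBox k) :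
    lenSq r ∈ Set.Icc (1:ℝ) 4 := by
  set α := (Real.sqrt (k + 1))⁻¹ with hα
  have hα0 : 0 < α := by positivity
  have hα2 : ((k:ℝ) + 1) * α ^ 2 = 1 := by
    rw [hα, inv_pow, Real.sq_sqrt (by positivity)]; field_simp
  have h1 : ∀ a, α ≤ r a := hr.1
  have h2 : ∀ a, r a ≤ 2 * α := hr.2
  have e : ∀ c : ℝ, ∑ _a : Fin (k + 1), c = ((k:ℝ) + 1) * c := by intro c; simp
  constructor
  · calc (1:ℝ) = ∑ _a : Fin (k + 1), α ^ 2 := by rw [e, hα2]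
      _ ≤ lenSq r := Finset.sum_le_sum fun a _ => pow_le_pow_left₀ hα0.le (h1 a) 2
  · calc lenSq r ≤ ∑ _a : Fin (k + 1), (2 * α) ^ 2 :=
          Finset.sum_le_sum fun a _ => pow_le_pow_left₀ (hα0.le.trans (h1 a)) (h2 a) 2
      _ = 4 * (((k:ℝ) + 1) * α ^ 2) := by rw [e]; ring
      _ = 4 := by rw [hα2, mul_one]

/-- Averaging over the box divides by this volume, which is the source of the factor `√(k+1) ^
(k+1)`. -/
theorem volume_shellBox :
    volume (shellBox k) = ENNReal.ofReal ((Real.sqrt (k + 1))⁻¹ ^ (k + 1)) := by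
  rw [shellBox, Real.volume_Icc_pi, ENNReal.ofReal_pow (by positivity)]
  simp only [Finset.prod_const, Finset.card_univ, Fintype.card_fin]
  congr 2; ring

/-- The area formula for `polarMap` on the nondegenerate part of the box; degenerate points
contribute nothing to the integral. In the constant, `2 ∏ max(d_b, 1)` counts fibres, `3` is the
length of the interval `[1, 4]` of squared lengths, and `2 ^ k` compensates the factor `|r|⁻ᵏ` in
the Jacobian, as `|r| ≤ 2`. -/
theorem lintegral_tangentMatrix_le (p : Fin k → MvPolynomial (Fin n) ℝ) (d : Fin k → ℕ)
    (hdeg : ∀ b, (p b).totalDegree ≤ d b) (h : Fin k → ℝ → ℝ≥0∞) (hh : ∀ b, Measurable (h b))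
    (G : Fin (k + 1) → Fin n → ℝ) :
    ∫⁻ r in shellBox k, ENNReal.ofReal |(tangentMatrix p G (unitVec r)).det| *
        ∏ b, h b (eval (comb (unitVec r) G) (p b)) ≤
      ENNReal.ofReal (6 * 2 ^ k * ∏ b, (max (d b) 1 : ℕ)) * ∏ b, ∫⁻ t, h b t := by
  set D : Set (Fin (k + 1) → ℝ) := shellBox k ∩ {r | (tangentMatrix p G (unitVec r)).det ≠ 0}
    with hD
  have hdetm : Measurable fun r => (tangentMatrix p G (unitVec r)).det :=
    measurable_det_tangentMatrix p measurable_unitVec measurable_const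
  have hDm : MeasurableSet D :=
    measurableSet_shellBox.inter (hdetm (measurableSet_singleton 0).compl)
  have hlen : ∀ r ∈ D, 0 < lenSq r := fun r hr =>
    lt_of_lt_of_le one_pos (lenSq_mem_of_mem_shellBox hr.1).1
  let g : (Fin (k + 1) → ℝ) → ℝ≥0∞ := fun y =>
    ∏ j, (Fin.cons ((Set.Icc (1:ℝ) 4).indicator 1) h : Fin (k + 1) → ℝ → ℝ≥0∞) j (y j)
  have hcons : ∀ j, Measurable
      ((Fin.cons ((Set.Icc (1:ℝ) 4).indicator 1) h : Fin (k + 1) → ℝ → ℝ≥0∞) j) := by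
    intro j
    refine Fin.cases ?_ (fun b => ?_) j
    · exact measurable_one.indicator measurableSet_Icc
    · exact hh b
  have hgm : Measurable g := Finset.measurable_prod _ fun j _ =>
    (hcons j).comp (measurable_pi_apply j)
  have hgint : ∫⁻ y, g y = 3 * ∏ b, ∫⁻ t, h b t := by
    rw [lintegral_prod_pi _ hcons, Fin.prod_univ_succ]
    simp only [Fin.cons_zero, Fin.cons_succ]
    rw [lintegral_indicator_one measurableSet_Icc, Real.volume_Icc]
    norm_num
  have hdetJ : ∀ r ∈ D, (LinearMap.toContinuousLinearMap
      (Matrix.toLin' (polarJacobian p G r))).det = (polarJacobian p G r).det := by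
    intro r _
    rw [LinearMap.det_toContinuousLinearMap, LinearMap.det_toLin']
  have hmain := lintegral_abs_det_mul_le_of_card_fibre_le volume hDm (polarMap p G)
    (fun r => LinearMap.toContinuousLinearMap (Matrix.toLin' (polarJacobian p G r)))
    (fun r hr => (hasFDerivAt_polarMap p G (hlen r hr)).hasFDerivWithinAt)
    (fun r hr => by
      rw [hdetJ r hr, det_polarJacobian p G (hlen r hr)]
      have hs := Real.sqrt_pos.2 (hlen r hr)
      exact mul_ne_zero (by positivity) hr.2)
    (2 * ∏ b, max (d b) 1)
    (fun y Z hZ => card_fibre_polarMap_le p d hdeg G y Z fun z hz =>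
      ⟨hlen z (hZ z hz).1, (hZ z hz).1.2, (hZ z hz).2⟩) g hgm
  have hpt : ∀ r ∈ D, ENNReal.ofReal |(tangentMatrix p G (unitVec r)).det| *
        ∏ b, h b (eval (comb (unitVec r) G) (p b)) ≤ ENNReal.ofReal (2 ^ k) *
      (ENNReal.ofReal |(LinearMap.toContinuousLinearMap
      (Matrix.toLin' (polarJacobian p G r))).det| * g (polarMap p G r)) := by
    intro r hr
    have hmem := lenSq_mem_of_mem_shellBox hr.1
    have hgv : g (polarMap p G r) = ∏ b, h b (eval (comb (unitVec r) G) (p b)) := by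
      simp only [g, Fin.prod_univ_succ, polarMap, Fin.cons_zero, Fin.cons_succ]
      rw [Set.indicator_of_mem hmem]; simp
    rw [hgv, ← mul_assoc, ← ENNReal.ofReal_mul (by positivity), hdetJ r hr,
      det_polarJacobian p G (hlen r hr)]
    refine mul_le_mul_left (ENNReal.ofReal_le_ofReal ?_) _
    set s := Real.sqrt (lenSq r) with hs
    have hs1 : 1 ≤ s := Real.one_le_sqrt.2 hmem.1
    have hs2 : s ≤ 2 := by rw [hs, Real.sqrt_le_left (by norm_num)]; linarith [hmem.2]
    rw [abs_mul, abs_of_pos (show 0 < 2 * s * s⁻¹ ^ k by positivity), ← mul_assoc]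
    refine le_mul_of_one_le_left (abs_nonneg _) ?_
    have : (1:ℝ) ≤ 2 ^ k * s⁻¹ ^ k := by
      rw [← mul_pow]
      refine one_le_pow₀ ?_
      rw [← div_eq_mul_inv, one_le_div (by positivity)]; exact hs2
    calc (1:ℝ) ≤ 1 * (2 ^ k * s⁻¹ ^ k) := by rw [one_mul]; exact this
      _ ≤ (2 * s) * (2 ^ k * s⁻¹ ^ k) := by gcongr; linarith
      _ = _ := by ring
  have hres : ∫⁻ r in shellBox k, ENNReal.ofReal |(tangentMatrix p G (unitVec r)).det| *
        ∏ b, h b (eval (comb (unitVec r) G) (p b)) =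
      ∫⁻ r in D, ENNReal.ofReal |(tangentMatrix p G (unitVec r)).det| *
        ∏ b, h b (eval (comb (unitVec r) G) (p b)) := by
    rw [← lintegral_inter_add_sdiff _ (shellBox k)
      (hdetm (measurableSet_singleton (0:ℝ)).compl), ← add_zero (∫⁻ r in D, _)]
    congr 1
    refine setLIntegral_eq_zero (measurableSet_shellBox.diff
      (hdetm (measurableSet_singleton (0:ℝ)).compl)) fun r hr => ?_
    have : (tangentMatrix p G (unitVec r)).det = 0 := by
      by_contra hne; exact hr.2 hne
    simp [this]
  rw [hres]
  calc _ ≤ ∫⁻ r in D, ENNReal.ofReal (2 ^ k) * (ENNReal.ofReal |(LinearMap.toContinuousLinearMap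
        (Matrix.toLin' (polarJacobian p G r))).det| * g (polarMap p G r)) :=
        setLIntegral_mono' hDm hpt
    _ = ENNReal.ofReal (2 ^ k) * ∫⁻ r in D, ENNReal.ofReal |(LinearMap.toContinuousLinearMap
        (Matrix.toLin' (polarJacobian p G r))).det| * g (polarMap p G r) :=
        lintegral_const_mul' _ _ ENNReal.ofReal_ne_top
    _ ≤ ENNReal.ofReal (2 ^ k) * ((2 * ∏ b, max (d b) 1 : ℕ) * ∫⁻ y, g y) :=
        mul_le_mul_right hmain _
    _ = _ := by
        rw [hgint, ← mul_assoc, ← mul_assoc, ← ENNReal.ofReal_natCast,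
          ← ENNReal.ofReal_mul (by positivity),
          show (3 : ℝ≥0∞) = ENNReal.ofReal 3 by simp,
          ← ENNReal.ofReal_mul (by positivity)]
        congr 2
        push_cast; ring

/-- The expected Jacobian of `k` polynomials of a Gaussian vector along `k` independent Gaussian
directions, weighted by functions of the values of the polynomials. -/
theorem lintegral_jacobian_le (p : Fin k → MvPolynomial (Fin n) ℝ) (d : Fin k → ℕ)
    (hdeg : ∀ b, (p b).totalDegree ≤ d b) (h : Fin k → ℝ → ℝ≥0∞) (hh : ∀ b, Measurable (h b)) :
    ∫⁻ G : Fin (k + 1) → Fin n → ℝ,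
        ENNReal.ofReal |(Matrix.of fun b a : Fin k => dirDeriv (p b) (G a.succ) (G 0)).det| *
          ∏ b, h b (eval (G 0) (p b)) ∂(Measure.pi fun _ => stdGauss (Fin n)) ≤
      ENNReal.ofReal (Real.sqrt (k + 1) ^ (k + 1) * (6 * 2 ^ k * ∏ b, (max (d b) 1 : ℕ))) *
        ∏ b, ∫⁻ t, h b t := by
  set I := ∫⁻ G : Fin (k + 1) → Fin n → ℝ,
        ENNReal.ofReal |(Matrix.of fun b a : Fin k => dirDeriv (p b) (G a.succ) (G 0)).det| *
          ∏ b, h b (eval (G 0) (p b)) ∂(Measure.pi fun _ => stdGauss (Fin n)) with hI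
  have hrot : ∀ r ∈ shellBox k, I = ∫⁻ G : Fin (k + 1) → Fin n → ℝ,
      ENNReal.ofReal |(tangentMatrix p G (unitVec r)).det| *
          ∏ b, h b (eval (comb (unitVec r) G) (p b)) ∂(Measure.pi fun _ => stdGauss (Fin n)) :=
    fun r hr => lintegral_jacobian_eq p h hh (unitVec r) (sum_unitVec_sq
      (lt_of_lt_of_le one_pos (lenSq_mem_of_mem_shellBox hr).1))
  have hmeas : Measurable fun q : (Fin (k + 1) → ℝ) × (Fin (k + 1) → Fin n → ℝ) =>
      ENNReal.ofReal |(tangentMatrix p q.2 (unitVec q.1)).det| *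
          ∏ b, h b (eval (comb (unitVec q.1) q.2) (p b)) := by
    refine Measurable.mul (ENNReal.measurable_ofReal.comp (Measurable.abs ?_)) ?_
    · exact measurable_det_tangentMatrix p (measurable_unitVec.comp measurable_fst) measurable_snd
    · exact Finset.measurable_prod _ fun b _ => (hh b).comp (measurable_eval_comp _
        (measurable_comb (measurable_unitVec.comp measurable_fst) measurable_snd))
  -- The integral `I` equals its rotated form for each `r` in the box. Integrating over `r` and
  -- exchanging the integrals leaves the bound for fixed `G`, which is uniform in `G`.
  have h1 : I * volume (shellBox k) ≤
      ENNReal.ofReal (6 * 2 ^ k * ∏ b, (max (d b) 1 : ℕ)) * ∏ b, ∫⁻ t, h b t := by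
    rw [← setLIntegral_const, setLIntegral_congr_fun measurableSet_shellBox hrot,
      lintegral_lintegral_swap hmeas.aemeasurable]
    refine (lintegral_mono fun G => lintegral_tangentMatrix_le p d hdeg h hh G).trans ?_
    simp
  rw [volume_shellBox] at h1
  set α := Real.sqrt ((k:ℝ) + 1)
  have hα : 0 < α := by positivity
  calc I = ENNReal.ofReal (α ^ (k + 1)) * (I * ENNReal.ofReal (α⁻¹ ^ (k + 1))) := by
        rw [mul_comm I, ← mul_assoc, ← ENNReal.ofReal_mul (by positivity), ← mul_pow,
          mul_inv_cancel₀ hα.ne']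
        simp
    _ ≤ _ := mul_le_mul_right h1 _
    _ = _ := by rw [← mul_assoc, ← ENNReal.ofReal_mul (by positivity)]

end JacobianBound
end StrongAnticoncentration

namespace StrongAnticoncentration
open scoped ENNReal NNReal
open MvPolynomial

/-! ### The regularised weight `1/|w|` and its two estimates. -/

section Weight

/-- The inverse square of the weight `w ↦ 1/|w|` regularised below `δ` and above `M`. -/
noncomputable def weightDenom (δ M w : ℝ) : ℝ := (δ ^ 2 + w ^ 2) * (1 + w ^ 2 / M ^ 2)

theorem weightDenom_pos {δ : ℝ} (hδ : 0 < δ) (M w : ℝ) : 0 < weightDenom δ M w := by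
  unfold weightDenom; positivity

/-- The weight is at most `4M / ((δ + |t|)(2M + |t|))`, which is then split into partial fractions.
Taking `2M` instead of `M` as the upper scale gives `M ≤ 2M - δ`, so the numerator fits even when `δ
= M`. -/
theorem inv_sqrt_weightDenom_le {δ M t : ℝ} (hδ : 0 < δ) (hδM : δ ≤ M) :
    (Real.sqrt (weightDenom δ M t))⁻¹ ≤ 4 * ((δ + |t|)⁻¹ - (2 * M + |t|)⁻¹) := by
  have hM : 0 < M := hδ.trans_le hδM
  have h1 : (δ + |t|) * (2 * M + |t|) / (4 * M) ≤ Real.sqrt (weightDenom δ M t) := by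
    apply Real.le_sqrt_of_sq_le
    have a1 : (δ + |t|) ^ 2 ≤ 2 * (δ ^ 2 + t ^ 2) := by
      rw [← sq_abs t]; nlinarith [sq_nonneg (δ - |t|)]
    have a2 : ((2 * M + |t|) / (4 * M)) ^ 2 ≤ (1 / 2) * (1 + t ^ 2 / M ^ 2) := by
      rw [← sq_abs t]
      rw [div_pow, div_le_iff₀ (by positivity)]
      have : 1 / 2 * (1 + |t| ^ 2 / M ^ 2) * (4 * M) ^ 2 = 8 * (M ^ 2 + |t| ^ 2) := by
        field_simp; ring
      rw [this]
      nlinarith [sq_nonneg (2 * M - |t|)]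
    calc ((δ + |t|) * (2 * M + |t|) / (4 * M)) ^ 2
        = (δ + |t|) ^ 2 * ((2 * M + |t|) / (4 * M)) ^ 2 := by ring
      _ ≤ (2 * (δ ^ 2 + t ^ 2)) * ((1 / 2) * (1 + t ^ 2 / M ^ 2)) := by gcongr
      _ = weightDenom δ M t := by unfold weightDenom; ring
  calc (Real.sqrt (weightDenom δ M t))⁻¹ ≤ ((δ + |t|) * (2 * M + |t|) / (4 * M))⁻¹ := by
        gcongr
    _ = 4 * M / ((δ + |t|) * (2 * M + |t|)) := by rw [inv_div]
    _ ≤ 4 * (2 * M - δ) / ((δ + |t|) * (2 * M + |t|)) := by gcongr; linarith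
    _ = _ := by field_simp; ring

/-- The majorant has the antiderivative `4 log ((δ + t) / (2M + t))` on the positive half-line,
which tends to zero at infinity. The two half-lines contribute equally. This is the origin of the
logarithms in the theorem. -/
theorem lintegral_weight_le {δ M : ℝ} (hδ : 0 < δ) (hδM : δ ≤ M) :
    ∫⁻ t, ENNReal.ofReal (Real.sqrt (weightDenom δ M t))⁻¹ ≤
      ENNReal.ofReal (8 * Real.log (2 * M / δ)) := by
  have hM : 0 < M := hδ.trans_le hδM
  let φ : ℝ → ℝ := fun t => 4 * ((δ + t)⁻¹ - (2 * M + t)⁻¹)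
  let H : ℝ → ℝ := fun t => 4 * (Real.log (δ + t) - Real.log (2 * M + t))
  have hder : ∀ t ∈ Set.Ici (0:ℝ), HasDerivAt H (φ t) t := by
    intro t ht
    have ht' : 0 ≤ t := ht
    have h1 : HasDerivAt (fun t => Real.log (δ + t)) (δ + t)⁻¹ t := by
      simpa using ((hasDerivAt_id t).const_add δ).log (by simp; positivity)
    have h2 : HasDerivAt (fun t => Real.log (2 * M + t)) (2 * M + t)⁻¹ t := by
      simpa using ((hasDerivAt_id t).const_add (2 * M)).log (by simp; positivity)
    exact (h1.sub h2).const_mul 4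
  have hpos : ∀ t ∈ Set.Ioi (0:ℝ), 0 ≤ φ t := by
    intro t ht
    have ht' : 0 < t := ht
    have : (2 * M + t)⁻¹ ≤ (δ + t)⁻¹ := by gcongr; linarith
    simp only [φ]; linarith
  have hlim : Filter.Tendsto H Filter.atTop (nhds 0) := by
    have h0 : Filter.Tendsto (fun t : ℝ => 1 - (2 * M - δ) / (2 * M + t)) Filter.atTop
        (nhds (1 - 0)) := tendsto_const_nhds.sub (tendsto_const_nhds.div_atTop
          (Filter.tendsto_atTop_add_const_left _ _ Filter.tendsto_id))
    have h1 := (Real.continuousAt_log (x := 1 - 0) (by norm_num)).tendsto.comp h0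
    have h2 := h1.const_mul (4:ℝ)
    simp only [sub_zero, Real.log_one, mul_zero] at h2
    refine h2.congr' ?_
    filter_upwards [Filter.eventually_ge_atTop (0:ℝ)] with t ht
    simp only [H, Function.comp]
    rw [← Real.log_div (by positivity) (by positivity)]
    congr 2
    field_simp; ring
  have hint := integrableOn_Ioi_deriv_of_nonneg' hder hpos hlim
  have hval : ∫⁻ t in Set.Ioi (0:ℝ), ENNReal.ofReal (φ |t|) =
      ENNReal.ofReal (4 * Real.log (2 * M / δ)) := by
    have e : ∫⁻ t in Set.Ioi (0:ℝ), ENNReal.ofReal (φ |t|) =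
        ∫⁻ t in Set.Ioi (0:ℝ), ENNReal.ofReal (φ t) :=
      setLIntegral_congr_fun measurableSet_Ioi fun t (ht : 0 < t) => by rw [abs_of_pos ht]
    rw [e, ← ofReal_integral_eq_lintegral_ofReal hint
      (ae_restrict_of_forall_mem measurableSet_Ioi hpos),
      integral_Ioi_of_hasDerivAt_of_nonneg' hder hpos hlim]
    congr 1
    simp only [H, add_zero]
    rw [Real.log_div (by positivity) hδ.ne']; ring
  have hneg : ∫⁻ t in (Set.Ioi (0:ℝ))ᶜ, ENNReal.ofReal (φ |t|) =
      ∫⁻ t in Set.Ioi (0:ℝ), ENNReal.ofReal (φ |t|) := by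
    have h1 := (Measure.measurePreserving_neg (volume : Measure ℝ)).setLIntegral_comp_preimage_emb
      (MeasurableEquiv.neg ℝ).measurableEmbedding (fun t => ENNReal.ofReal (φ |t|)) (Set.Ici 0)
    simp only [abs_neg] at h1
    rw [setLIntegral_congr Ioi_ae_eq_Ici, ← h1]
    congr 2
    ext t; simp
  calc ∫⁻ t, ENNReal.ofReal (Real.sqrt (weightDenom δ M t))⁻¹
      ≤ ∫⁻ t, ENNReal.ofReal (φ |t|) :=
        lintegral_mono fun t => ENNReal.ofReal_le_ofReal (inv_sqrt_weightDenom_le hδ hδM)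
    _ = ENNReal.ofReal (4 * Real.log (2 * M / δ)) + ENNReal.ofReal (4 * Real.log (2 * M / δ)) := by
        rw [← lintegral_add_compl _ (measurableSet_Ioi (a := (0:ℝ))), hneg, hval]
    _ = _ := by
        have : 0 ≤ Real.log (2 * M / δ) := Real.log_nonneg (by
          rw [one_le_div hδ]; linarith)
        rw [← ENNReal.ofReal_add (by positivity) (by positivity)]
        congr 1; ring

variable {K : Type*} [Fintype K]

theorem weightDenom_linearForm (a : K → ℝ) (δ M : ℝ) :
    (fun y : K → ℝ => weightDenom δ M (∑ i, a i * y i)) = fun y => δ ^ 2 +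
      (1 + δ ^ 2 / M ^ 2) * (∑ i, a i * y i) ^ 2 + (1 / M ^ 2) * (∑ i, a i * y i) ^ 4 := by
  funext y; unfold weightDenom; ring

theorem integrable_weightDenom (a : K → ℝ) (δ M : ℝ) :
    Integrable (fun y : K → ℝ => weightDenom δ M (∑ i, a i * y i)) (stdGauss K) := by
  rw [weightDenom_linearForm]
  exact ((integrable_const _).add ((integrable_linearForm_pow a 2).const_mul _)).add
    ((integrable_linearForm_pow a 4).const_mul _)

/-- With `ρ = max δ |a|`, the constant is `6 = 1 + 2 + 3`, from the constant, quadratic and quartic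
terms. The quartic term is `3 |a|⁴ / M²`, and this is where the upper truncation `|a| ≤ M` enters.
-/
theorem integral_weightDenom_le (a : K → ℝ) {δ M : ℝ} (hδ : 0 < δ) (hδM : δ ≤ M)
    (ha : norm2 a ≤ M) :
    ∫ y, weightDenom δ M (∑ i, a i * y i) ∂stdGauss K ≤ 6 * (max δ (norm2 a)) ^ 2 := by
  have hM : 0 < M := hδ.trans_le hδM
  have j1 : Integrable (fun y : K → ℝ => δ ^ 2 + (1 + δ ^ 2 / M ^ 2) * (∑ i, a i * y i) ^ 2)
    (stdGauss K) := (integrable_const _).add ((integrable_linearForm_pow a 2).const_mul _)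
  rw [weightDenom_linearForm, integral_add j1 ((integrable_linearForm_pow a 4).const_mul _),
    integral_add (integrable_const _) ((integrable_linearForm_pow a 2).const_mul _),
    integral_const_mul, integral_const_mul, integral_linearForm_sq, integral_linearForm_pow_four,
    ← norm2_sq]
  simp only [integral_const, probReal_univ, one_smul]
  set ρ := max δ (norm2 a) with hρ
  have h0 := norm2_nonneg a
  have h1 : δ ≤ ρ := le_max_left _ _
  have h2 : norm2 a ≤ ρ := le_max_right _ _
  have h3 : δ ^ 2 / M ^ 2 ≤ 1 := by
    rw [div_le_one (by positivity)]; gcongr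
  have h4 : 1 / M ^ 2 * (3 * (norm2 a ^ 2) ^ 2) ≤ 3 * ρ ^ 2 := by
    have : norm2 a ^ 2 / M ^ 2 ≤ 1 := by
      rw [div_le_one (by positivity)]; gcongr
    calc 1 / M ^ 2 * (3 * (norm2 a ^ 2) ^ 2) = 3 * ((norm2 a ^ 2 / M ^ 2) * norm2 a ^ 2) := by ring
      _ ≤ 3 * (1 * ρ ^ 2) := by gcongr
      _ = _ := by ring
  have h5 : (1 + δ ^ 2 / M ^ 2) * norm2 a ^ 2 ≤ (1 + 1) * ρ ^ 2 := by gcongr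
  have h6 : δ ^ 2 ≤ ρ ^ 2 := by gcongr
  linarith

end Weight

/-! ### Weighted first moments for contractions in several slots. -/

section MultiContraction

/-- The contraction of a tensor with index sets `K 0, …, K (m-1), T` by one vector for each
`K c`. -/
def multiContract {m : ℕ} {K : Fin m → Type} [∀ c, Fintype (K c)] {T : Type}
    (W : (∀ c, K c) → T → ℝ) (y : ∀ c, K c → ℝ) : Tensor T :=
  fun t => ∑ κ : ∀ c, K c, W κ t * ∏ c, y c (κ c)

theorem measurable_norm2_multiContract {m : ℕ} {K : Fin m → Type} [∀ c, Fintype (K c)] {T α : Type}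
    [Fintype T] [MeasurableSpace α] (W : α → (∀ c, K c) → T → ℝ) (y : α → ∀ c, K c → ℝ)
    (hW : ∀ κ t, Measurable fun x => W x κ t) (hy : Measurable y) :
    Measurable fun x => norm2 (multiContract (W x) (y x)) := by
  unfold norm2 multiContract
  refine Measurable.sqrt (Finset.measurable_sum _ fun t _ => Measurable.pow_const
    (Finset.measurable_sum _ fun κ _ => (hW κ t).mul (Finset.measurable_prod _ fun c _ => ?_)) 2)
  exact (measurable_pi_apply (κ c)).comp ((measurable_pi_apply c).comp hy)

/-- Contract one slot at a time. The remaining slots together with `T` form the index set of a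
single tensor for the one-slot estimate, and the contracted tensor is then fed into the induction
hypothesis. The weights multiply because each depends on one vector only. -/
theorem le_lintegral_norm2_multiContract {m : ℕ} {K : Fin m → Type} [∀ c, Fintype (K c)]
    {T : Type} [Fintype T] (W : (∀ c, K c) → T → ℝ) (F : ∀ c, (K c → ℝ) → ℝ)
    (hFm : ∀ c, Measurable (F c)) (hF0 : ∀ c y, 0 < F c y)
    (hF : ∀ c, Integrable (F c) (stdGauss (K c))) (ρ : Fin m → ℝ) (hρ : ∀ c, 0 < ρ c)
    (hFρ : ∀ c, ∫ y, F c y ∂stdGauss (K c) ≤ 6 * ρ c ^ 2) :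
    ENNReal.ofReal (Real.sqrt (∑ t, ∑ κ, W κ t ^ 2) / ∏ c, (10 * ρ c)) ≤
      ∫⁻ y, ENNReal.ofReal (norm2 (multiContract W y)) *
        ∏ c, ENNReal.ofReal (Real.sqrt (F c (y c)))⁻¹ ∂(Measure.pi fun c => stdGauss (K c)) := by
  induction m generalizing T with
  | zero =>
    simp [multiContract, norm2]
  | succ m ih =>
    let L : K 0 → ((∀ c : Fin m, K c.succ) × T) → ℝ := fun i q => W (Fin.cons i q.1) q.2
    let W' : (K 0 → ℝ) → (∀ c : Fin m, K c.succ) → T → ℝ := fun y₀ κ t => contract L y₀ (κ, t)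
    have hP : 0 < ∏ c : Fin m, (10 * ρ c.succ) :=
      Finset.prod_pos fun c _ => mul_pos (by norm_num) (hρ _)
    have hcons : ∀ (y₀ : K 0 → ℝ) (y' : ∀ c : Fin m, K c.succ → ℝ),
        multiContract W (Fin.cons y₀ y' : ∀ c, K c → ℝ) = multiContract (W' y₀) y' := by
      intro y₀ y'
      funext t
      simp only [multiContract, W', contract, L]
      rw [← (Fin.consEquiv K).sum_comp, Fintype.sum_prod_type_right]
      refine Finset.sum_congr rfl fun κ _ => ?_
      rw [Finset.sum_mul]
      refine Finset.sum_congr rfl fun i _ => ?_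
      simp only [Fin.consEquiv, Equiv.coe_fn_mk, Fin.prod_univ_succ, Fin.cons_zero, Fin.cons_succ]
      ring
    have hnorm : ∑ t, ∑ κ, W κ t ^ 2 = ∑ q, ∑ i, L i q ^ 2 := by
      rw [Fintype.sum_prod_type_right]
      refine Finset.sum_congr rfl fun t _ => ?_
      rw [← (Fin.consEquiv K).sum_comp, Fintype.sum_prod_type_right]
      rfl
    have hnorm' : ∀ y₀, Real.sqrt (∑ t, ∑ κ, W' y₀ κ t ^ 2) = norm2 (contract L y₀) := by
      intro y₀
      rw [norm2, Fintype.sum_prod_type_right]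
    have h0 := le_lintegral_norm2_contract L (F 0) (hF0 0) (hF 0) (ρ 0) (hρ 0) (hFρ 0)
    rw [lintegral_pi_fin_succ]
    have hW'm : ∀ κ t, Measurable fun y₀ => W' y₀ κ t := by
      intro κ t
      simp only [W', contract]; fun_prop
    have hmeas : Measurable fun p : (K 0 → ℝ) × (∀ c : Fin m, K c.succ → ℝ) =>
        ENNReal.ofReal (norm2 (multiContract W (Fin.cons p.1 p.2 : ∀ c, K c → ℝ))) *
        ∏ c, ENNReal.ofReal (Real.sqrt (F c ((Fin.cons p.1 p.2 : ∀ c, K c → ℝ) c)))⁻¹ := by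
      simp only [hcons, Fin.prod_univ_succ, Fin.cons_zero, Fin.cons_succ]
      refine (ENNReal.measurable_ofReal.comp (measurable_norm2_multiContract _ _
        (fun κ t => (hW'm κ t).comp measurable_fst) measurable_snd)).mul (Measurable.mul ?_ ?_)
      · exact ENNReal.measurable_ofReal.comp (((hFm 0).comp measurable_fst).sqrt.inv)
      · exact Finset.measurable_prod _ fun c _ => ENNReal.measurable_ofReal.comp
          ((hFm c.succ).comp ((measurable_pi_apply c).comp measurable_snd)).sqrt.inv
    rw [lintegral_prod _ hmeas.aemeasurable]
    simp only [hcons, Fin.prod_univ_succ, Fin.cons_zero, Fin.cons_succ]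
    rw [hnorm]
    set P := ∏ c : Fin m, (10 * ρ c.succ)
    calc ENNReal.ofReal (Real.sqrt (∑ q, ∑ i, L i q ^ 2) / (10 * ρ 0 * P))
        = ENNReal.ofReal P⁻¹ * ENNReal.ofReal (Real.sqrt (∑ q, ∑ i, L i q ^ 2) / (10 * ρ 0)) := by
          rw [← ENNReal.ofReal_mul (by positivity)]
          congr 1; field_simp
      _ ≤ ENNReal.ofReal P⁻¹ * ∫⁻ y, ENNReal.ofReal (norm2 (contract L y)) *
          ENNReal.ofReal (Real.sqrt (F 0 y))⁻¹ ∂stdGauss (K 0) := mul_le_mul_right h0 _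
      _ = ∫⁻ y, ENNReal.ofReal P⁻¹ * (ENNReal.ofReal (norm2 (contract L y)) *
          ENNReal.ofReal (Real.sqrt (F 0 y))⁻¹) ∂stdGauss (K 0) :=
          (lintegral_const_mul' _ _ ENNReal.ofReal_ne_top).symm
      _ ≤ _ := by
          refine lintegral_mono fun y₀ => ?_
          have hih := ih (W' y₀) (fun c => F c.succ) (fun c => hFm _) (fun c => hF0 _)
            (fun c => hF _) (fun c => ρ c.succ) (fun c => hρ _) (fun c => hFρ _)
          rw [hnorm'] at hih
          calc ENNReal.ofReal P⁻¹ * (ENNReal.ofReal (norm2 (contract L y₀)) *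
                ENNReal.ofReal (Real.sqrt (F 0 y₀))⁻¹)
              = ENNReal.ofReal (Real.sqrt (F 0 y₀))⁻¹ *
                ENNReal.ofReal (norm2 (contract L y₀) / P) := by
                rw [div_eq_mul_inv, ENNReal.ofReal_mul (norm2_nonneg _)]; ring
            _ ≤ _ := mul_le_mul_right hih _
            _ = _ := by
                rw [← lintegral_const_mul' _ _ ENNReal.ofReal_ne_top]
                refine lintegral_congr fun y' => ?_
                ring

end MultiContraction
end StrongAnticoncentration

namespace StrongAnticoncentration
open scoped ENNReal NNReal
open MvPolynomial

/-! ### From the wedge product to the averaged Jacobian. -/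

section WedgeMoment

variable {k n : ℕ}

/-- The polynomial `⟨g, A⟩` for a tensor-valued polynomial `A`. -/
noncomputable def contrPoly {S : Type} [Fintype S] (A : TensorPoly n S) (g : S → ℝ) :
    MvPolynomial (Fin n) ℝ := ∑ s, C (g s) * A s

theorem eval_contrPoly {S : Type} [Fintype S] (A : TensorPoly n S) (g : S → ℝ) (x : Fin n → ℝ) :
    eval x (contrPoly A g) = ∑ s, evalAt A x s * g s := by
  simp [contrPoly, evalAt, mul_comm]

theorem dirDeriv_contrPoly {S : Type} [Fintype S] (A : TensorPoly n S) (g : S → ℝ)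
    (y x : Fin n → ℝ) :
    dirDeriv (contrPoly A g) y x = ∑ i, (∑ s, evalAt (derivative A) x (i, s) * g s) * y i := by
  simp only [dirDeriv, contrPoly, map_sum, Derivation.leibniz, pderiv_C, mul_zero, add_zero,
    smul_eq_mul, map_mul, eval_C, evalAt, derivative]
  exact Finset.sum_congr rfl fun i _ => by
    congr 1; exact Finset.sum_congr rfl fun s _ => mul_comm _ _

theorem totalDegree_contrPoly_le {S : Type} [Fintype S] (A : TensorPoly n S) (g : S → ℝ) {d : ℕ}
    (hd : ∀ s, (A s).totalDegree ≤ d) : (contrPoly A g).totalDegree ≤ d := by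
  refine totalDegree_finsetSum_le fun s _ => (totalDegree_mul _ _).trans ?_
  rw [totalDegree_C, zero_add]; exact hd s

/-- The wedge product of the derivatives of the `A j`. -/
noncomputable abbrev wedgeDeriv {S : Fin k → Type} (A : (j : Fin k) → TensorPoly n (S j))
    (x : Fin n → ℝ) : Tensor ((Fin k → Fin n) × ((j : Fin k) → S j)) :=
  wedge (tensorProd fun j => evalAt (derivative (A j)) x)

variable {S : Fin k → Type} [∀ j, Fintype (S j)] (A : (j : Fin k) → TensorPoly n (S j))

/-- Pairing an antisymmetrised tensor product with a product of vectors gives the Leibniz expansion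
of a determinant: the sum over `i` and `s` factors for each permutation separately. -/
theorem contract_wedgeDeriv_eq_det (x : Fin n → ℝ) (g : ∀ j, S j → ℝ) (Y : Fin k → Fin n → ℝ) :
    ∑ i : Fin k → Fin n, (∑ s : ∀ j, S j, wedgeDeriv A x (i, s) * ∏ j, g j (s j)) *
      ∏ j, Y j (i j) =
      (Matrix.of fun b a : Fin k => dirDeriv (contrPoly (A b) (g b)) (Y a) x).det := by
  let E : ∀ j : Fin k, Fin n → ℝ := fun j i => ∑ s, evalAt (derivative (A j)) x (i, s) * g j s
  have h1 : ∀ i : Fin k → Fin n, ∑ s : ∀ j, S j, wedgeDeriv A x (i, s) * ∏ j, g j (s j) =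
      ∑ σ : Equiv.Perm (Fin k), ((Equiv.Perm.sign σ : ℤ) : ℝ) * ∏ j, E j (i (σ j)) := by
    intro i
    simp only [wedge, tensorProd, Finset.sum_mul]
    rw [Finset.sum_comm]
    refine Finset.sum_congr rfl fun σ _ => ?_
    simp only [E]
    rw [Finset.prod_univ_sum, Fintype.piFinset_univ, Finset.mul_sum]
    refine Finset.sum_congr rfl fun s _ => ?_
    rw [Finset.prod_mul_distrib]; ring
  have h2 : ∀ σ : Equiv.Perm (Fin k), ∑ i : Fin k → Fin n,
      (∏ j, E j (i (σ j))) * ∏ j, Y j (i j) = ∏ j, ∑ i, E j i * Y (σ j) i := by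
    intro σ
    rw [Finset.prod_univ_sum, Fintype.piFinset_univ,
      ← (Equiv.arrowCongr σ (Equiv.refl (Fin n))).sum_comp]
    refine Finset.sum_congr rfl fun i _ => ?_
    rw [Finset.prod_mul_distrib, ← Equiv.prod_comp σ (fun j => Y j _)]
    simp
  rw [← Matrix.det_transpose, Matrix.det_apply']
  simp_rw [h1, Finset.sum_mul]
  rw [Finset.sum_comm]
  refine Finset.sum_congr rfl fun σ _ => ?_
  simp only [Matrix.transpose_apply, Matrix.of_apply, dirDeriv_contrPoly]
  rw [← h2, Finset.mul_sum]
  exact Finset.sum_congr rfl fun i _ => by ring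

/-- The integrand of the averaged Jacobian bound. -/
noncomputable def jacobianWeight (δ M : Fin k → ℝ) (x : Fin n → ℝ) (g : ∀ j, S j → ℝ)
    (Y : Fin k → Fin n → ℝ) : ℝ≥0∞ :=
  ENNReal.ofReal |(Matrix.of fun b a : Fin k => dirDeriv (contrPoly (A b) (g b)) (Y a) x).det| *
    ∏ j, ENNReal.ofReal (Real.sqrt (weightDenom (δ j) (M j) (eval x (contrPoly (A j) (g j)))))⁻¹

theorem continuous_weightDenom (δ M : ℝ) : Continuous (weightDenom δ M) := by
  unfold weightDenom; fun_prop

theorem measurable_weight (δ M : ℝ) :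
    Measurable fun t => ENNReal.ofReal (Real.sqrt (weightDenom δ M t))⁻¹ :=
  ENNReal.measurable_ofReal.comp (continuous_weightDenom δ M).measurable.sqrt.inv

theorem measurable_evalAt_comp {T α : Type*} [MeasurableSpace α] (B : TensorPoly n T)
    {x : α → Fin n → ℝ} (hx : Measurable x) (t : T) : Measurable fun q => evalAt B (x q) t :=
  measurable_eval_comp _ hx

theorem measurable_jacobianWeight_comp {α : Type*} [MeasurableSpace α] (δ M : Fin k → ℝ)
    {x : α → Fin n → ℝ} {g : α → ∀ j, S j → ℝ} {Y : α → Fin k → Fin n → ℝ} (hx : Measurable x)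
    (hg : Measurable g) (hY : Measurable Y) :
    Measurable fun q => jacobianWeight A δ M (x q) (g q) (Y q) := by
  have hgm : ∀ j s, Measurable fun q => g q j s := fun j s =>
    (measurable_pi_apply s).comp ((measurable_pi_apply j).comp hg)
  have hYm : ∀ j i, Measurable fun q => Y q j i := fun j i =>
    (measurable_pi_apply i).comp ((measurable_pi_apply j).comp hY)
  unfold jacobianWeight
  refine (ENNReal.measurable_ofReal.comp (Measurable.abs (measurable_matrix_det fun b a => ?_))).mul
    (Finset.measurable_prod _ fun j _ => (measurable_weight _ _).comp ?_)
  · simp only [Matrix.of_apply, dirDeriv_contrPoly]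
    exact Finset.measurable_sum _ fun i _ => (Finset.measurable_sum _ fun s _ =>
      (measurable_evalAt_comp _ hx _).mul (hgm b s)).mul (hYm a i)
  · simp only [eval_contrPoly]
    exact Finset.measurable_sum _ fun s _ => (measurable_evalAt_comp _ hx _).mul (hgm j s)

/-- Two multiple contractions, each costing `10 ^ k`. The first uses Gaussian `g_j` in the slots `S
j`, with weights depending only on `⟨g_j, A^j(x)⟩`, so that they become functions of the scalar
polynomials in the Jacobian bound; these weights supply the denominators. The second uses Gaussian
`Y` in the derivative slots with trivial weights, after which only a determinant remains. -/
theorem norm2_wedgeDeriv_le_lintegral (δ M : Fin k → ℝ) (hδ : ∀ j, 0 < δ j)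
    (hδM : ∀ j, δ j ≤ M j) (x : Fin n → ℝ) (hx : ∀ j, norm2 (evalAt (A j) x) ≤ M j) :
    ENNReal.ofReal (norm2 (wedgeDeriv A x) / ∏ j, max (δ j) (norm2 (evalAt (A j) x))) ≤
      ENNReal.ofReal (100 ^ k) * ∫⁻ g, ∫⁻ Y, jacobianWeight A δ M x g Y
        ∂(Measure.pi fun _ : Fin k => stdGauss (Fin n)) ∂(Measure.pi fun j => stdGauss (S j)) := by
  set ρ : Fin k → ℝ := fun j => max (δ j) (norm2 (evalAt (A j) x)) with hρ
  have hρ0 : ∀ j, 0 < ρ j := fun j => (hδ j).trans_le (le_max_left _ _)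
  let F : ∀ j, (S j → ℝ) → ℝ := fun j y =>
    weightDenom (δ j) (M j) (∑ s, evalAt (A j) x s * y s)
  have hA := le_lintegral_norm2_multiContract (K := S) (T := Fin k → Fin n)
    (fun s i => wedgeDeriv A x (i, s)) F
    (fun j => (continuous_weightDenom _ _).measurable.comp (by fun_prop))
    (fun j y => weightDenom_pos (hδ j) _ _) (fun j => integrable_weightDenom _ _ _) ρ hρ0
    (fun j => integral_weightDenom_le _ (hδ j) (hδM j) (hx j))
  have hnorm : Real.sqrt (∑ i, ∑ s, wedgeDeriv A x (i, s) ^ 2) = norm2 (wedgeDeriv A x) := by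
    rw [norm2, Fintype.sum_prod_type]
  rw [hnorm] at hA
  have hB : ∀ g : ∀ j, S j → ℝ,
      ENNReal.ofReal (norm2 (multiContract (fun s i => wedgeDeriv A x (i, s)) g) / 10 ^ k) ≤
      ∫⁻ Y, ENNReal.ofReal |(Matrix.of fun b a : Fin k =>
        dirDeriv (contrPoly (A b) (g b)) (Y a) x).det|
        ∂(Measure.pi fun _ : Fin k => stdGauss (Fin n)) := by
    intro g
    have h := le_lintegral_norm2_multiContract (K := fun _ : Fin k => Fin n) (T := Unit)
      (fun i _ => multiContract (fun s i => wedgeDeriv A x (i, s)) g i) (fun _ _ => 1)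
      (fun _ => measurable_const) (fun _ _ => one_pos) (fun _ => integrable_const _) (fun _ => 1)
      (fun _ => one_pos) (fun _ => by norm_num)
    simp only [Finset.univ_unique, Finset.sum_singleton, mul_one, Finset.prod_const,
      Finset.card_univ, Fintype.card_fin, Real.sqrt_one, inv_one, ENNReal.ofReal_one, one_pow] at h
    refine h.trans (le_of_eq (lintegral_congr fun Y => ?_))
    rw [← contract_wedgeDeriv_eq_det]
    simp only [norm2, multiContract, Finset.univ_unique, Finset.sum_singleton]
    rw [Real.sqrt_sq_eq_abs]
  have hw : ∀ (g : ∀ j, S j → ℝ) j, F j (g j) =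
      weightDenom (δ j) (M j) (eval x (contrPoly (A j) (g j))) := fun g j => by
    rw [eval_contrPoly]
  have hscale : ENNReal.ofReal (norm2 (wedgeDeriv A x) / ∏ j, ρ j) = ENNReal.ofReal (10 ^ k) *
      ENNReal.ofReal (norm2 (wedgeDeriv A x) / ∏ j, (10 * ρ j)) := by
    rw [← ENNReal.ofReal_mul (by positivity), Finset.prod_mul_distrib]
    simp only [Finset.prod_const, Finset.card_univ, Fintype.card_fin]
    congr 1; field_simp
  rw [hscale]
  calc _ ≤ ENNReal.ofReal (10 ^ k) * ∫⁻ g, ENNReal.ofReal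
          (norm2 (multiContract (fun s i => wedgeDeriv A x (i, s)) g)) *
        ∏ j, ENNReal.ofReal (Real.sqrt (F j (g j)))⁻¹ ∂(Measure.pi fun j => stdGauss (S j)) :=
        mul_le_mul_right hA _
    _ ≤ ENNReal.ofReal (10 ^ k) * ∫⁻ g, ENNReal.ofReal (10 ^ k) *
          ∫⁻ Y, jacobianWeight A δ M x g Y ∂(Measure.pi fun _ : Fin k => stdGauss (Fin n))
          ∂(Measure.pi fun j => stdGauss (S j)) := by
        refine mul_le_mul_right (lintegral_mono fun g => ?_) _
        simp only [hw]
        have e : ENNReal.ofReal (norm2 (multiContract (fun s i => wedgeDeriv A x (i, s)) g)) =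
            ENNReal.ofReal (10 ^ k) * ENNReal.ofReal
              (norm2 (multiContract (fun s i => wedgeDeriv A x (i, s)) g) / 10 ^ k) := by
          rw [← ENNReal.ofReal_mul (by positivity)]
          congr 1; field_simp
        rw [e, mul_assoc]
        refine mul_le_mul_right ?_ _
        unfold jacobianWeight
        rw [lintegral_mul_const']
        · exact mul_le_mul_left (hB g) _
        · exact ENNReal.prod_ne_top fun j _ => ENNReal.ofReal_ne_top
    _ = _ := by
        rw [lintegral_const_mul' _ _ ENNReal.ofReal_ne_top, ← mul_assoc,
          ← ENNReal.ofReal_mul (by positivity), ← mul_pow]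
        norm_num

/-- Once `g` is moved outermost, the Jacobian bound applies to the polynomials `⟨g_b, A^b⟩`, with
`x` as the zeroth Gaussian vector and `Y` as the others, uniformly in `g`. The constant is `1600 =
100 · 2 · 8`, from the contractions, the shell and the weight integral. -/
theorem lintegral_norm2_wedgeDeriv_le (d : Fin k → ℕ)
    (hdeg : ∀ j s, (A j s).totalDegree ≤ d j) (δ M : Fin k → ℝ) (hδ : ∀ j, 0 < δ j)
    (hδM : ∀ j, δ j ≤ M j) :
    ∫⁻ x in {x | ∀ j, norm2 (evalAt (A j) x) ≤ M j},
        ENNReal.ofReal (norm2 (wedgeDeriv A x) / ∏ j, max (δ j) (norm2 (evalAt (A j) x)))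
        ∂stdGauss (Fin n) ≤
      ENNReal.ofReal (6 * 1600 ^ k * Real.sqrt (k + 1) ^ (k + 1) * (∏ j, (max (d j) 1 : ℕ)) *
        ∏ j, Real.log (2 * M j / δ j)) := by
  have hset : MeasurableSet {x : Fin n → ℝ | ∀ j, norm2 (evalAt (A j) x) ≤ M j} := by
    rw [Set.ofPred_forall]
    refine MeasurableSet.iInter fun j => measurableSet_le ?_ measurable_const
    unfold norm2
    exact Measurable.sqrt (Finset.measurable_sum _ fun s _ =>
      (measurable_evalAt_comp _ measurable_id s).pow_const 2)
  have hlog : ∀ j, 0 ≤ Real.log (2 * M j / δ j) := fun j => Real.log_nonneg (by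
    rw [one_le_div (hδ j)]; linarith [hδ j, hδM j])
  have hg : ∀ g : ∀ j, S j → ℝ, ∫⁻ x, ∫⁻ Y, jacobianWeight A δ M x g Y
      ∂(Measure.pi fun _ : Fin k => stdGauss (Fin n)) ∂stdGauss (Fin n) ≤
      ENNReal.ofReal (Real.sqrt (k + 1) ^ (k + 1) * (6 * 2 ^ k * ∏ b, (max (d b) 1 : ℕ))) *
        ∏ j, ENNReal.ofReal (8 * Real.log (2 * M j / δ j)) := by
    intro g
    have h := lintegral_jacobian_le (fun b => contrPoly (A b) (g b)) d
      (fun b => totalDegree_contrPoly_le _ _ (hdeg b))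
      (fun j t => ENNReal.ofReal (Real.sqrt (weightDenom (δ j) (M j) t))⁻¹)
      (fun j => measurable_weight _ _)
    rw [lintegral_pi_fin_succ, lintegral_prod] at h
    · refine le_trans h (mul_le_mul_right ?_ _)
      exact Finset.prod_le_prod' fun j _ => lintegral_weight_le (hδ j) (hδM j)
    · exact (measurable_jacobianWeight_comp A δ M measurable_fst (measurable_const (a := g))
        measurable_snd).aemeasurable
  calc _ ≤ ∫⁻ x in {x | ∀ j, norm2 (evalAt (A j) x) ≤ M j}, ENNReal.ofReal (100 ^ k) *
          ∫⁻ g, ∫⁻ Y, jacobianWeight A δ M x g Y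
        ∂(Measure.pi fun _ : Fin k => stdGauss (Fin n)) ∂(Measure.pi fun j => stdGauss (S j))
        ∂stdGauss (Fin n) := setLIntegral_mono' hset fun x hx =>
          norm2_wedgeDeriv_le_lintegral A δ M hδ hδM x hx
    _ ≤ ∫⁻ x, ENNReal.ofReal (100 ^ k) *
          ∫⁻ g, ∫⁻ Y, jacobianWeight A δ M x g Y
        ∂(Measure.pi fun _ : Fin k => stdGauss (Fin n)) ∂(Measure.pi fun j => stdGauss (S j))
        ∂stdGauss (Fin n) := setLIntegral_le_lintegral _ _
    _ = ENNReal.ofReal (100 ^ k) * ∫⁻ g, ∫⁻ x, ∫⁻ Y, jacobianWeight A δ M x g Y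
        ∂(Measure.pi fun _ : Fin k => stdGauss (Fin n)) ∂stdGauss (Fin n)
        ∂(Measure.pi fun j => stdGauss (S j)) := by
        rw [lintegral_const_mul' _ _ ENNReal.ofReal_ne_top, lintegral_lintegral_swap]
        refine Measurable.aemeasurable ?_
        exact Measurable.lintegral_prod_right' (f := fun q : ((Fin n → ℝ) × (∀ j, S j → ℝ)) ×
          (Fin k → Fin n → ℝ) => jacobianWeight A δ M q.1.1 q.1.2 q.2)
          (measurable_jacobianWeight_comp A δ M (measurable_fst.comp measurable_fst)
            (measurable_snd.comp measurable_fst) measurable_snd)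
    _ ≤ ENNReal.ofReal (100 ^ k) * ∫⁻ _g : ∀ j, S j → ℝ,
        ENNReal.ofReal (Real.sqrt (k + 1) ^ (k + 1) * (6 * 2 ^ k * ∏ b, (max (d b) 1 : ℕ))) *
        ∏ j, ENNReal.ofReal (8 * Real.log (2 * M j / δ j))
        ∂(Measure.pi fun j => stdGauss (S j)) := mul_le_mul_right (lintegral_mono hg) _
    _ = _ := by
        rw [lintegral_const, measure_univ, mul_one,
          ← ENNReal.ofReal_prod_of_nonneg fun j _ => mul_nonneg (by norm_num) (hlog j),
          ← ENNReal.ofReal_mul (by positivity), ← ENNReal.ofReal_mul (by positivity),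
          Finset.prod_mul_distrib]
        simp only [Finset.prod_const, Finset.card_univ, Fintype.card_fin]
        congr 1
        rw [show (1600:ℝ) = 100 * (2 * 8) by norm_num, mul_pow, mul_pow]
        ring

end WedgeMoment
end StrongAnticoncentration

namespace StrongAnticoncentration
open scoped ENNReal NNReal
open MvPolynomial

/-! ### A Gaussian Poincaré inequality for tensor-valued polynomials. -/

section Poincare

variable {n : ℕ}

theorem integrable_eval_stdGauss (p : MvPolynomial (Fin n) ℝ) :
    Integrable (fun x => eval x p) (stdGauss (Fin n)) := by
  simp only [eval_eq']
  refine integrable_finsetSum _ fun s _ => Integrable.const_mul ?_ _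
  exact Integrable.fintype_prod (f := fun i (t : ℝ) => t ^ s i)
    fun i => integrable_pow_gaussianReal 1 (s i)

theorem lintegral_eval_sq_ne_top (p : MvPolynomial (Fin n) ℝ) :
    ∫⁻ x, ENNReal.ofReal (eval x p ^ 2) ∂stdGauss (Fin n) ≠ ∞ := by
  have h := (integrable_eval_stdGauss (p ^ 2)).lintegral_lt_top
  simp only [map_pow] at h
  exact h.ne

/-- Expand the nonnegative integral of `(b f - I)²`, where `I` is the integral of `f`. -/
theorem sq_integral_le {f : ℝ → ℝ} (hf : Continuous f) {b : ℝ} (hb : 0 < b) :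
    (∫ t in (0:ℝ)..b, f t) ^ 2 ≤ b * ∫ t in (0:ℝ)..b, f t ^ 2 := by
  set I := ∫ t in (0:ℝ)..b, f t with hI
  have h0 : 0 ≤ ∫ t in (0:ℝ)..b, (b * f t - I) ^ 2 :=
    intervalIntegral.integral_nonneg hb.le fun t _ => sq_nonneg _
  have h1 : ∫ t in (0:ℝ)..b, (b * f t - I) ^ 2 =
      b ^ 2 * (∫ t in (0:ℝ)..b, f t ^ 2) - 2 * b * I * I + b * I ^ 2 := by
    have e : ∀ t, (b * f t - I) ^ 2 = b ^ 2 * f t ^ 2 - 2 * b * I * f t + I ^ 2 := fun t => by ring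
    simp_rw [e]
    rw [intervalIntegral.integral_add, intervalIntegral.integral_sub,
      intervalIntegral.integral_const_mul, intervalIntegral.integral_const_mul,
      intervalIntegral.integral_const, ← hI]
    · simp
    all_goals exact Continuous.intervalIntegrable (by fun_prop) _ _
  rw [h1] at h0
  have h2 : 0 ≤ b * (b * (∫ t in (0:ℝ)..b, f t ^ 2) - I ^ 2) := by nlinarith
  have := nonneg_of_mul_nonneg_right h2 hb
  linarith

/-- The rotation matrix by the angle `θ`. -/
noncomputable def rotationMatrix (θ : ℝ) : Matrix (Fin 2) (Fin 2) ℝ :=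
  !![Real.cos θ, Real.sin θ; -Real.sin θ, Real.cos θ]

theorem rotationMatrix_orthogonal (θ : ℝ) :
    (rotationMatrix θ).transpose * rotationMatrix θ = 1 := by
  ext i j
  fin_cases i <;> fin_cases j <;>
    simp [rotationMatrix, Matrix.mul_apply, Fin.sum_univ_two] <;>
    nlinarith [Real.sin_sq_add_cos_sq θ]

theorem lintegral_rotate {F : (Fin n → ℝ) → (Fin n → ℝ) → ℝ≥0∞}
    (hF : Measurable (Function.uncurry F)) (θ : ℝ) :
    ∫⁻ x, ∫⁻ y, F (Real.cos θ • x + Real.sin θ • y) (-Real.sin θ • x + Real.cos θ • y)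
      ∂stdGauss (Fin n) ∂stdGauss (Fin n) =
    ∫⁻ x, ∫⁻ y, F x y ∂stdGauss (Fin n) ∂stdGauss (Fin n) := by
  have hpair : ∀ H : (Fin n → ℝ) → (Fin n → ℝ) → ℝ≥0∞, Measurable (Function.uncurry H) →
      ∫⁻ G : Fin 2 → Fin n → ℝ, H (G 0) (G 1) ∂(Measure.pi fun _ => stdGauss (Fin n)) =
        ∫⁻ x, ∫⁻ y, H x y ∂stdGauss (Fin n) ∂stdGauss (Fin n) := by
    intro H hH
    have h := (measurePreserving_finTwoArrow (stdGauss (Fin n))).lintegral_comp hH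
    rw [lintegral_prod _ hH.aemeasurable] at h
    exact h
  have hm : Measurable (Function.uncurry fun x y : Fin n → ℝ =>
      F (Real.cos θ • x + Real.sin θ • y) (-Real.sin θ • x + Real.cos θ • y)) :=
    hF.comp (f := fun q : (Fin n → ℝ) × (Fin n → ℝ) => (Real.cos θ • q.1 + Real.sin θ • q.2,
      -Real.sin θ • q.1 + Real.cos θ • q.2)) (by fun_prop)
  rw [← hpair _ hm, ← hpair _ hF]
  have hrot := (measurePreserving_rotate (I := Fin n) (rotationMatrix θ)
    (rotationMatrix_orthogonal θ)).lintegral_comp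
    (f := fun G : Fin 2 → Fin n → ℝ => F (G 0) (G 1))
    (hF.comp (f := fun G : Fin 2 → Fin n → ℝ => (G 0, G 1)) ((measurable_pi_apply 0).prodMk (measurable_pi_apply 1)))
  rw [← hrot]
  refine lintegral_congr fun G => ?_
  congr 1 <;> (funext i; simp [rotationMatrix, Fin.sum_univ_two])

/-- Join `x` to `y` by the arc `cos θ • x + sin θ • y` instead of a segment. For independent
Gaussian `x, y`, position and velocity on this arc are again independent standard Gaussians. -/
theorem sq_sub_le_lintegral_dirDeriv (p : MvPolynomial (Fin n) ℝ) (x y : Fin n → ℝ) :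
    ENNReal.ofReal ((eval y p - eval x p) ^ 2) ≤ ENNReal.ofReal (Real.pi / 2) *
      ∫⁻ θ in Set.Ioc 0 (Real.pi / 2), ENNReal.ofReal
        (dirDeriv p (-Real.sin θ • x + Real.cos θ • y) (Real.cos θ • x + Real.sin θ • y) ^ 2) := by
  set f : ℝ → ℝ := fun θ =>
    dirDeriv p (-Real.sin θ • x + Real.cos θ • y) (Real.cos θ • x + Real.sin θ • y) with hf
  have hcont : Continuous f := by
    simp only [hf, dirDeriv]
    refine continuous_finsetSum _ fun i _ => (continuous_eval_comp _ ?_).mul ?_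
    · exact ((Real.continuous_cos.smul continuous_const).add
        (Real.continuous_sin.smul continuous_const))
    · simp only [Pi.add_apply, Pi.smul_apply, smul_eq_mul]; fun_prop
  have hder : ∀ θ, HasDerivAt (fun θ => eval (Real.cos θ • x + Real.sin θ • y) p) (f θ) θ := by
    intro θ
    have h1 : HasDerivAt (fun θ => Real.cos θ • x + Real.sin θ • y)
        (-Real.sin θ • x + Real.cos θ • y) θ :=
      ((Real.hasDerivAt_cos θ).smul_const x).add ((Real.hasDerivAt_sin θ).smul_const y)
    have h2 := (hasFDerivAt_eval p _).comp_hasDerivAt θ h1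
    refine h2.congr_deriv ?_
    simp [hf, dirDeriv]
  have hpi : 0 < Real.pi / 2 := by positivity
  have hftc := intervalIntegral.integral_eq_sub_of_hasDerivAt (a := 0) (b := Real.pi / 2)
    (fun θ _ => hder θ) (hcont.intervalIntegrable _ _)
  simp only [Real.cos_pi_div_two, Real.sin_pi_div_two, Real.cos_zero, Real.sin_zero, zero_smul,
    one_smul, zero_add, add_zero] at hftc
  rw [← hftc]
  refine (ENNReal.ofReal_le_ofReal (sq_integral_le hcont hpi)).trans (le_of_eq ?_)
  rw [ENNReal.ofReal_mul hpi.le, intervalIntegral.integral_of_le hpi.le,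
    ofReal_integral_eq_lintegral_ofReal]
  · exact ((hcont.pow 2).integrableOn_Icc).mono_set Set.Ioc_subset_Icc_self
  · exact Filter.Eventually.of_forall fun θ => sq_nonneg _

/-- A Gaussian Poincaré inequality for polynomials. -/
theorem poincare (p : MvPolynomial (Fin n) ℝ) :
    ∫⁻ x, ∫⁻ y, ENNReal.ofReal ((eval y p - eval x p) ^ 2) ∂stdGauss (Fin n) ∂stdGauss (Fin n) ≤
      ENNReal.ofReal (Real.pi ^ 2 / 4) *
        ∫⁻ x, ENNReal.ofReal (∑ i, eval x (pderiv i p) ^ 2) ∂stdGauss (Fin n) := by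
  set γ := stdGauss (Fin n)
  let F : (Fin n → ℝ) → (Fin n → ℝ) → ℝ≥0∞ := fun x y => ENNReal.ofReal (dirDeriv p y x ^ 2)
  have hF : Measurable (Function.uncurry F) := ENNReal.measurable_ofReal.comp
    ((measurable_dirDeriv_comp p measurable_snd measurable_fst).pow_const 2)
  have hsecond : ∀ x, ∫⁻ y, F x y ∂γ = ENNReal.ofReal (∑ i, eval x (pderiv i p) ^ 2) := by
    intro x
    rw [← integral_linearForm_sq, ofReal_integral_eq_lintegral_ofReal
      (integrable_linearForm_pow _ 2) (Filter.Eventually.of_forall fun _ => sq_nonneg _)]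
    rfl
  have hjoint : Measurable fun q : ((Fin n → ℝ) × (Fin n → ℝ)) × ℝ =>
      F (Real.cos q.2 • q.1.1 + Real.sin q.2 • q.1.2)
        (-Real.sin q.2 • q.1.1 + Real.cos q.2 • q.1.2) :=
    hF.comp (f := fun q : ((Fin n → ℝ) × (Fin n → ℝ)) × ℝ =>
      (Real.cos q.2 • q.1.1 + Real.sin q.2 • q.1.2,
        -Real.sin q.2 • q.1.1 + Real.cos q.2 • q.1.2)) (by fun_prop)
  calc ∫⁻ x, ∫⁻ y, ENNReal.ofReal ((eval y p - eval x p) ^ 2) ∂γ ∂γ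
      ≤ ∫⁻ x, ∫⁻ y, ENNReal.ofReal (Real.pi / 2) * (∫⁻ θ in Set.Ioc 0 (Real.pi / 2),
          F (Real.cos θ • x + Real.sin θ • y) (-Real.sin θ • x + Real.cos θ • y)) ∂γ ∂γ :=
        lintegral_mono fun x => lintegral_mono fun y => sq_sub_le_lintegral_dirDeriv p x y
    _ = ENNReal.ofReal (Real.pi / 2) * ∫⁻ x, ∫⁻ y, (∫⁻ θ in Set.Ioc 0 (Real.pi / 2),
          F (Real.cos θ • x + Real.sin θ • y) (-Real.sin θ • x + Real.cos θ • y)) ∂γ ∂γ := by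
        simp_rw [lintegral_const_mul' _ _ ENNReal.ofReal_ne_top]
    _ = ENNReal.ofReal (Real.pi / 2) * ∫⁻ θ in Set.Ioc 0 (Real.pi / 2), ∫⁻ x, ∫⁻ y,
          F (Real.cos θ • x + Real.sin θ • y) (-Real.sin θ • x + Real.cos θ • y) ∂γ ∂γ := by
        congr 1
        rw [← lintegral_prod (μ := γ) (ν := γ) (fun q : (Fin n → ℝ) × (Fin n → ℝ) =>
          ∫⁻ θ in Set.Ioc 0 (Real.pi / 2), F (Real.cos θ • q.1 + Real.sin θ • q.2)
            (-Real.sin θ • q.1 + Real.cos θ • q.2)) hjoint.lintegral_prod_right'.aemeasurable,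
          lintegral_lintegral_swap hjoint.aemeasurable]
        refine lintegral_congr fun θ => ?_
        rw [lintegral_prod]
        exact (hjoint.comp (measurable_id.prodMk measurable_const)).aemeasurable
    _ = ENNReal.ofReal (Real.pi / 2) * ∫⁻ _θ in Set.Ioc 0 (Real.pi / 2),
          ∫⁻ x, ENNReal.ofReal (∑ i, eval x (pderiv i p) ^ 2) ∂γ := by
        congr 1
        refine lintegral_congr fun θ => ?_
        rw [lintegral_rotate hF θ]
        exact lintegral_congr hsecond
    _ = _ := by
        rw [setLIntegral_const, Real.volume_Ioc, mul_comm (lintegral _ _), ← mul_assoc,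
          ← ENNReal.ofReal_mul (by positivity)]
        congr 2; ring

/-- The second moment of a tensor-valued polynomial under the Gaussian measure. -/
noncomputable def energy {S : Type} [Fintype S] (A : TensorPoly n S) : ℝ≥0∞ :=
  ∫⁻ x, ENNReal.ofReal (norm2 (evalAt A x) ^ 2) ∂stdGauss (Fin n)

variable {S : Type} [Fintype S] (A : TensorPoly n S)

theorem measurable_norm2_evalAt : Measurable fun x => norm2 (evalAt A x) := by
  unfold norm2
  exact Measurable.sqrt (Finset.measurable_sum _ fun s _ =>
    (measurable_evalAt_comp _ measurable_id s).pow_const 2)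

theorem energy_ne_top : energy A ≠ ∞ := by
  unfold energy
  simp_rw [norm2_sq, ENNReal.ofReal_sum_of_nonneg fun s _ => sq_nonneg (evalAt A _ s)]
  have hm : ∀ s, Measurable fun x => ENNReal.ofReal (evalAt A x s ^ 2) := fun s =>
    ENNReal.measurable_ofReal.comp ((measurable_evalAt_comp A measurable_id s).pow_const 2)
  rw [lintegral_finsetSum _ fun s _ => hm s]
  exact ENNReal.sum_ne_top.2 fun s _ => lintegral_eval_sq_ne_top (A s)

/-- The Gaussian measure charges every nonempty open set, so a continuous function vanishing almost
everywhere vanishes identically. -/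
theorem eq_zero_of_energy_eq_zero (h : energy A = 0) (s : S) : A s = 0 := by
  have : (gaussianReal 0 1).IsOpenPosMeasure :=
    (gaussianReal_absolutelyContinuous' 0 one_ne_zero).isOpenPosMeasure
  have h1 : (fun x => norm2 (evalAt A x) ^ 2) =ᵐ[stdGauss (Fin n)] 0 := by
    have hm : Measurable fun x => ENNReal.ofReal (norm2 (evalAt A x) ^ 2) :=
      ENNReal.measurable_ofReal.comp ((measurable_norm2_evalAt A).pow_const 2)
    rw [energy, lintegral_eq_zero_iff hm] at h
    filter_upwards [h] with x hx
    exact le_antisymm (ENNReal.ofReal_eq_zero.1 hx) (sq_nonneg _)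
  have hc : Continuous fun x => norm2 (evalAt A x) ^ 2 := by
    simp only [norm2_sq, evalAt]
    exact continuous_finsetSum _ fun s _ => (continuous_eval (A s)).pow 2
  have h2 := (hc.ae_eq_iff_eq _ continuous_zero).1 h1
  apply MvPolynomial.funext
  intro x
  have h3 := congrFun h2 x
  simp only [norm2_sq, Pi.zero_apply] at h3
  rw [Finset.sum_eq_zero_iff_of_nonneg (fun s _ => sq_nonneg _)] at h3
  rw [map_zero]
  exact pow_eq_zero_iff two_ne_zero |>.1 (h3 s (Finset.mem_univ s))

theorem poincare_tensor :
    ∫⁻ x, ∫⁻ y, ENNReal.ofReal (∑ s, (evalAt A y s - evalAt A x s) ^ 2)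
      ∂stdGauss (Fin n) ∂stdGauss (Fin n) ≤ ENNReal.ofReal (5 / 2) * energy (derivative A) := by
  have hm : ∀ s, Measurable fun q : (Fin n → ℝ) × (Fin n → ℝ) =>
      ENNReal.ofReal ((evalAt A q.2 s - evalAt A q.1 s) ^ 2) := fun s =>
    ENNReal.measurable_ofReal.comp (((measurable_evalAt_comp A measurable_snd s).sub
      (measurable_evalAt_comp A measurable_fst s)).pow_const 2)
  calc _ = ∑ s, ∫⁻ x, ∫⁻ y, ENNReal.ofReal ((evalAt A y s - evalAt A x s) ^ 2)
      ∂stdGauss (Fin n) ∂stdGauss (Fin n) := by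
        rw [← lintegral_finsetSum _ fun s _ => (hm s).lintegral_prod_right']
        refine lintegral_congr fun x => ?_
        have hx : ∀ s, Measurable fun y => ENNReal.ofReal ((evalAt A y s - evalAt A x s) ^ 2) :=
          fun s => ENNReal.measurable_ofReal.comp
            (((measurable_evalAt_comp A measurable_id s).sub measurable_const).pow_const 2)
        dsimp only
        rw [← lintegral_finsetSum _ fun s _ => hx s]
        exact lintegral_congr fun y => ENNReal.ofReal_sum_of_nonneg fun s _ => sq_nonneg _
    _ ≤ ∑ s, ENNReal.ofReal (5 / 2) * ∫⁻ x, ENNReal.ofReal (∑ i, eval x (pderiv i (A s)) ^ 2)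
          ∂stdGauss (Fin n) := by
        refine Finset.sum_le_sum fun s _ => (poincare (A s)).trans (mul_le_mul_left ?_ _)
        refine ENNReal.ofReal_le_ofReal ?_
        nlinarith [Real.pi_lt_d2, Real.pi_pos]
    _ = ENNReal.ofReal (5 / 2) * energy (derivative A) := by
        rw [← Finset.mul_sum, ← lintegral_finsetSum]
        · congr 1
          refine lintegral_congr fun x => ?_
          rw [norm2_sq, Fintype.sum_prod_type_right, ENNReal.ofReal_sum_of_nonneg]
          · rfl
          · exact fun s _ => Finset.sum_nonneg fun i _ => sq_nonneg _
        · exact fun s _ => ENNReal.measurable_ofReal.comp (Finset.measurable_sum _ fun i _ =>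
            (continuous_eval _).measurable.pow_const 2)

end Poincare
end StrongAnticoncentration

namespace StrongAnticoncentration
open scoped ENNReal NNReal
open MvPolynomial

/-! ### Small ball and tail estimates for one tensor. -/

section SmallBall

variable {n : ℕ} {S : Type} [Fintype S]

theorem norm2_wedgeDeriv_one (A : TensorPoly n S) (x : Fin n → ℝ) :
    norm2 (wedgeDeriv (fun _ : Fin 1 => A) x) = norm2 (evalAt (derivative A) x) := by
  unfold norm2
  congr 1
  rw [Fintype.sum_prod_type, Fintype.sum_prod_type,
    ← (Equiv.funUnique (Fin 1) (Fin n)).symm.sum_comp]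
  refine Finset.sum_congr rfl fun i _ => ?_
  rw [← (Equiv.funUnique (Fin 1) S).symm.sum_comp]
  refine Finset.sum_congr rfl fun s _ => ?_
  simp [wedgeDeriv, wedge, tensorProd]

/-- A tensor-valued polynomial is rarely small where its derivative is large. -/
theorem measure_small_and_derivative_large_le (A : TensorPoly n S) (d : ℕ)
    (hdeg : ∀ s, (A s).totalDegree ≤ d) {δ η : ℝ} (hδ : 0 < δ) (hη : 0 < η) :
    stdGauss (Fin n) {x | norm2 (evalAt A x) ≤ δ ∧ η ≤ norm2 (evalAt (derivative A) x)} ≤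
      ENNReal.ofReal (19200 * (max d 1 : ℕ) * (δ / η)) := by
  -- With `M = δ` the logarithm is just `log 2`, so this estimate loses no logarithmic factor.
  have h := lintegral_norm2_wedgeDeriv_le (k := 1) (fun _ => A) (fun _ => d) (fun _ => hdeg)
    (fun _ => δ) (fun _ => δ) (fun _ => hδ) (fun _ => le_rfl)
  set B : Set (Fin n → ℝ) := {x | ∀ _ : Fin 1, norm2 (evalAt A x) ≤ δ} with hB
  set D : Set (Fin n → ℝ) :=
    {x | norm2 (evalAt A x) ≤ δ ∧ η ≤ norm2 (evalAt (derivative A) x)} with hD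
  have hDB : D ⊆ B := fun x hx _ => hx.1
  have hDm : MeasurableSet D := (measurableSet_le (measurable_norm2_evalAt A) measurable_const).inter
    (measurableSet_le measurable_const (measurable_norm2_evalAt (derivative A)))
  have h1 : ENNReal.ofReal (η / δ) * stdGauss (Fin n) D ≤
      ENNReal.ofReal (19200 * (max d 1 : ℕ)) := by
    calc ENNReal.ofReal (η / δ) * stdGauss (Fin n) D
        = ∫⁻ _x in D, ENNReal.ofReal (η / δ) ∂stdGauss (Fin n) := (setLIntegral_const _ _).symm
      _ ≤ ∫⁻ x in D, ENNReal.ofReal (norm2 (wedgeDeriv (fun _ : Fin 1 => A) x) /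
            ∏ _j : Fin 1, max δ (norm2 (evalAt A x))) ∂stdGauss (Fin n) := by
          refine setLIntegral_mono' hDm fun x hx => ENNReal.ofReal_le_ofReal ?_
          rw [norm2_wedgeDeriv_one]
          simp only [Finset.univ_unique, Finset.prod_singleton]
          rw [max_eq_left hx.1]
          exact div_le_div_of_nonneg_right hx.2 hδ.le
      _ ≤ _ := (lintegral_mono_set hDB).trans h
      _ ≤ _ := by
          refine ENNReal.ofReal_le_ofReal ?_
          simp only [Finset.univ_unique, Finset.prod_singleton]
          have e1 : Real.sqrt (((1:ℕ):ℝ) + 1) ^ (1 + 1) = 2 := by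
            rw [Real.sq_sqrt (by positivity)]; norm_num
          have e2 : Real.log (2 * δ / δ) ≤ 1 := by
            rw [mul_div_cancel_right₀ _ hδ.ne']
            linarith [Real.log_two_lt_d9]
          rw [e1]
          calc _ ≤ 6 * 1600 ^ 1 * 2 * ((max d 1 : ℕ) : ℝ) * 1 := by gcongr
            _ = _ := by ring
  calc stdGauss (Fin n) D = ENNReal.ofReal (δ / η) * (ENNReal.ofReal (η / δ) *
        stdGauss (Fin n) D) := by
        rw [← mul_assoc, ← ENNReal.ofReal_mul (by positivity),
          show δ / η * (η / δ) = 1 by field_simp, ENNReal.ofReal_one, one_mul]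
    _ ≤ ENNReal.ofReal (δ / η) * ENNReal.ofReal (19200 * (max d 1 : ℕ)) := mul_le_mul_right h1 _
    _ = _ := by rw [← ENNReal.ofReal_mul (by positivity), mul_comm]

/-- A tensor-valued polynomial whose derivative has small second moment is rarely small. -/
theorem measure_small_le_of_energy_derivative_le (A : TensorPoly n S) {m ε : ℝ} (hm : 0 < m)
    (hA : energy A = ENNReal.ofReal m) (hε : 0 < ε)
    (hDA : energy (derivative A) ≤ ENNReal.ofReal (ε * m)) :
    stdGauss (Fin n) {x | norm2 (evalAt A x) ≤ Real.sqrt m / 4} ≤ ENNReal.ofReal (10 * ε) := by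
  set D : Set (Fin n → ℝ) := {x | norm2 (evalAt A x) ≤ Real.sqrt m / 4} with hD
  have hDm : MeasurableSet D := measurableSet_le (measurable_norm2_evalAt A) measurable_const
  have hpt : ∀ x ∈ D, ENNReal.ofReal (m / 4) ≤
      ∫⁻ y, ENNReal.ofReal (∑ s, (evalAt A y s - evalAt A x s) ^ 2) ∂stdGauss (Fin n) := by
    intro x hx
    have hx2 : norm2 (evalAt A x) ^ 2 ≤ m / 16 := by
      calc norm2 (evalAt A x) ^ 2 ≤ (Real.sqrt m / 4) ^ 2 :=
            pow_le_pow_left₀ (norm2_nonneg _) hx 2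
        _ = m / 16 := by rw [div_pow, Real.sq_sqrt hm.le]; norm_num
    -- If `A x` is small, then `A y - A x` is typically as large as `A y`. Averaging over `y` gives
    -- at least `m/2 - m/16 ≥ m/4`, while the Poincaré inequality bounds the average over both
    -- variables by `(5/2) ε m`.
    have hle : ∀ y, ENNReal.ofReal (1 / 2) * ENNReal.ofReal (norm2 (evalAt A y) ^ 2) ≤
        ENNReal.ofReal (∑ s, (evalAt A y s - evalAt A x s) ^ 2) + ENNReal.ofReal (m / 16) := by
      intro y
      rw [← ENNReal.ofReal_mul (by norm_num), ← ENNReal.ofReal_add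
        (Finset.sum_nonneg fun s _ => sq_nonneg _) (by positivity)]
      refine ENNReal.ofReal_le_ofReal (le_trans ?_ (add_le_add_right hx2 _))
      rw [norm2_sq, norm2_sq, Finset.mul_sum, ← Finset.sum_add_distrib]
      exact Finset.sum_le_sum fun s _ => by nlinarith [sq_nonneg (evalAt A y s - 2 * evalAt A x s)]
    have h1 := lintegral_mono (μ := stdGauss (Fin n)) hle
    rw [lintegral_const_mul' _ _ ENNReal.ofReal_ne_top, lintegral_add_right _ measurable_const,
      lintegral_const, measure_univ, mul_one] at h1
    change ENNReal.ofReal (1 / 2) * energy A ≤ _ at h1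
    rw [hA, ← ENNReal.ofReal_mul (by norm_num)] at h1
    have h2 : ENNReal.ofReal (m / 4) + ENNReal.ofReal (m / 16) ≤ ENNReal.ofReal (1 / 2 * m) := by
      rw [← ENNReal.ofReal_add (by positivity) (by positivity)]
      exact ENNReal.ofReal_le_ofReal (by linarith)
    exact (ENNReal.add_le_add_iff_right ENNReal.ofReal_ne_top).1 (h2.trans h1)
  have h1 : ENNReal.ofReal (m / 4) * stdGauss (Fin n) D ≤ ENNReal.ofReal (5 / 2 * (ε * m)) := by
    calc ENNReal.ofReal (m / 4) * stdGauss (Fin n) D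
        = ∫⁻ _x in D, ENNReal.ofReal (m / 4) ∂stdGauss (Fin n) := (setLIntegral_const _ _).symm
      _ ≤ _ := setLIntegral_mono' hDm hpt
      _ ≤ _ := setLIntegral_le_lintegral _ _
      _ ≤ _ := poincare_tensor A
      _ ≤ ENNReal.ofReal (5 / 2) * ENNReal.ofReal (ε * m) := mul_le_mul_right hDA _
      _ = _ := by rw [← ENNReal.ofReal_mul (by norm_num)]
  calc stdGauss (Fin n) D = ENNReal.ofReal (4 / m) * (ENNReal.ofReal (m / 4) *
        stdGauss (Fin n) D) := by
        rw [← mul_assoc, ← ENNReal.ofReal_mul (by positivity),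
          show 4 / m * (m / 4) = 1 by field_simp, ENNReal.ofReal_one, one_mul]
    _ ≤ ENNReal.ofReal (4 / m) * ENNReal.ofReal (5 / 2 * (ε * m)) := mul_le_mul_right h1 _
    _ = _ := by
        rw [← ENNReal.ofReal_mul (by positivity)]
        congr 1; field_simp; norm_num

/-- Weak anticoncentration of tensor-valued polynomials of bounded degree. -/
theorem measure_small_ball_le (d : ℕ) : ∀ {S : Type} [Fintype S] (A : TensorPoly n S),
    (∀ s, (A s).totalDegree ≤ d) → ∀ m : ℝ, 0 < m → energy A = ENNReal.ofReal m →
      ∀ ε : ℝ, 0 < ε → ε < 1 →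
      stdGauss (Fin n) {x | norm2 (evalAt A x) ≤ ε ^ (2 * d) * Real.sqrt m / 4} ≤
        ENNReal.ofReal (19200 * (d + 1) ^ 2 * ε) := by
  induction d with
  | zero =>
    intro S _ A hdeg m hm hA ε hε hε1
    have h0 : ∀ x, norm2 (evalAt (derivative A) x) = 0 := by
      intro x
      have : ∀ q, evalAt (derivative A) x q = 0 := by
        rintro ⟨i, s⟩
        have h1 := totalDegree_eq_zero_iff_eq_C.1 (Nat.le_zero.1 (hdeg s))
        simp only [evalAt, derivative]
        rw [h1, pderiv_C, map_zero]
      simp [norm2, this]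
    have h1 : energy (derivative A) ≤ ENNReal.ofReal (ε * m) := by
      simp [energy, h0]
    simp only [mul_zero, pow_zero, one_mul]
    refine (measure_small_le_of_energy_derivative_le A hm hA hε h1).trans ?_
    exact ENNReal.ofReal_le_ofReal (by push_cast; nlinarith)
  | succ d ih =>
    intro S _ A hdeg m hm hA ε hε hε1
    have hεpow : ε ^ (2 * (d + 1)) ≤ 1 := pow_le_one₀ hε.le hε1.le
    -- If the derivative has little energy, the Poincaré inequality suffices. Otherwise its energy
    -- `m'` exceeds `ε m`, and the two extra powers of `ε` in the threshold make the ratio of the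
    -- thresholds for `A` and its derivative at most `ε`. The induction hypothesis is applied to a
    -- tensor with a larger index set, which is why `S` is quantified inside.
    by_cases hcase : energy (derivative A) ≤ ENNReal.ofReal (ε * m)
    · refine (measure_mono fun x hx => ?_).trans
        ((measure_small_le_of_energy_derivative_le A hm hA hε hcase).trans
          (ENNReal.ofReal_le_ofReal ?_))
      · refine le_trans (show norm2 (evalAt A x) ≤ _ from hx) ?_
        have : ε ^ (2 * (d + 1)) * Real.sqrt m ≤ 1 * Real.sqrt m := by gcongr
        linarith
      · have : (1:ℝ) ≤ ((d + 1 : ℕ) + 1) ^ 2 := one_le_pow₀ (by push_cast; linarith [d.cast_nonneg (α := ℝ)])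
        nlinarith
    · push Not at hcase
      set m' := (energy (derivative A)).toReal with hm'
      have hA' : energy (derivative A) = ENNReal.ofReal m' :=
        (ENNReal.ofReal_toReal (energy_ne_top _)).symm
      have hm'gt : ε * m < m' := by
        rw [hA'] at hcase
        exact (ENNReal.ofReal_lt_ofReal_iff_of_nonneg (by positivity)).1 hcase
      have hm'0 : 0 < m' := lt_trans (by positivity) hm'gt
      have hdeg' : ∀ q, (derivative A q).totalDegree ≤ d := fun q =>
        (totalDegree_pderiv_le _ _).trans (by have := hdeg q.2; omega)
      have hih := ih (derivative A) hdeg' m' hm'0 hA' ε hε hε1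
      have hsm' : 0 < Real.sqrt m' := Real.sqrt_pos.2 hm'0
      have hδ : 0 < ε ^ (2 * (d + 1)) * Real.sqrt m / 4 := by positivity
      have hη : 0 < ε ^ (2 * d) * Real.sqrt m' / 4 := by positivity
      have hstep := measure_small_and_derivative_large_le A (d + 1) hdeg hδ hη
      have hratio : ε ^ (2 * (d + 1)) * Real.sqrt m / 4 / (ε ^ (2 * d) * Real.sqrt m' / 4) ≤ ε := by
        have e : ε ^ (2 * (d + 1)) * Real.sqrt m / 4 / (ε ^ (2 * d) * Real.sqrt m' / 4) =
            ε ^ 2 * Real.sqrt m / Real.sqrt m' := by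
          rw [show 2 * (d + 1) = 2 * d + 2 by ring, pow_add]; field_simp
        rw [e, div_le_iff₀ hsm']
        have : ε * Real.sqrt m ≤ Real.sqrt m' := by
          apply Real.le_sqrt_of_sq_le
          rw [mul_pow, Real.sq_sqrt hm.le]
          nlinarith [mul_pos hε hm]
        nlinarith
      have hsub : {x | norm2 (evalAt A x) ≤ ε ^ (2 * (d + 1)) * Real.sqrt m / 4} ⊆
          {x | norm2 (evalAt A x) ≤ ε ^ (2 * (d + 1)) * Real.sqrt m / 4 ∧
            ε ^ (2 * d) * Real.sqrt m' / 4 ≤ norm2 (evalAt (derivative A) x)} ∪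
          {x | norm2 (evalAt (derivative A) x) ≤ ε ^ (2 * d) * Real.sqrt m' / 4} := by
        intro x hx
        rcases le_total (ε ^ (2 * d) * Real.sqrt m' / 4) (norm2 (evalAt (derivative A) x)) with h | h
        · exact Or.inl ⟨hx, h⟩
        · exact Or.inr h
      refine (measure_mono hsub).trans ((measure_union_le _ _).trans
        ((add_le_add hstep hih).trans ?_))
      rw [← ENNReal.ofReal_add (by positivity) (by positivity)]
      refine ENNReal.ofReal_le_ofReal ?_
      have hmax : max (d + 1) 1 = d + 1 := max_eq_left (by omega)
      rw [hmax]
      calc _ ≤ 19200 * ((d + 1 : ℕ) : ℝ) * ε + 19200 * ((d:ℝ) + 1) ^ 2 * ε := by gcongr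
        _ ≤ _ := by
          push_cast
          nlinarith [mul_nonneg hε.le (d.cast_nonneg (α := ℝ))]

/-- Upper tail of a tensor-valued polynomial. -/
theorem measure_large_le (A : TensorPoly n S) {m ε : ℝ} (hm : 0 < m)
    (hA : energy A = ENNReal.ofReal m) (hε : 0 < ε) :
    stdGauss (Fin n) {x | Real.sqrt (m / ε) ≤ norm2 (evalAt A x)} ≤ ENNReal.ofReal ε := by
  have hm1 : Measurable fun x => ENNReal.ofReal (norm2 (evalAt A x) ^ 2) :=
    ENNReal.measurable_ofReal.comp ((measurable_norm2_evalAt A).pow_const 2)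
  have h := mul_meas_ge_le_lintegral (μ := stdGauss (Fin n)) hm1 (ENNReal.ofReal (m / ε))
  change _ ≤ energy A at h
  have hsub : {x | Real.sqrt (m / ε) ≤ norm2 (evalAt A x)} ⊆
      {x | ENNReal.ofReal (m / ε) ≤ ENNReal.ofReal (norm2 (evalAt A x) ^ 2)} := by
    intro x hx
    refine ENNReal.ofReal_le_ofReal ?_
    rw [← Real.sq_sqrt (show 0 ≤ m / ε by positivity)]
    exact pow_le_pow_left₀ (Real.sqrt_nonneg _) hx 2
  calc stdGauss (Fin n) {x | Real.sqrt (m / ε) ≤ norm2 (evalAt A x)}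
      = ENNReal.ofReal (ε / m) * (ENNReal.ofReal (m / ε) *
        stdGauss (Fin n) {x | Real.sqrt (m / ε) ≤ norm2 (evalAt A x)}) := by
        rw [← mul_assoc, ← ENNReal.ofReal_mul (by positivity),
          show ε / m * (m / ε) = 1 by field_simp, ENNReal.ofReal_one, one_mul]
    _ ≤ ENNReal.ofReal (ε / m) * ENNReal.ofReal m :=
        mul_le_mul_right ((mul_le_mul_right (measure_mono hsub) _).trans (h.trans hA.le)) _
    _ = _ := by
        rw [← ENNReal.ofReal_mul (by positivity)]
        congr 1; field_simp

end SmallBall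
end StrongAnticoncentration

namespace StrongAnticoncentration
open scoped ENNReal NNReal
open MvPolynomial

/-! ### Truncation, choice of thresholds and constants. -/

section Assembly

variable {k n : ℕ} {S : Fin k → Type} [∀ j, Fintype (S j)] (A : (j : Fin k) → TensorPoly n (S j))

theorem measurable_norm2_wedgeDeriv : Measurable fun x => norm2 (wedgeDeriv A x) := by
  unfold norm2 wedgeDeriv wedge tensorProd
  exact Measurable.sqrt (Finset.measurable_sum _ fun q _ => (Finset.measurable_sum _ fun σ _ =>
    (Finset.measurable_prod _ fun j _ =>
      measurable_evalAt_comp _ measurable_id _).const_mul _).pow_const 2)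

/-- The event that the product of the norms is small compared to the wedge product. -/
def smallProductEvent (ε : ℝ) : Set (Fin n → ℝ) :=
  {x | ∏ j, norm2 (evalAt (A j) x) < ε * norm2 (wedgeDeriv A x)}

/-- If one factor vanishes identically, so do its derivatives and the wedge, and the strict
inequality fails. This disposes of zero energy, for which the thresholds would degenerate. -/
theorem smallProductEvent_eq_empty_of_zero {ε : ℝ} (j : Fin k) (hj : ∀ s, A j s = 0) :
    smallProductEvent A ε = ∅ := by
  ext x
  have : ∀ q, wedgeDeriv A x q = 0 := by
    intro q
    refine Finset.sum_eq_zero fun σ _ => ?_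
    rw [tensorProd, Finset.prod_eq_zero (Finset.mem_univ j), mul_zero]
    simp [evalAt, derivative, hj]
  simp only [smallProductEvent, Set.mem_ofPred_eq, Set.mem_empty_iff_false, iff_false, not_lt]
  rw [show norm2 (wedgeDeriv A x) = 0 by simp [norm2, this], mul_zero]
  exact Finset.prod_nonneg fun j _ => norm2_nonneg _

theorem measure_smallProductEvent_truncated_le (d : Fin k → ℕ)
    (hdeg : ∀ j s, (A j s).totalDegree ≤ d j) (δ M : Fin k → ℝ) (hδ : ∀ j, 0 < δ j)
    (hδM : ∀ j, δ j ≤ M j) {ε : ℝ} (hε : 0 < ε) :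
    stdGauss (Fin n) (smallProductEvent A ε ∩
        {x | ∀ j, δ j ≤ norm2 (evalAt (A j) x) ∧ norm2 (evalAt (A j) x) ≤ M j}) ≤
      ENNReal.ofReal (ε * (6 * 1600 ^ k * Real.sqrt (k + 1) ^ (k + 1) *
        (∏ j, (max (d j) 1 : ℕ)) * ∏ j, Real.log (2 * M j / δ j))) := by
  set D := smallProductEvent A ε ∩
    {x | ∀ j, δ j ≤ norm2 (evalAt (A j) x) ∧ norm2 (evalAt (A j) x) ≤ M j} with hD
  have hDm : MeasurableSet D := by
    refine (measurableSet_lt (Finset.measurable_prod _ fun j _ => measurable_norm2_evalAt (A j))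
      ((measurable_norm2_wedgeDeriv A).const_mul ε)).inter ?_
    rw [Set.ofPred_forall]
    exact MeasurableSet.iInter fun j =>
      (measurableSet_le measurable_const (measurable_norm2_evalAt (A j))).inter
        (measurableSet_le (measurable_norm2_evalAt (A j)) measurable_const)
  have h := lintegral_norm2_wedgeDeriv_le A d hdeg δ M hδ hδM
  have h1 : ENNReal.ofReal ε⁻¹ * stdGauss (Fin n) D ≤ _ :=
    calc ENNReal.ofReal ε⁻¹ * stdGauss (Fin n) D
        = ∫⁻ _x in D, ENNReal.ofReal ε⁻¹ ∂stdGauss (Fin n) := (setLIntegral_const _ _).symm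
      _ ≤ ∫⁻ x in D, ENNReal.ofReal (norm2 (wedgeDeriv A x) /
            ∏ j, max (δ j) (norm2 (evalAt (A j) x))) ∂stdGauss (Fin n) := by
          refine setLIntegral_mono' hDm fun x hx => ENNReal.ofReal_le_ofReal ?_
          have hmax : ∀ j, max (δ j) (norm2 (evalAt (A j) x)) = norm2 (evalAt (A j) x) :=
            fun j => max_eq_right (hx.2 j).1
          simp only [hmax]
          have hpos : 0 < ∏ j, norm2 (evalAt (A j) x) :=
            Finset.prod_pos fun j _ => (hδ j).trans_le (hx.2 j).1
          rw [le_div_iff₀ hpos, inv_mul_le_iff₀ hε]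
          exact (show _ < _ from hx.1).le
      _ ≤ _ := (lintegral_mono_set fun x hx j => (hx.2 j).2).trans h
  calc stdGauss (Fin n) D = ENNReal.ofReal ε * (ENNReal.ofReal ε⁻¹ * stdGauss (Fin n) D) := by
        rw [← mul_assoc, ← ENNReal.ofReal_mul hε.le, mul_inv_cancel₀ hε.ne', ENNReal.ofReal_one,
          one_mul]
    _ ≤ _ := mul_le_mul_right h1 _
    _ = _ := by rw [← ENNReal.ofReal_mul hε.le]

/-- The ratio is at most `8 ε^(-(2d+1))`, and `log 2 ≤ log ε⁻¹` absorbs the constant. The resulting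
factor, linear in `d`, is relaxed to an exponential one, which the factor `2^(C₁ ∑ d_j)` can
accommodate. -/
theorem log_truncation_ratio_le {m ε : ℝ} (hm : 0 < m) (hε : 0 < ε) (hε2 : ε < 1 / 2) (d : ℕ) :
    Real.log (2 * Real.sqrt (m / ε) / (ε ^ (2 * d) * Real.sqrt m / 4)) ≤
      4 * 2 ^ d * Real.log ε⁻¹ := by
  have hℓ : Real.log 2 ≤ Real.log ε⁻¹ :=
    Real.log_le_log (by norm_num) (by rw [le_inv_comm₀ (by norm_num) hε]; linarith)
  have hℓ0 : 0 < Real.log ε⁻¹ := (Real.log_pos (by norm_num)).trans_le hℓ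
  have h1 : 2 * Real.sqrt (m / ε) / (ε ^ (2 * d) * Real.sqrt m / 4) ≤
      2 ^ 3 * ε⁻¹ ^ (2 * d + 1) := by
    rw [Real.sqrt_div hm.le]
    have e : 2 * (Real.sqrt m / Real.sqrt ε) / (ε ^ (2 * d) * Real.sqrt m / 4) =
        2 ^ 3 * ε⁻¹ ^ (2 * d) * (Real.sqrt ε)⁻¹ := by
      rw [inv_pow]; field_simp; norm_num
    rw [e, pow_succ ε⁻¹, ← mul_assoc]
    have : (Real.sqrt ε)⁻¹ ≤ ε⁻¹ := by
      refine inv_anti₀ hε (Real.le_sqrt_of_sq_le ?_)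
      nlinarith
    gcongr
  have h2 : (d:ℝ) + 2 ≤ 2 * 2 ^ d := by
    have : d + 1 ≤ 2 ^ d := Nat.lt_two_pow_self
    have h3 : (1:ℝ) ≤ 2 ^ d := one_le_pow₀ (by norm_num)
    have h4 : ((d + 1 : ℕ) : ℝ) ≤ 2 ^ d := by exact_mod_cast this
    push_cast at h4; linarith
  calc _ ≤ Real.log (2 ^ 3 * ε⁻¹ ^ (2 * d + 1)) :=
        Real.log_le_log (by positivity) h1
    _ = 3 * Real.log 2 + (2 * d + 1) * Real.log ε⁻¹ := by
        rw [Real.log_mul (by positivity) (by positivity), Real.log_pow, Real.log_pow]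
        push_cast; ring
    _ ≤ 2 * ((d:ℝ) + 2) * Real.log ε⁻¹ := by linarith
    _ ≤ 2 * (2 * 2 ^ d) * Real.log ε⁻¹ := by gcongr
    _ = _ := by ring

/-- One factor `2 ^ ∑ d_j` comes from the Bézout product and one from the logarithms. Raising `6` to
`6400 = 1600 · 4` completes the power `k + 1`, and `√(k+1) ≤ 2 √k` needs `k ≥ 1`. -/
theorem truncated_bound_le (hk : 1 ≤ k) (d : Fin k → ℕ) {ℓ : ℝ} (L : Fin k → ℝ)
    (hL0 : ∀ j, 0 ≤ L j) (hL : ∀ j, L j ≤ 4 * 2 ^ d j * ℓ) :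
    6 * 1600 ^ k * Real.sqrt (k + 1) ^ (k + 1) * (∏ j, (max (d j) 1 : ℕ)) * ∏ j, L j ≤
      4 ^ (∑ j, d j) * (12800 * Real.sqrt k) ^ (k + 1) * ℓ ^ k := by
  have hk' : (1:ℝ) ≤ k := by exact_mod_cast hk
  have h1 : Real.sqrt (k + 1) ≤ 2 * Real.sqrt k := by
    rw [Real.sqrt_le_left (by positivity), mul_pow, Real.sq_sqrt (by positivity)]
    linarith
  have h2 : ((∏ j, (max (d j) 1 : ℕ) : ℕ) : ℝ) ≤ 2 ^ (∑ j, d j) := by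
    rw [← Finset.prod_pow_eq_pow_sum]
    have : ∏ j, (max (d j) 1 : ℕ) ≤ ∏ j, 2 ^ d j :=
      Finset.prod_le_prod' fun j _ => max_le Nat.lt_two_pow_self.le Nat.one_le_two_pow
    exact_mod_cast this
  have h3 : ∏ j, L j ≤ 4 ^ k * 2 ^ (∑ j, d j) * ℓ ^ k := by
    refine (Finset.prod_le_prod (fun j _ => hL0 j) fun j _ => hL j).trans (le_of_eq ?_)
    rw [Finset.prod_mul_distrib, Finset.prod_mul_distrib, Finset.prod_pow_eq_pow_sum]
    simp
  have h4 : (0:ℝ) ≤ ∏ j, L j := Finset.prod_nonneg fun j _ => hL0 j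
  calc _ ≤ 6400 * 1600 ^ k * (2 * Real.sqrt k) ^ (k + 1) * 2 ^ (∑ j, d j) *
        (4 ^ k * 2 ^ (∑ j, d j) * ℓ ^ k) := by
        push_cast at h2 ⊢
        gcongr
        norm_num
    _ = _ := by
        have e4 : (4:ℝ) ^ (∑ j, d j) = 2 ^ (∑ j, d j) * 2 ^ (∑ j, d j) := by
          rw [← mul_pow]; norm_num
        have e6 : (6400:ℝ) ^ k = 1600 ^ k * 4 ^ k := by rw [← mul_pow]; norm_num
        have e12 : (12800 * Real.sqrt k) ^ (k + 1) = 6400 * (1600 ^ k * 4 ^ k) *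
            (2 * Real.sqrt k) ^ (k + 1) := by
          rw [show (12800:ℝ) * Real.sqrt k = 6400 * (2 * Real.sqrt k) by ring, mul_pow 6400,
            pow_succ (6400:ℝ), e6]
          ring
        rw [e4, e12]
        ring

/-- The tails carry no logarithm. Since `ℓ ≥ 1/2`, the factor `ℓ ^ k` costs at most `2 ^ k`, which
half of the constant `12800` pays for. -/
theorem tail_bound_le (hk : 1 ≤ k) (d : Fin k → ℕ) {ℓ : ℝ} (hℓ : 1 / 2 ≤ ℓ) :
    ∑ j, (19200 * ((d j : ℝ) + 1) ^ 2 + 1) ≤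
      4 ^ (∑ j, d j) * (12800 * Real.sqrt k) ^ (k + 1) * ℓ ^ k := by
  have hk' : (1:ℝ) ≤ k := by exact_mod_cast hk
  have hs : 1 ≤ Real.sqrt k := Real.one_le_sqrt.2 hk'
  have hterm : ∀ j, 19200 * ((d j : ℝ) + 1) ^ 2 + 1 ≤ 19201 * 4 ^ (∑ j, d j) := by
    intro j
    have h1 : ((d j : ℝ) + 1) ≤ 2 ^ d j := by
      have : d j + 1 ≤ 2 ^ d j := Nat.lt_two_pow_self
      exact_mod_cast this
    have h2 : ((d j : ℝ) + 1) ^ 2 ≤ 4 ^ (∑ j, d j) := by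
      calc ((d j : ℝ) + 1) ^ 2 ≤ (2 ^ d j) ^ 2 := by gcongr
        _ = 4 ^ d j := by rw [← pow_mul, mul_comm, pow_mul]; norm_num
        _ ≤ 4 ^ (∑ j, d j) := pow_le_pow_right₀ (by norm_num)
            (Finset.single_le_sum (fun i _ => Nat.zero_le (d i)) (Finset.mem_univ j))
    have h3 : (1:ℝ) ≤ 4 ^ (∑ j, d j) := one_le_pow₀ (by norm_num)
    linarith
  have hpow : 19201 * (k:ℝ) ≤ (12800 * Real.sqrt k) ^ (k + 1) * ℓ ^ k := by
    calc 19201 * (k:ℝ) ≤ (6400 * Real.sqrt k) ^ 2 := by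
          rw [mul_pow, Real.sq_sqrt (by positivity)]; nlinarith
      _ ≤ (6400 * Real.sqrt k) ^ (k + 1) := pow_le_pow_right₀ (by linarith) (by omega)
      _ = (12800 * Real.sqrt k) ^ (k + 1) * (1 / 2) ^ (k + 1) := by
          rw [← mul_pow]; congr 1; ring
      _ ≤ (12800 * Real.sqrt k) ^ (k + 1) * (1 / 2) ^ k := by
          refine mul_le_mul_of_nonneg_left ?_ (by positivity)
          exact pow_le_pow_of_le_one (by norm_num) (by norm_num) (Nat.le_succ k)
      _ ≤ _ := by gcongr
  calc ∑ j, (19200 * ((d j : ℝ) + 1) ^ 2 + 1) ≤ ∑ _j : Fin k, 19201 * (4:ℝ) ^ (∑ j, d j) :=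
        Finset.sum_le_sum fun j _ => hterm j
    _ = 4 ^ (∑ j, d j) * (19201 * (k:ℝ)) := by simp; ring
    _ ≤ 4 ^ (∑ j, d j) * ((12800 * Real.sqrt k) ^ (k + 1) * ℓ ^ k) := by gcongr
    _ = _ := by ring

theorem measure_smallProductEvent_le (hk : 1 ≤ k) (d : Fin k → ℕ)
    (hdeg : ∀ j s, (A j s).totalDegree ≤ d j) {ε : ℝ} (hε : 0 < ε) (hε2 : ε < 1 / 2) :
    stdGauss (Fin n) (smallProductEvent A ε) ≤ ENNReal.ofReal
      (ε * 4 ^ (∑ j, d j) * (25600 * Real.sqrt k) ^ (k + 1) * Real.log ε⁻¹ ^ k) := by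
  by_cases h0 : ∃ j, energy (A j) = 0
  · obtain ⟨j, hj⟩ := h0
    rw [smallProductEvent_eq_empty_of_zero A j (eq_zero_of_energy_eq_zero (A j) hj)]
    simp
  push Not at h0
  have hε1 : ε < 1 := by linarith
  have hℓ : 1 / 2 ≤ Real.log ε⁻¹ := by
    have : Real.log 2 ≤ Real.log ε⁻¹ :=
      Real.log_le_log (by norm_num) (by rw [le_inv_comm₀ (by norm_num) hε]; linarith)
    linarith [Real.log_two_gt_d9]
  let m : Fin k → ℝ := fun j => (energy (A j)).toReal
  have hm : ∀ j, energy (A j) = ENNReal.ofReal (m j) := fun j =>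
    (ENNReal.ofReal_toReal (energy_ne_top _)).symm
  have hm0 : ∀ j, 0 < m j := fun j => ENNReal.toReal_pos (h0 j) (energy_ne_top _)
  -- Both thresholds are chosen so that leaving the truncated region has probability of order `ε`
  -- for each `j`: `δ j` through the small ball estimate, `M j` through Chebyshev's inequality.
  let δ : Fin k → ℝ := fun j => ε ^ (2 * d j) * Real.sqrt (m j) / 4
  let M : Fin k → ℝ := fun j => Real.sqrt (m j / ε)
  have hδ : ∀ j, 0 < δ j := fun j => by
    have := Real.sqrt_pos.2 (hm0 j)
    simp only [δ]; positivity
  have hδM : ∀ j, δ j ≤ M j := by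
    intro j
    have h1 : Real.sqrt (m j) ≤ Real.sqrt (m j / ε) :=
      Real.sqrt_le_sqrt ((le_div_iff₀ hε).2 (by nlinarith [hm0 j]))
    have h2 : ε ^ (2 * d j) * Real.sqrt (m j) ≤ 1 * Real.sqrt (m j) := by
      gcongr; exact pow_le_one₀ hε.le hε1.le
    simp only [δ, M]
    linarith [Real.sqrt_nonneg (m j)]
  have hsub : smallProductEvent A ε ⊆
      ((⋃ j, {x | norm2 (evalAt (A j) x) ≤ δ j}) ∪ ⋃ j, {x | M j ≤ norm2 (evalAt (A j) x)}) ∪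
      (smallProductEvent A ε ∩
        {x | ∀ j, δ j ≤ norm2 (evalAt (A j) x) ∧ norm2 (evalAt (A j) x) ≤ M j}) := by
    intro x hx
    by_cases h : ∀ j, δ j ≤ norm2 (evalAt (A j) x) ∧ norm2 (evalAt (A j) x) ≤ M j
    · exact Or.inr ⟨hx, h⟩
    · push Not at h
      obtain ⟨j, hj⟩ := h
      refine Or.inl ?_
      rcases le_total (norm2 (evalAt (A j) x)) (δ j) with h1 | h1
      · exact Or.inl (Set.mem_iUnion.2 ⟨j, h1⟩)
      · exact Or.inr (Set.mem_iUnion.2 ⟨j, (hj h1).le⟩)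
  have hsmall : stdGauss (Fin n) (⋃ j, {x | norm2 (evalAt (A j) x) ≤ δ j}) ≤
      ∑ j, ENNReal.ofReal (19200 * ((d j : ℝ) + 1) ^ 2 * ε) :=
    (measure_iUnion_fintype_le _ _).trans (Finset.sum_le_sum fun j _ =>
      measure_small_ball_le (d j) (A j) (hdeg j) (m j) (hm0 j) (hm j) ε hε hε1)
  have hlarge : stdGauss (Fin n) (⋃ j, {x | M j ≤ norm2 (evalAt (A j) x)}) ≤
      ∑ _j : Fin k, ENNReal.ofReal ε :=
    (measure_iUnion_fintype_le _ _).trans (Finset.sum_le_sum fun j _ =>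
      measure_large_le (A j) (hm0 j) (hm j) hε)
  have hmain := measure_smallProductEvent_truncated_le A d hdeg δ M hδ hδM hε
  set ℓ := Real.log ε⁻¹ with hℓdef
  set X := (4:ℝ) ^ (∑ j, d j) * (12800 * Real.sqrt k) ^ (k + 1) * ℓ ^ k with hX
  have htails : stdGauss (Fin n) (⋃ j, {x | norm2 (evalAt (A j) x) ≤ δ j}) +
      stdGauss (Fin n) (⋃ j, {x | M j ≤ norm2 (evalAt (A j) x)}) ≤ ENNReal.ofReal (ε * X) := by
    refine (add_le_add hsmall hlarge).trans ?_
    rw [← Finset.sum_add_distrib]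
    simp_rw [← ENNReal.ofReal_add (show (0:ℝ) ≤ 19200 * ((d _ : ℝ) + 1) ^ 2 * ε by positivity) hε.le]
    rw [← ENNReal.ofReal_sum_of_nonneg fun j _ => by positivity]
    refine ENNReal.ofReal_le_ofReal ?_
    calc ∑ j, (19200 * ((d j : ℝ) + 1) ^ 2 * ε + ε)
        = ε * ∑ j, (19200 * ((d j : ℝ) + 1) ^ 2 + 1) := by
          rw [Finset.mul_sum]; exact Finset.sum_congr rfl fun j _ => by ring
      _ ≤ ε * X := by gcongr; exact tail_bound_le hk d hℓ
  have hmain' : stdGauss (Fin n) (smallProductEvent A ε ∩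
        {x | ∀ j, δ j ≤ norm2 (evalAt (A j) x) ∧ norm2 (evalAt (A j) x) ≤ M j}) ≤
      ENNReal.ofReal (ε * X) := by
    refine hmain.trans (ENNReal.ofReal_le_ofReal (mul_le_mul_of_nonneg_left ?_ hε.le))
    refine truncated_bound_le hk d (fun j => Real.log (2 * M j / δ j)) (fun j => ?_) fun j => ?_
    · exact Real.log_nonneg (by rw [one_le_div (hδ j)]; linarith [hδ j, hδM j])
    · exact log_truncation_ratio_le (hm0 j) hε hε2 (d j)
  calc stdGauss (Fin n) (smallProductEvent A ε) ≤ ENNReal.ofReal (ε * X) +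
        ENNReal.ofReal (ε * X) :=
        (measure_mono hsub).trans ((measure_union_le _ _).trans
          (add_le_add ((measure_union_le _ _).trans htails) hmain'))
    _ = ENNReal.ofReal (ε * (2 * X)) := by
        rw [← ENNReal.ofReal_add (by positivity) (by positivity)]; congr 1; ring
    _ ≤ _ := by
        refine ENNReal.ofReal_le_ofReal ?_
        have h2 : 2 * (12800 * Real.sqrt k) ^ (k + 1) ≤ (25600 * Real.sqrt k) ^ (k + 1) := by
          rw [show 25600 * Real.sqrt k = 2 * (12800 * Real.sqrt k) by ring, mul_pow 2]
          refine mul_le_mul_of_nonneg_right ?_ (by positivity)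
          exact le_self_pow₀ (by norm_num) (by omega)
        calc ε * (2 * X) = ε * 4 ^ (∑ j, d j) * (2 * (12800 * Real.sqrt k) ^ (k + 1)) * ℓ ^ k := by
              rw [hX]; ring
          _ ≤ _ := by gcongr

end Assembly
end StrongAnticoncentration

theorem mainTheorem10 :
    ∃ C₁ C₂ : ℝ, 0 < C₁ ∧ 0 < C₂ ∧
      ∀ (k n : ℕ) (d : Fin k → ℕ) (S : Fin k → Type) [∀ j, Fintype (S j)]
        (A : (j : Fin k) → StrongAnticoncentration.TensorPoly n (S j)),
        (∀ j s, (A j s).totalDegree ≤ d j) →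
        ∀ ε : ℝ, 0 < ε → ε < 1 / 2 →
          (StrongAnticoncentration.gaussian n).real
              {x | ∏ j, StrongAnticoncentration.norm2 (StrongAnticoncentration.evalAt (A j) x) <
                ε * StrongAnticoncentration.norm2 (StrongAnticoncentration.wedge
                  (StrongAnticoncentration.tensorProd fun j =>
                    StrongAnticoncentration.evalAt
                      (StrongAnticoncentration.derivative (A j)) x))} ≤
            ε * (2 : ℝ) ^ (C₁ * ∑ j, (d j : ℝ)) * (C₂ * Real.sqrt k) ^ (k + 1) *
              Real.log ε⁻¹ ^ k := by
  refine ⟨2, 25600, by norm_num, by norm_num, ?_⟩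
  intro k n d S _ A hdeg ε hε hε2
  have hlog : 0 ≤ Real.log ε⁻¹ := Real.log_nonneg ((one_le_inv₀ hε).2 (by linarith))
  have hpow : (2:ℝ) ^ (2 * ∑ j, (d j : ℝ)) = 4 ^ (∑ j, d j) := by
    rw [← Nat.cast_sum, Real.rpow_mul (by norm_num), Real.rpow_natCast]
    norm_num
  rw [hpow]
  rcases Nat.eq_zero_or_pos k with rfl | hk
  -- For `k = 0` the bound is zero because of `√0`, so the event must be empty. It is: the empty
  -- product and the norm of the wedge are both `1`, and `1 < ε` is false.
  · have hempty : {x : Fin n → ℝ | ∏ j, StrongAnticoncentration.norm2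
        (StrongAnticoncentration.evalAt (A j) x) < ε * StrongAnticoncentration.norm2
          (StrongAnticoncentration.wedge (StrongAnticoncentration.tensorProd fun j =>
            StrongAnticoncentration.evalAt (StrongAnticoncentration.derivative (A j)) x))} = ∅ := by
      ext x
      simp only [Set.mem_ofPred_eq, Set.mem_empty_iff_false, iff_false, not_lt]
      simp [StrongAnticoncentration.norm2, StrongAnticoncentration.wedge,
        StrongAnticoncentration.tensorProd]
      linarith
    rw [hempty]
    simp
  · refine ENNReal.toReal_le_of_le_ofReal (by positivity) ?_
    exact StrongAnticoncentration.measure_smallProductEvent_le A hk d hdeg hε hε2
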